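/- Link diagrams are diagrams in $S^2$. A tied link diagram is a (nonempty) link diagram together with a partition of its set of components; two components are tied together if they lie in the same class. A tie joining two components unites their classes. Let $L$ be the Kauffman polynomial: the unique function from unoriented link diagrams to $\mathbb Z[a^{\pm1},z^{\pm1}]$ that equals $1$ on the circle without crossings, is invariant under planar isotopy and Reidemeister moves II and III, is multiplied by $a^{\pm1}$ when a curl of sign $\pm1$ is inserted, and satisfies $L(D_+)+L(D_-)=z\,(L(D_0)+L(D_\infty))$, where the four diagrams agree outside a disc in which they show a crossing, the opposite crossing, and its two smoothings. Let $\mathcal L$ be the Kauffman polynomial of tied links: the unique function from unoriented tied link diagrams to $\mathbb Z[a^{\pm1},z^{\pm1},x^{-1}]$ that equals $1$ on the circle without crossings, is invariant under planar isotopy and Reidemeister moves II and III, is multiplied by $a^{\pm1}$ when a curl of sign $\pm1$ is inserted, satisfies $\mathcal L(D\sqcup\bigcirc)=x^{-1}\mathcal L(D)$ for a disjoint circle not tied to $D$, and satisfies $\mathcal L(D_+)+\mathcal L(D_-)=z\,(\mathcal L(D_e)+\mathcal L(D_f))$, where $D_e,D_f$ are the two smoothings of the crossing with a tie added between the two strands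 in the disc. For an oriented diagram $\overrightarrow D$ of a link (respectively, of a tied link) with writhe $w(D)$ and underlying unoriented diagram $D$, put $\widehat L(\overrightarrow D)=a^{-w(D)}L(D)$ (respectively, $\widehat{\mathcal L}(\overrightarrow D)=a^{-w(D)}\mathcal L(D)$). Let $\overrightarrow D^{\nsim}$ be the classical oriented link diagram obtained from $\overrightarrow D$ by forgetting all ties. **Proposition.** For every oriented tied link diagram $\overrightarrow D$ whose components are all tied together, $$\widehat{\mathcal L}(\overrightarrow D)=\widehat L(\overrightarrow D^{\nsim})$$ in $\mathbb Z[a^{\pm1},z^{\pm1},x^{-1}]$. In particular $\widehat L(\overrightarrow D^{\nsim})$ is obtained from $\widehat{\mathcal L}(\overrightarrow D)$ by the specialization $x=\dfrac{z}{a+a^{-1}-z}$, i.e. $x^{-1}=(a+a^{-1})z^{-1}-1$. -/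

import Mathlib

namespace TiedLinks

/-! ### Sliced link diagrams

A link diagram in general position with respect to a height function is read from bottom to top as
a word of elementary events: minima (`cup`), maxima (`cap`) and crossings (`cross`).  Between two
events one sees a finite row of strands.  Every strand carries a label which is transported along
the link; a label may change to its "reverse" at an extremum.  With the label types
* `Unit` one gets unoriented diagrams,
* `Dir` (is the strand travelled upwards or downwards?) one gets oriented diagrams,
* `ℕ` (colours, constant along each component) one gets unoriented tied diagrams: a set partition
  of the components, two components being tied together when they have the same colour,
* `ℕ × Dir` one gets oriented tied diagrams. -/

/-- Labels of strands, with the reversal that takes place between the two legs of an extremum. -/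
class StrandLabel (X : Type) where
  rev : X → X
  rev_rev : ∀ x, rev (rev x) = x

open StrandLabel

/-- The direction in which a strand of an oriented diagram is travelled. -/
inductive Dir
  | up
  | down
  deriving DecidableEq

/-- The opposite direction. -/
def Dir.opp : Dir → Dir
  | .up => .down
  | .down => .up

instance : StrandLabel Unit := ⟨fun x => x, fun _ => rfl⟩

instance : StrandLabel ℕ := ⟨fun x => x, fun _ => rfl⟩

instance : StrandLabel Dir := ⟨Dir.opp, fun x => by cases x <;> rfl⟩

instance {X Y : Type} [StrandLabel X] [StrandLabel Y] : StrandLabel (X × Y) :=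
  ⟨fun q => (rev q.1, rev q.2), fun q => by simp [rev_rev]⟩

/-- Elementary events; `p` is the number of strands to the left of the event.
* `cup p x`: a minimum, whose left leg is labelled `x` and whose right leg is labelled `rev x`;
* `cap p x`: a maximum, whose left leg is labelled `x` and whose right leg is labelled `rev x`;
* `cross p b x y`: the strand labelled `x` goes from bottom left to top right, the strand labelled
  `y` goes from bottom right to top left; the former passes over the latter iff `b = true`. -/
inductive Event (X : Type)
  | cup (p : ℕ) (x : X)
  | cap (p : ℕ) (x : X)
  | cross (p : ℕ) (b : Bool) (x y : X)

namespace Event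

variable {X Y : Type}

/-- The number of strands to the left of the event. -/
def pos : Event X → ℕ
  | cup p _ => p
  | cap p _ => p
  | cross p _ _ _ => p

/-- Number of strands entering from below. -/
def inArity : Event X → ℕ
  | cup _ _ => 0
  | cap _ _ => 2
  | cross _ _ _ _ => 2

/-- Number of strands leaving at the top. -/
def outArity : Event X → ℕ
  | cup _ _ => 2
  | cap _ _ => 0
  | cross _ _ _ _ => 2

/-- Move the event `k` strands to the right. -/
def shift (k : ℕ) : Event X → Event X
  | cup p x => cup (p + k) x
  | cap p x => cap (p + k) x
  | cross p b x y => cross (p + k) b x y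

/-- Relabel the strands. -/
def map (f : X → Y) : Event X → Event Y
  | cup p x => cup p (f x)
  | cap p x => cap p (f x)
  | cross p b x y => cross p b (f x) (f y)

/-- The labels occurring in an event (up to reversal). -/
def labels : Event X → List X
  | cup _ x => [x]
  | cap _ x => [x]
  | cross _ _ x y => [x, y]

end Event

open Event

variable {X Y : Type}

/-- `Step e S S'`: the event `e` can be applied to the row of strands `S`, and produces `S'`. -/
inductive Step [StrandLabel X] : Event X → List X → List X → Prop
  | cup (l r : List X) (x : X) : Step (cup l.length x) (l ++ r) (l ++ x :: rev x :: r)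
  | cap (l r : List X) (x : X) : Step (cap l.length x) (l ++ x :: rev x :: r) (l ++ r)
  | cross (l r : List X) (b : Bool) (x y : X) :
      Step (cross l.length b x y) (l ++ x :: y :: r) (l ++ y :: x :: r)

/-- `IsTangle w S S'`: the word `w` is a tangle diagram with bottom strands `S`, top strands `S'`. -/
inductive IsTangle [StrandLabel X] : List (Event X) → List X → List X → Prop
  | nil (S : List X) : IsTangle [] S S
  | cons {e : Event X} {w : List (Event X)} {S S' S'' : List X} :
      Step e S S' → IsTangle w S' S'' → IsTangle (e :: w) S S''

/-- A (nonempty) link diagram, labelled by `X`. -/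
structure Diagram (X : Type) [StrandLabel X] where
  word : List (Event X)
  word_ne_nil : word ≠ []
  isTangle : IsTangle word [] []

theorem Step.map [StrandLabel X] [StrandLabel Y] {f : X → Y}
    (hf : ∀ x, f (rev x) = rev (f x)) {e : Event X} {S S' : List X} (h : Step e S S') :
    Step (e.map f) (S.map f) (S'.map f) := by
  cases h with
  | cup l r x => simpa [Event.map, hf] using Step.cup (l.map f) (r.map f) (f x)
  | cap l r x => simpa [Event.map, hf] using Step.cap (l.map f) (r.map f) (f x)
  | cross l r b x y => simpa [Event.map] using Step.cross (l.map f) (r.map f) b (f x) (f y)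

theorem IsTangle.map [StrandLabel X] [StrandLabel Y] {f : X → Y}
    (hf : ∀ x, f (rev x) = rev (f x)) {w : List (Event X)} {S S' : List X}
    (h : IsTangle w S S') : IsTangle (w.map (Event.map f)) (S.map f) (S'.map f) := by
  induction h with
  | nil S => exact IsTangle.nil _
  | cons hs _ ih => exact IsTangle.cons (hs.map hf) ih

/-- Relabel a diagram along a map of labels that commutes with reversal. -/
def Diagram.map [StrandLabel X] [StrandLabel Y] (f : X → Y) (hf : ∀ x, f (rev x) = rev (f x))
    (D : Diagram X) : Diagram Y where
  word := D.word.map (Event.map f)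
  word_ne_nil := by simpa using D.word_ne_nil
  isTangle := by simpa using D.isTangle.map hf

/-! ### Regular isotopy -/

/-- Local moves: the planar isotopies of sliced diagrams and the Reidemeister moves II and III. -/
inductive LocalMove [StrandLabel X] : List (Event X) → List (Event X) → Prop
  /-- Two consecutive events which are side by side may be exchanged (`f` is to the right of `e`). -/
  | far (e f : Event X) :
      LocalMove [e, f.shift (e.pos + e.outArity)] [f.shift (e.pos + e.inArity), e]
  /-- A minimum followed by a maximum on the same strand may be straightened. -/
  | zigzagLeft (p : ℕ) (x : X) : LocalMove [cup (p + 1) (rev x), cap p x] []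
  /-- The mirror image of the previous move. -/
  | zigzagRight (p : ℕ) (x : X) : LocalMove [cup p x, cap (p + 1) (rev x)] []
  /-- A crossing may be turned around a minimum. -/
  | crossCup (p : ℕ) (b : Bool) (x y : X) :
      LocalMove [cup p x, cross (p + 1) b (rev x) y] [cup (p + 1) x, cross p (!b) y x]
  /-- A crossing may be turned around a maximum. -/
  | crossCap (p : ℕ) (b : Bool) (x y : X) :
      LocalMove [cross (p + 1) b y (rev x), cap p x] [cross p (!b) x y, cap (p + 1) x]
  /-- Reidemeister move II. -/
  | reidemeister2 (p : ℕ) (b : Bool) (x y : X) : LocalMove [cross p b x y, cross p (!b) y x] []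
  /-- Reidemeister move III; the condition says that one strand is above the two others and one is
  below the two others. -/
  | reidemeister3 (p : ℕ) (b₁ b₂ b₃ : Bool) (x y w : X) (hb : b₂ = b₁ ∨ b₂ = b₃) :
      LocalMove [cross p b₁ x y, cross (p + 1) b₂ x w, cross p b₃ y w]
        [cross (p + 1) b₃ y w, cross p b₂ x w, cross (p + 1) b₁ x y]

/-- Elementary regular isotopies of diagrams in the sphere. -/
inductive RegularMove [StrandLabel X] : Diagram X → Diagram X → Prop
  /-- A local move somewhere in the diagram. -/
  | isotopy (D D' : Diagram X) (u s t v : List (Event X)) (h : LocalMove s t)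
      (hD : D.word = u ++ s ++ v) (hD' : D'.word = u ++ t ++ v) : RegularMove D D'
  /-- The arc that closes up a tangle with one lower and one upper end point on its right is
  swept through the point at infinity of the sphere and closes it up on its left. -/
  | sphere (D D' : Diagram X) (t : List (Event X)) (x : X) (ht : IsTangle t [x] [x])
      (hD : D.word = [cup 0 x] ++ t ++ [cap 0 x])
      (hD' : D'.word = [cup 0 (rev x)] ++ t.map (Event.shift 1) ++ [cap 0 (rev x)]) :
      RegularMove D D'

/-- `IsCurl b k`: the word `k` is a curl on a single strand (on either side of the strand), whose
crossing is positive if `b = true` and negative if `b = false`. -/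
inductive IsCurl [StrandLabel X] : Bool → List (Event X) → Prop
  | right (p : ℕ) (b : Bool) (x : X) :
      IsCurl b [cup (p + 1) x, cross p b x x, cap (p + 1) x]
  | left (p : ℕ) (b : Bool) (x : X) :
      IsCurl b [cup p (rev x), cross (p + 1) b x x, cap p (rev x)]

/-! ### The polynomial rings -/

/-- The ring `ℤ[a^{±1}, z^{±1}]`: Laurent polynomials in `a` over Laurent polynomials in `z`. -/
abbrev KRing : Type := LaurentPolynomial (LaurentPolynomial ℤ)

/-- The ring `ℤ[a^{±1}, z^{±1}, x^{-1}]`; the polynomial variable `Polynomial.X` is `x^{-1}`. -/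
abbrev TRing : Type := Polynomial KRing

/-- The power `a ^ k`, for an integer `k`. -/
noncomputable def aPow (k : ℤ) : KRing := LaurentPolynomial.T k

/-- The power `z ^ k`, for an integer `k`. -/
noncomputable def zPow (k : ℤ) : KRing := LaurentPolynomial.C (LaurentPolynomial.T k)

/-- The sign `±1` of a curl. -/
def curlSign (b : Bool) : ℤ := if b then 1 else -1

/-! ### The Kauffman polynomial of unoriented links -/

/-- Kauffman's rules for the two-variable polynomial `L(a, z)` of unoriented link diagrams. -/
structure IsKauffman (F : Diagram Unit → KRing) : Prop where
  /-- The value on the circle without crossings is `1`. -/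
  circle : ∀ D : Diagram Unit, D.word = [cup 0 (), cap 0 ()] → F D = 1
  /-- Invariance under regular isotopy. -/
  regular : ∀ D D' : Diagram Unit, RegularMove D D' → F D = F D'
  /-- A positive curl contributes a factor `a`, a negative one a factor `a⁻¹`. -/
  curl : ∀ (D D' : Diagram Unit) (b : Bool) (u k v : List (Event Unit)), IsCurl b k →
    D.word = u ++ k ++ v → D'.word = u ++ v → F D = aPow (curlSign b) * F D'
  /-- The skein rule for a crossing, the opposite crossing and the two smoothings. -/
  skein : ∀ (Dp Dm D0 Dinf : Diagram Unit) (p : ℕ) (u v : List (Event Unit)),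
    Dp.word = u ++ [cross p true () ()] ++ v →
    Dm.word = u ++ [cross p false () ()] ++ v →
    D0.word = u ++ v →
    Dinf.word = u ++ [cap p (), cup p ()] ++ v →
    F Dp + F Dm = zPow 1 * (F D0 + F Dinf)

open Classical in
/-- The Kauffman polynomial `L`: the function defined by Kauffman's rules. -/
noncomputable def kauffman : Diagram Unit → KRing :=
  if h : ∃ F, IsKauffman F then h.choose else 0

/-! ### The Kauffman polynomial of unoriented tied links -/

/-- Two colours are merged: every `d` is replaced by `c`. -/
def mergeColour (c d : ℕ) : ℕ → ℕ := fun i => if i = d then c else i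

/-- The rules for the Kauffman polynomial of unoriented tied link diagrams. -/
structure IsTiedKauffman (F : Diagram ℕ → TRing) : Prop where
  /-- Only the partition of the components given by the colours matters, not their names. -/
  rename : ∀ (D : Diagram ℕ) (f : ℕ → ℕ), Function.Injective f →
    F (D.map f (fun _ => rfl)) = F D
  /-- The value on the circle without crossings is `1`. -/
  circle : ∀ (D : Diagram ℕ) (c : ℕ), D.word = [cup 0 c, cap 0 c] → F D = 1
  /-- Adding a disjoint circle which is not tied to any component gives a factor `x⁻¹`. -/
  disjointCircle : ∀ (D D' : Diagram ℕ) (c : ℕ), (∀ e ∈ D.word, c ∉ e.labels) →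
    D'.word = D.word ++ [cup 0 c, cap 0 c] → F D' = Polynomial.X * F D
  /-- Invariance under regular isotopy. -/
  regular : ∀ D D' : Diagram ℕ, RegularMove D D' → F D = F D'
  /-- A positive curl contributes a factor `a`, a negative one a factor `a⁻¹`. -/
  curl : ∀ (D D' : Diagram ℕ) (b : Bool) (u k v : List (Event ℕ)), IsCurl b k →
    D.word = u ++ k ++ v → D'.word = u ++ v →
    F D = Polynomial.C (aPow (curlSign b)) * F D'
  /-- The skein rule for a crossing between strands of colours `c` and `d`, the opposite crossing,
  and the two smoothings with a tie between their two strands (so that the classes `c` and `d`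
  are united in the whole diagram). -/
  skein : ∀ (Dp Dm De Df : Diagram ℕ) (p c d : ℕ) (u v : List (Event ℕ)),
    Dp.word = u ++ [cross p true c d] ++ v →
    Dm.word = u ++ [cross p false c d] ++ v →
    De.word = (u ++ v).map (Event.map (mergeColour c d)) →
    Df.word = (u ++ [cap p c, cup p c] ++ v).map (Event.map (mergeColour c d)) →
    F Dp + F Dm = Polynomial.C (zPow 1) * (F De + F Df)

open Classical in
/-- The Kauffman polynomial `𝓛` of tied links: the function defined by the rules above. -/
noncomputable def tiedKauffman : Diagram ℕ → TRing :=
  if h : ∃ F, IsTiedKauffman F then h.choose else 0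

/-! ### Oriented diagrams -/

/-- The sign of a crossing of an oriented diagram (`0` for the other events). -/
def eventSign : Event Dir → ℤ
  | cup _ _ => 0
  | cap _ _ => 0
  | cross _ b d d' => (if b then 1 else -1) * (if d = d' then 1 else -1)

/-- The writhe of an oriented diagram. -/
def writhe (D : Diagram Dir) : ℤ := (D.word.map eventSign).sum

/-- Forget the orientation of a classical diagram. -/
def unorient (D : Diagram Dir) : Diagram Unit := D.map (fun _ => ()) (fun _ => rfl)

/-- Forget the orientation of a tied diagram. -/
def unorientTied (D : Diagram (ℕ × Dir)) : Diagram ℕ := D.map Prod.fst (fun _ => rfl)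

/-- Forget all ties of an oriented tied diagram. -/
def forgetTies (D : Diagram (ℕ × Dir)) : Diagram Dir := D.map Prod.snd (fun _ => rfl)

/-- All components of the tied diagram are tied together. -/
def AllTied (D : Diagram (ℕ × Dir)) : Prop :=
  ∃ c : ℕ, ∀ e ∈ D.word, ∀ q ∈ e.labels, q.1 = c

/-- The Kauffman polynomial of oriented links, `a ^ (-w(D)) * L(D)`. -/
noncomputable def orientedKauffman (D : Diagram Dir) : KRing :=
  aPow (-writhe D) * kauffman (unorient D)

/-- The Kauffman polynomial of oriented tied links, `a ^ (-w(D)) * 𝓛(D)`. -/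
noncomputable def orientedTiedKauffman (D : Diagram (ℕ × Dir)) : TRing :=
  Polynomial.C (aPow (-writhe (forgetTies D))) * tiedKauffman (unorientTied D)

/-- The element `y = (a + a⁻¹) z⁻¹ - 1`, which is `1 / x` for `x = z / (a + a⁻¹ - z)`. -/
noncomputable def yElt : KRing := (aPow 1 + aPow (-1)) * zPow (-1) - 1

end TiedLinks

set_option linter.unusedSimpArgs false

/-! ### Words as tangles, and the value of a disjoint circle -/

namespace TiedLinks

open StrandLabel Event

/-! ### Rows of strands -/

/-! When all components carry one colour, merging the colours at a crossing changes nothing, and the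
tied skein rule is Kauffman's rule. So `fun D => G (D.monochrome c)` satisfies Kauffman's rules for
every tied polynomial `G` (`IsTiedKauffman.monochrome`), and so does the classical polynomial
followed by the inclusion of coefficients. Kauffman's rules have at most one solution, hence the two
agree. The writhe factors are equal, and the result is constant in `x⁻¹`, so the specialization does
not alter it.

Both polynomials are defined by choice, with value `0` if no function obeys the rules. Hence a
solution of one system must also produce a solution of the other. That a classical solution exists
is never needed.

Uniqueness (`KauffmanRules.unique`) is proved over an arbitrary domain, because it is applied to
values in `TRing`. Given two solutions, a tangle ending in `n` points is regarded as the functional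
sending each completion to its pair of values. The functionals of layered arcs, each lying over the
preceding ones, have a span `arcSpan` that is stable under minima, maxima and crossings
(`act_mem_arcSpan`). For `n = 0` this span is generated by the empty word, on which both normalised
solutions are `1`; so the two values of any closed diagram are the same scalar.

From a classical solution `F`, a tied one is built as a sum over colourings. Give each tie class one
of `N` colours; multiply the values of the sublinks of each colour, each with an additional circle,
and a sign which changes when a crossing of two different colours is switched. In the skein rule the
colourings that differ at the crossing cancel, and the others are exactly the colourings of the
merged diagrams (`totalValue_skein`). A new untied circle contributes `N * y` with `y = (a + a⁻¹)
z⁻¹ - 1`. Grouping the colourings by their partitions shows that the sum is `N * y` times a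
polynomial evaluated at `N * y` (`eval_tiedPolynomial`). That polynomial in `x⁻¹` obeys the tied
rules, since it does so at infinitely many points. -/

theorem IsTangle.append {X : Type} [StrandLabel X] {u v : List (Event X)} {S S' S'' : List X}
    (hu : IsTangle u S S') (hv : IsTangle v S' S'') : IsTangle (u ++ v) S S'' := by
  induction hu with
  | nil S => exact hv
  | cons hs _ ih => exact IsTangle.cons hs (ih hv)

theorem IsTangle.split {X : Type} [StrandLabel X] {u v : List (Event X)} {S S'' : List X}
    (h : IsTangle (u ++ v) S S'') : ∃ S', IsTangle u S S' ∧ IsTangle v S' S'' := by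
  induction u generalizing S with
  | nil => exact ⟨S, IsTangle.nil _, h⟩
  | cons e u ih =>
    cases h with
    | cons hs ht =>
      obtain ⟨S', h1, h2⟩ := ih ht
      exact ⟨S', IsTangle.cons hs h1, h2⟩

/-- The strands entering an event from below. -/
def Event.ins {X : Type} [StrandLabel X] : Event X → List X
  | cup _ _ => []
  | cap _ x => [x, rev x]
  | cross _ _ x y => [x, y]

/-- The strands leaving an event at the top. -/
def Event.outs {X : Type} [StrandLabel X] : Event X → List X
  | cup _ x => [x, rev x]
  | cap _ _ => []
  | cross _ _ x y => [y, x]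

section Rows

variable {X : Type} [StrandLabel X]

@[simp] theorem Event.length_ins (e : Event X) : e.ins.length = e.inArity := by
  cases e <;> rfl

@[simp] theorem Event.length_outs (e : Event X) : e.outs.length = e.outArity := by
  cases e <;> rfl

theorem step_iff {e : Event X} {S S' : List X} :
    Step e S S' ↔ ∃ l r, l.length = e.pos ∧ S = l ++ e.ins ++ r ∧ S' = l ++ e.outs ++ r := by
  constructor
  · rintro (⟨l, r, x⟩ | ⟨l, r, x⟩ | ⟨l, r, b, x, y⟩) <;>
      exact ⟨l, r, rfl, by simp [ins], by simp [outs]⟩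
  · rintro ⟨l, r, h, rfl, rfl⟩
    cases e with
    | cup p x => obtain rfl : l.length = p := h; simpa [ins, outs] using Step.cup l r x
    | cap p x => obtain rfl : l.length = p := h; simpa [ins, outs] using Step.cap l r x
    | cross p b x y =>
      obtain rfl : l.length = p := h; simpa [ins, outs] using Step.cross l r b x y

theorem Step.unique {e : Event X} {S S' S'' : List X} (h : Step e S S') (h' : Step e S S'') :
    S' = S'' := by
  obtain ⟨l, r, hl, rfl, rfl⟩ := step_iff.1 h
  obtain ⟨l', r', hl', h1, rfl⟩ := step_iff.1 h'
  obtain ⟨h2, rfl⟩ := List.append_inj h1 (by simp [hl, hl'])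
  rw [List.append_cancel_right h2]

theorem IsTangle.unique {w : List (Event X)} {S S' S'' : List X} (h : IsTangle w S S')
    (h' : IsTangle w S S'') : S' = S'' := by
  induction h with
  | nil S => cases h'; rfl
  | cons hs _ ih =>
    cases h' with
    | cons hs' ht' => cases hs.unique hs'; exact ih ht'

end Rows

/-- `w` is an unlabelled tangle with `n` lower and `m` upper end points. -/
def Tan (w : List (Event Unit)) (n m : ℕ) : Prop :=
  IsTangle w (List.replicate n ()) (List.replicate m ())

theorem unit_list_eq (S : List Unit) : S = List.replicate S.length () :=
  List.eq_replicate_of_mem fun _ _ => rfl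

theorem step_unit_iff {e : Event Unit} {n m : ℕ} :
    Step e (List.replicate n ()) (List.replicate m ()) ↔
      e.pos + e.inArity ≤ n ∧ m + e.inArity = n + e.outArity := by
  rw [step_iff]
  constructor
  · rintro ⟨l, r, hl, h1, h2⟩
    have h1 := congrArg List.length h1
    have h2 := congrArg List.length h2
    simp at h1 h2
    omega
  · rintro ⟨h1, h2⟩
    refine ⟨List.replicate e.pos (), List.replicate (n - e.pos - e.inArity) (), by simp, ?_, ?_⟩
    · rw [unit_list_eq (_ ++ _)]; simp; omega
    · rw [unit_list_eq (_ ++ _)]; simp; omega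

theorem tan_nil {n m : ℕ} : Tan [] n m ↔ n = m := by
  constructor
  · intro h
    have : List.replicate n () = List.replicate m () := by
      unfold Tan at h
      generalize List.replicate n () = S at h
      generalize List.replicate m () = S' at h
      cases h; rfl
    simpa using congrArg List.length this
  · rintro rfl; exact IsTangle.nil _

theorem tan_cons {e : Event Unit} {w : List (Event Unit)} {n m : ℕ} :
    Tan (e :: w) n m ↔ e.pos + e.inArity ≤ n ∧ Tan w (n - e.inArity + e.outArity) m := by
  constructor
  · intro h
    cases h with
    | @cons _ _ _ S' _ hs ht =>
      rw [unit_list_eq S', step_unit_iff] at hs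
      rw [unit_list_eq S'] at ht
      refine ⟨hs.1, ?_⟩
      have : n - e.inArity + e.outArity = S'.length := by omega
      rw [this]; exact ht
  · rintro ⟨h1, h2⟩
    exact IsTangle.cons (step_unit_iff.2 ⟨h1, by omega⟩) h2

theorem tan_append {u v : List (Event Unit)} {n m : ℕ} :
    Tan (u ++ v) n m ↔ ∃ k, Tan u n k ∧ Tan v k m := by
  constructor
  · intro h
    obtain ⟨S, h1, h2⟩ := IsTangle.split h
    rw [unit_list_eq S] at h1 h2
    exact ⟨_, h1, h2⟩
  · rintro ⟨k, h1, h2⟩; exact IsTangle.append h1 h2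

theorem Tan.unique {w : List (Event Unit)} {n m m' : ℕ} (h : Tan w n m) (h' : Tan w n m') :
    m = m' := by
  simpa using congrArg List.length (IsTangle.unique h h')

theorem Tan.append_right_iff {u v : List (Event Unit)} {n k m : ℕ} (h : Tan u n k) :
    Tan (u ++ v) n m ↔ Tan v k m := by
  rw [tan_append]
  constructor
  · rintro ⟨k', h1, h2⟩; rwa [h.unique h1]
  · exact fun h' => ⟨k, h, h'⟩

theorem tan_cup {p n m : ℕ} {w : List (Event Unit)} :
    Tan (cup p () :: w) n m ↔ p ≤ n ∧ Tan w (n + 2) m := by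
  simp [tan_cons, pos, inArity, outArity]

theorem tan_cap {p n m : ℕ} {w : List (Event Unit)} :
    Tan (cap p () :: w) n m ↔ p + 2 ≤ n ∧ Tan w (n - 2) m := by
  simp [tan_cons, pos, inArity, outArity]

theorem tan_cross {p n m : ℕ} {b : Bool} {w : List (Event Unit)} :
    Tan (cross p b () () :: w) n m ↔ p + 2 ≤ n ∧ Tan w n m := by
  rw [tan_cons]
  simp only [pos, inArity, outArity]
  refine and_congr_right fun h => ?_
  rw [Nat.sub_add_cancel (by omega)]

/-! ### Values on words -/

/-- Invertible elements `a` and `z` of a commutative ring. -/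
structure SkeinParams (R : Type) [CommRing R] where
  a : R
  aInv : R
  z : R
  zInv : R
  mul_aInv : a * aInv = 1
  mul_zInv : z * zInv = 1

namespace SkeinParams

variable {R : Type} [CommRing R] (P : SkeinParams R)

/-- The factor of a curl. -/
def curl (b : Bool) : R := if b then P.a else P.aInv

/-- The factor of a disjoint circle. -/
def circle : R := (P.a + P.aInv) * P.zInv - 1

end SkeinParams

variable {R : Type} [CommRing R]

/-- Kauffman's rules, with values in a commutative ring with parameters. -/
structure KauffmanRules (P : SkeinParams R) (F : Diagram Unit → R) : Prop where
  circle : ∀ D : Diagram Unit, D.word = [cup 0 (), cap 0 ()] → F D = 1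
  regular : ∀ D D' : Diagram Unit, RegularMove D D' → F D = F D'
  curl : ∀ (D D' : Diagram Unit) (b : Bool) (u k v : List (Event Unit)), IsCurl b k →
    D.word = u ++ k ++ v → D'.word = u ++ v → F D = P.curl b * F D'
  skein : ∀ (Dp Dm D0 Dinf : Diagram Unit) (p : ℕ) (u v : List (Event Unit)),
    Dp.word = u ++ [cross p true () ()] ++ v →
    Dm.word = u ++ [cross p false () ()] ++ v →
    D0.word = u ++ v →
    Dinf.word = u ++ [cap p (), cup p ()] ++ v →
    F Dp + F Dm = P.z * (F D0 + F Dinf)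

open Classical in
/-- The value of `F` on a word, extended by zero to words that are not diagrams. -/
noncomputable def wordValue (F : Diagram Unit → R) (w : List (Event Unit)) : R :=
  if h : w ≠ [] ∧ Tan w 0 0 then F ⟨w, h.1, h.2⟩ else 0

theorem wordValue_eq {F : Diagram Unit → R} (D : Diagram Unit) : wordValue F D.word = F D := by
  rw [wordValue, dif_pos ⟨D.word_ne_nil, D.isTangle⟩]

theorem wordValue_mk {F : Diagram Unit → R} {w : List (Event Unit)} (h : w ≠ [])
    (h' : Tan w 0 0) : wordValue F w = F ⟨w, h, h'⟩ := by
  rw [wordValue, dif_pos ⟨h, h'⟩]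

namespace KauffmanRules

variable {P : SkeinParams R} {F : Diagram Unit → R} (hF : KauffmanRules P F)

include hF

theorem word_move {s t u v : List (Event Unit)} (h : LocalMove s t) (h1 : u ++ s ++ v ≠ [])
    (h2 : u ++ t ++ v ≠ []) (h3 : Tan (u ++ s ++ v) 0 0) (h4 : Tan (u ++ t ++ v) 0 0) :
    wordValue F (u ++ s ++ v) = wordValue F (u ++ t ++ v) := by
  rw [wordValue_mk h1 h3, wordValue_mk h2 h4]
  exact hF.regular _ _ (.isotopy _ _ u s t v h rfl rfl)

theorem word_curl {b : Bool} {k u v : List (Event Unit)} (h : IsCurl b k) (h2 : u ++ v ≠ [])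
    (h3 : Tan (u ++ k ++ v) 0 0) (h4 : Tan (u ++ v) 0 0) :
    wordValue F (u ++ k ++ v) = P.curl b * wordValue F (u ++ v) := by
  have h1 : u ++ k ++ v ≠ [] := by cases h <;> simp
  rw [wordValue_mk h1 h3, wordValue_mk h2 h4]
  exact hF.curl _ _ b u k v h rfl rfl

theorem word_skein {p n : ℕ} {u v : List (Event Unit)} (hu : Tan u 0 n) (hp : p + 2 ≤ n)
    (hv : Tan v n 0) :
    wordValue F (u ++ [cross p true () ()] ++ v) + wordValue F (u ++ [cross p false () ()] ++ v) =
      P.z * (wordValue F (u ++ v) + wordValue F (u ++ [cap p (), cup p ()] ++ v)) := by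
  have hne : u ++ v ≠ [] := by
    rintro h
    simp only [List.append_eq_nil_iff] at h
    rw [h.1, tan_nil] at hu
    omega
  have h1 (b : Bool) : Tan (u ++ [cross p b () ()] ++ v) 0 0 := by
    rw [List.append_assoc, hu.append_right_iff]; exact tan_cross.2 ⟨hp, hv⟩
  have h2 : Tan (u ++ [cap p (), cup p ()] ++ v) 0 0 := by
    rw [List.append_assoc, hu.append_right_iff]
    refine tan_cap.2 ⟨hp, tan_cup.2 ⟨by omega, ?_⟩⟩
    rwa [Nat.sub_add_cancel (by omega)]
  rw [wordValue_mk (by simp) (h1 true), wordValue_mk (by simp) (h1 false),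
    wordValue_mk hne (hu.append_right_iff.2 hv), wordValue_mk (by simp) h2]
  exact hF.skein _ _ _ _ p u v rfl rfl rfl rfl

-- The skein rule for a kink on a strand: its two signs give `a` and `a⁻¹` times `f`, its smoothings
-- are the strand with a separate circle (value `g`) and the strand alone (value `f`).
omit hF in
theorem circle_of_curls {f g : R} (h : P.a * f + P.aInv * f = P.z * (g + f)) :
    g = P.circle * f := by
  unfold SkeinParams.circle
  linear_combination -P.zInv * h + (-g - f) * P.mul_zInv

/-- A circle next to a strand. -/
theorem word_circle_of_pos {p n : ℕ} {u v : List (Event Unit)} (hu : Tan u 0 n) (hp : p ≤ n)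
    (hn : 0 < n) (hv : Tan v n 0) :
    wordValue F (u ++ [cup p (), cap p ()] ++ v) = P.circle * wordValue F (u ++ v) := by
  have hne : u ++ v ≠ [] := by
    rintro h
    simp only [List.append_eq_nil_iff] at h
    rw [h.1, tan_nil] at hu
    omega
  have huv : Tan (u ++ v) 0 0 := hu.append_right_iff.2 hv
  apply circle_of_curls
  -- The circle is made to cross a neighbouring strand: the one on its right if `p = 0`, otherwise
  -- the one on its left. One smoothing leaves the circle, the other is a pair of zigzags.
  obtain ⟨q, hq, hcurl, hz1, hz2⟩ : ∃ q, q + 2 ≤ n + 2 ∧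
      (∀ b, IsCurl b [cup p (), cross q b () (), cap p ()]) ∧
      LocalMove [cup p (), cap q ()] [] ∧ LocalMove [cup q (), cap p ()] [] := by
    obtain _ | p := p
    · exact ⟨1, by omega, fun b => IsCurl.left 0 b (), LocalMove.zigzagRight 0 (),
        LocalMove.zigzagLeft 0 ()⟩
    · exact ⟨p, by omega, fun b => IsCurl.right p b (), LocalMove.zigzagLeft p (),
        LocalMove.zigzagRight p ()⟩
  have hu' : Tan (u ++ [cup p ()]) 0 (n + 2) := by
    rw [hu.append_right_iff]; exact tan_cup.2 ⟨hp, tan_nil.2 rfl⟩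
  have hv' : Tan (cap p () :: v) (n + 2) 0 := tan_cap.2 ⟨by omega, by simpa using hv⟩
  have key := hF.word_skein hu' hq hv'
  have hc (b : Bool) := hF.word_curl (u := u) (v := v) (hcurl b) hne
    (by rw [List.append_assoc, hu.append_right_iff]
        simp [tan_cup, tan_cross, tan_cap, hv, hp, hq]) huv
  have e1 (b : Bool) : u ++ [cup p ()] ++ [cross q b () ()] ++ cap p () :: v =
    u ++ [cup p (), cross q b () (), cap p ()] ++ v := by simp
  rw [e1, e1, hc, hc] at key
  have e2 : u ++ [cup p ()] ++ [cap q (), cup q ()] ++ cap p () :: v =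
    u ++ [cup p (), cap q ()] ++ (cup q () :: cap p () :: v) := by simp
  have h3 : Tan (cup q () :: cap p () :: v) n 0 := tan_cup.2 ⟨by omega, hv'⟩
  rw [e2, hF.word_move hz1 (by simp) (by simp)
    (by rw [List.append_assoc, hu.append_right_iff]
        simp only [List.cons_append, List.nil_append]
        refine tan_cup.2 ⟨hp, tan_cap.2 ⟨by omega, by simpa using h3⟩⟩)
    (by simpa using hu.append_right_iff.2 h3)] at key
  have e3 : u ++ [] ++ (cup q () :: cap p () :: v) = u ++ [cup q (), cap p ()] ++ v := by simp
  rw [e3, hF.word_move hz2 (by simp) (by simpa using hne)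
    (by simpa using hu.append_right_iff.2 h3) (by simpa using huv)] at key
  have e4 : u ++ [cup p ()] ++ cap p () :: v = u ++ [cup p (), cap p ()] ++ v := by simp
  rw [e4] at key
  simpa [SkeinParams.curl] using key

/-- A circle anywhere in a nonempty diagram. -/
theorem word_circle {p n : ℕ} {u v : List (Event Unit)} (hu : Tan u 0 n) (hp : p ≤ n)
    (hne : u ++ v ≠ []) (hv : Tan v n 0) :
    wordValue F (u ++ [cup p (), cap p ()] ++ v) = P.circle * wordValue F (u ++ v) := by
  obtain rfl | hn := Nat.eq_zero_or_pos n
  swap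
  · exact hF.word_circle_of_pos hu hp hn hv
  obtain rfl : p = 0 := by omega
  -- No strand is present at this height. The neighbouring event must be a maximum below or a
  -- minimum above; sliding the circle past it reaches a row of two strands.
  obtain _ | ⟨e, v⟩ := v
  · obtain rfl | ⟨u, e, rfl⟩ := List.eq_nil_or_concat u
    · simp at hne
    rw [List.concat_eq_append] at hu hne ⊢
    obtain ⟨k, hk, he⟩ := tan_append.1 hu
    rw [tan_cons, tan_nil] at he
    obtain ⟨q, ⟨⟩⟩ | ⟨q, ⟨⟩⟩ | ⟨q, b, ⟨⟩, ⟨⟩⟩ := e <;> simp only [pos, inArity, outArity] at he <;>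
      try omega
    obtain rfl : q = 0 := by omega
    obtain rfl : k = 2 := by omega
    have m1 : LocalMove [cap 0 (), cup 0 ()] [cup 2 (), cap 0 ()] :=
      LocalMove.far (cap 0 ()) (cup 0 ())
    have m2 : LocalMove [cap 0 (), cap 0 ()] [cap 2 (), cap 0 ()] :=
      LocalMove.far (cap 0 ()) (cap 0 ())
    have r1 := hF.word_move (u := u) (v := [cap 0 ()]) m1 (by simp) (by simp)
      (by rw [List.append_assoc, hk.append_right_iff]; simp [tan_cup, tan_cap, tan_nil])
      (by rw [List.append_assoc, hk.append_right_iff]; simp [tan_cup, tan_cap, tan_nil])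
    have r2 := hF.word_move (u := u ++ [cup 2 ()]) (v := []) m2 (by simp) (by simp)
      (by rw [List.append_assoc, List.append_assoc, hk.append_right_iff]
          simp [tan_cup, tan_cap, tan_nil])
      (by rw [List.append_assoc, List.append_assoc, hk.append_right_iff]
          simp [tan_cup, tan_cap, tan_nil])
    have r3 := hF.word_circle_of_pos (p := 2) (v := [cap 0 ()]) hk le_rfl (by omega)
      (by simp [tan_cap, tan_nil])
    simp only [List.append_assoc, List.cons_append, List.nil_append, List.append_nil] at *
    rw [r1, r2, r3]
  · have he := hv
    rw [tan_cons] at he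
    obtain ⟨q, ⟨⟩⟩ | ⟨q, ⟨⟩⟩ | ⟨q, b, ⟨⟩, ⟨⟩⟩ := e <;> simp only [pos, inArity, outArity] at he <;>
      try omega
    obtain rfl : q = 0 := by omega
    have hv2 : Tan v 2 0 := he.2
    have m1 : LocalMove [cup 0 (), cap 2 ()] [cap 0 (), cup 0 ()] :=
      LocalMove.far (cup 0 ()) (cap 0 ())
    have m2 : LocalMove [cup 0 (), cup 2 ()] [cup 0 (), cup 0 ()] :=
      LocalMove.far (cup 0 ()) (cup 0 ())
    have r1 := hF.word_move (u := u ++ [cup 0 ()]) (v := v) m1 (by simp) (by simp)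
      (by rw [List.append_assoc, List.append_assoc, hu.append_right_iff]
          simp [tan_cup, tan_cap, hv2])
      (by rw [List.append_assoc, List.append_assoc, hu.append_right_iff]
          simp [tan_cup, tan_cap, hv2])
    have r2 := hF.word_move (u := u) (v := cap 2 () :: v) m2 (by simp) (by simp)
      (by rw [List.append_assoc, hu.append_right_iff]
          simp [tan_cup, tan_cap, hv2])
      (by rw [List.append_assoc, hu.append_right_iff]
          simp [tan_cup, tan_cap, hv2])
    have hk : Tan (u ++ [cup 0 ()]) 0 2 := by
      rw [hu.append_right_iff]; simp [tan_cup, tan_nil]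
    have r3 := hF.word_circle_of_pos (p := 2) (v := v) hk le_rfl (by omega) hv2
    simp only [List.append_assoc, List.cons_append, List.nil_append, List.append_nil] at *
    rw [← r1, ← r2, r3]

end KauffmanRules

end TiedLinks

/-! ### Normalised rules, functionals of tangles, and local relations -/

namespace TiedLinks

open StrandLabel Event

variable {R : Type} [CommRing R]

/-! ### Kauffman's rules for words, normalised to be one on the empty word -/

/-- Kauffman's rules for functions on words of unlabelled events, normalised on the empty word. -/
structure WordRules (P : SkeinParams R) (Φ : List (Event Unit) → R) : Prop where
  eq_zero : ∀ {w}, ¬ Tan w 0 0 → Φ w = 0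
  nil : Φ [] = 1
  move : ∀ {s t u v : List (Event Unit)}, LocalMove s t → Tan (u ++ s ++ v) 0 0 →
    Tan (u ++ t ++ v) 0 0 → Φ (u ++ s ++ v) = Φ (u ++ t ++ v)
  curl : ∀ {b : Bool} {k u v : List (Event Unit)}, IsCurl b k → Tan (u ++ k ++ v) 0 0 →
    Tan (u ++ v) 0 0 → Φ (u ++ k ++ v) = P.curl b * Φ (u ++ v)
  skein : ∀ {p n : ℕ} {u v : List (Event Unit)}, Tan u 0 n → p + 2 ≤ n → Tan v n 0 →
    Φ (u ++ [cross p true () ()] ++ v) + Φ (u ++ [cross p false () ()] ++ v) =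
      P.z * (Φ (u ++ v) + Φ (u ++ [cap p (), cup p ()] ++ v))
  circle : ∀ {p n : ℕ} {u v : List (Event Unit)}, Tan u 0 n → p ≤ n → Tan v n 0 →
    Φ (u ++ [cup p (), cap p ()] ++ v) = P.circle * Φ (u ++ v)

/-- The value of the disjoint union with a circle. -/
noncomputable def circledValue (F : Diagram Unit → R) (w : List (Event Unit)) : R :=
  wordValue F (cup 0 () :: cap 0 () :: w)

theorem tan_circled {w : List (Event Unit)} {n : ℕ} :
    Tan (cup 0 () :: cap 0 () :: w) 0 n ↔ Tan w 0 n := by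
  simp [tan_cup, tan_cap]

/-- The empty word is not a diagram. An additional circle supplies a value for it, namely `1`, and
makes every surrounding diagram nonempty, so that the rules hold without exceptions. -/
theorem KauffmanRules.wordRules {P : SkeinParams R} {F : Diagram Unit → R}
    (hF : KauffmanRules P F) : WordRules P (circledValue F) where
  eq_zero h := dif_neg fun h' => h (tan_circled.1 h'.2)
  nil := by
    rw [circledValue, wordValue_mk (by simp) (by simp [tan_cup, tan_cap, tan_nil])]
    exact hF.circle _ rfl
  move h h1 h2 := hF.word_move (u := cup 0 () :: cap 0 () :: _) h (by simp) (by simp)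
    (tan_circled.2 h1) (tan_circled.2 h2)
  curl h h1 h2 := hF.word_curl (u := cup 0 () :: cap 0 () :: _) h (by simp)
    (tan_circled.2 h1) (tan_circled.2 h2)
  skein h1 h2 h3 := hF.word_skein (u := cup 0 () :: cap 0 () :: _) (tan_circled.2 h1) h2 h3
  circle h1 h2 h3 := hF.word_circle (u := cup 0 () :: cap 0 () :: _) (tan_circled.2 h1) h2
    (by simp) h3

theorem KauffmanRules.circledValue_eq {P : SkeinParams R} {F : Diagram Unit → R}
    (hF : KauffmanRules P F) (D : Diagram Unit) :
    circledValue F D.word = P.circle * F D := by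
  have := hF.word_circle (p := 0) (u := []) (v := D.word) (tan_nil.2 rfl) le_rfl D.word_ne_nil
    D.isTangle
  rw [← wordValue_eq (F := F) D]
  exact this

/-! ### Functionals on words -/

/-- Two sets of values on words. -/
abbrev Functional (R : Type) : Type := List (Event Unit) → R × R

/-- Composition of a functional with stacking below by the word `w`. -/
def act (w : List (Event Unit)) : Functional R →ₗ[R] Functional R :=
  LinearMap.funLeft R (R × R) fun v => w ++ v

theorem act_apply (w : List (Event Unit)) (φ : Functional R) (v : List (Event Unit)) :
    act w φ v = φ (w ++ v) := rfl

theorem act_act (u v : List (Event Unit)) (φ : Functional R) :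
    act v (act u φ) = act (u ++ v) φ := by
  ext w <;> simp [act_apply]

theorem act_nil (φ : Functional R) : act [] φ = φ := rfl

/-- The functional of a tangle without lower end points. -/
def vec (Φ Ψ : List (Event Unit) → R) (w : List (Event Unit)) : Functional R :=
  fun v => (Φ (w ++ v), Ψ (w ++ v))

theorem act_vec (Φ Ψ : List (Event Unit) → R) (u w : List (Event Unit)) :
    act w (vec Φ Ψ u) = vec Φ Ψ (u ++ w) := by
  ext v <;> simp [act_apply, vec]

/-- The span of the functionals of all tangles with `n` upper end points. -/
def tangleSpan (Φ Ψ : List (Event Unit) → R) (n : ℕ) : Submodule R (Functional R) :=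
  Submodule.span R (vec Φ Ψ '' {w | Tan w 0 n})

theorem vec_mem_tangleSpan {Φ Ψ : List (Event Unit) → R} {w : List (Event Unit)} {n : ℕ}
    (h : Tan w 0 n) : vec Φ Ψ w ∈ tangleSpan Φ Ψ n :=
  Submodule.subset_span ⟨w, h, rfl⟩

theorem tangleSpan_ext {Φ Ψ : List (Event Unit) → R} {n : ℕ} {S T : Functional R →ₗ[R] Functional R}
    (h : ∀ w, Tan w 0 n → S (vec Φ Ψ w) = T (vec Φ Ψ w)) {φ : Functional R}
    (hφ : φ ∈ tangleSpan Φ Ψ n) : S φ = T φ := by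
  refine LinearMap.eqOn_span (s := vec Φ Ψ '' {w | Tan w 0 n}) ?_ hφ
  rintro _ ⟨w, hw, rfl⟩
  exact h w hw

theorem act_mem_tangleSpan {Φ Ψ : List (Event Unit) → R} {w : List (Event Unit)} {n m : ℕ}
    (h : Tan w n m) {φ : Functional R} (hφ : φ ∈ tangleSpan Φ Ψ n) :
    act w φ ∈ tangleSpan Φ Ψ m := by
  refine (Submodule.span_le (p := (tangleSpan Φ Ψ m).comap (act (R := R) w))).2 ?_ hφ
  rintro _ ⟨u, hu, rfl⟩
  change act w (vec Φ Ψ u) ∈ tangleSpan Φ Ψ m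
  rw [act_vec]
  exact vec_mem_tangleSpan (tan_append.2 ⟨n, hu, h⟩)

/-- Two words act in the same way on the tangles with `n` upper end points. -/
def Sim (Φ Ψ : List (Event Unit) → R) (n : ℕ) (s t : List (Event Unit)) : Prop :=
  ∀ φ ∈ tangleSpan Φ Ψ n, act s φ = act t φ

section Sim

variable {Φ Ψ : List (Event Unit) → R} {n m k : ℕ} {s t u v : List (Event Unit)}

theorem Sim.refl (s : List (Event Unit)) : Sim Φ Ψ n s s := fun _ _ => rfl

theorem Sim.symm (h : Sim Φ Ψ n s t) : Sim Φ Ψ n t s := fun φ hφ => (h φ hφ).symm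

theorem Sim.trans (h : Sim Φ Ψ n s t) (h' : Sim Φ Ψ n t u) : Sim Φ Ψ n s u :=
  fun φ hφ => (h φ hφ).trans (h' φ hφ)

theorem Sim.append_right (h : Sim Φ Ψ n s t) (v : List (Event Unit)) :
    Sim Φ Ψ n (s ++ v) (t ++ v) := fun φ hφ => by
  rw [← act_act, ← act_act, h φ hφ]

theorem Sim.append_left (hu : Tan u n k) (h : Sim Φ Ψ k s t) : Sim Φ Ψ n (u ++ s) (u ++ t) :=
  fun φ hφ => by
    rw [← act_act, ← act_act, h _ (act_mem_tangleSpan hu hφ)]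

/-- A completion `v` closes up both words or neither; in the second case all values are zero by
`eq_zero`. -/
theorem Sim.of_move {P : SkeinParams R} (hΦ : WordRules P Φ) (hΨ : WordRules P Ψ)
    (h : LocalMove s t) (hs : Tan s n m) (ht : Tan t n m) : Sim Φ Ψ n s t := by
  refine fun φ hφ => tangleSpan_ext (fun w hw => ?_) hφ
  rw [act_vec, act_vec]
  funext v
  have h1 : Tan (w ++ s ++ v) 0 0 ↔ Tan v m 0 := (tan_append.2 ⟨n, hw, hs⟩ :).append_right_iff
  have h2 : Tan (w ++ t ++ v) 0 0 ↔ Tan v m 0 := (tan_append.2 ⟨n, hw, ht⟩ :).append_right_iff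
  by_cases hv : Tan v m 0
  · simp only [vec, hΦ.move h (h1.2 hv) (h2.2 hv), hΨ.move h (h1.2 hv) (h2.2 hv)]
  · simp only [vec, hΦ.eq_zero (mt h1.1 hv), hΦ.eq_zero (mt h2.1 hv), hΨ.eq_zero (mt h1.1 hv),
      hΨ.eq_zero (mt h2.1 hv)]

end Sim

/-! ### Local relations between words -/

theorem Event.shift_add {X : Type} (e : Event X) (k l : ℕ) :
    (e.shift k).shift l = e.shift (k + l) := by
  cases e <;> simp [shift, Nat.add_assoc]

theorem Event.shift_zero {X : Type} (e : Event X) : e.shift 0 = e := by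
  cases e <;> rfl

@[simp] theorem Event.pos_shift {X : Type} (e : Event X) (k : ℕ) :
    (e.shift k).pos = e.pos + k := by
  cases e <;> rfl

@[simp] theorem Event.inArity_shift {X : Type} (e : Event X) (k : ℕ) :
    (e.shift k).inArity = e.inArity := by
  cases e <;> rfl

@[simp] theorem Event.outArity_shift {X : Type} (e : Event X) (k : ℕ) :
    (e.shift k).outArity = e.outArity := by
  cases e <;> rfl

/-- A strand moves `k` places to the left, to position `j`, over the other strands. -/
def overLeft (j : ℕ) : ℕ → List (Event Unit)
  | 0 => []
  | k + 1 => cross (j + k) false () () :: overLeft j k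

theorem tan_overLeft {j k n : ℕ} (h : k = 0 ∨ j + k < n) : Tan (overLeft j k) n n := by
  induction k with
  | zero => exact tan_nil.2 rfl
  | succ k ih => exact tan_cross.2 ⟨by omega, ih (by omega)⟩

theorem overLeft_add (j i k : ℕ) : overLeft j (i + k) = overLeft (j + i) k ++ overLeft j i := by
  induction k with
  | zero => simp [overLeft]
  | succ k ih =>
    rw [← Nat.add_assoc, overLeft, ih, overLeft, List.cons_append, Nat.add_assoc]

theorem overLeft_succ (j k : ℕ) :
    overLeft j (k + 1) = overLeft (j + 1) k ++ [cross j false () ()] := by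
  rw [Nat.add_comm k 1, overLeft_add]; rfl

/-- An arc is inserted, with its right leg on the far right of `j + k` strands and its left leg
moved to position `j`. -/
def overArc (j k : ℕ) : List (Event Unit) := cup (j + k) () :: overLeft j k

theorem tan_overArc {j k n : ℕ} (h : j + k = n) : Tan (overArc j k) n (n + 2) :=
  tan_cup.2 ⟨h.le, tan_overLeft (by omega)⟩

theorem overArc_succ (j k : ℕ) :
    overArc j (k + 1) = overArc (j + 1) k ++ [cross j false () ()] := by
  rw [overArc, overArc, overLeft_succ, List.cons_append, Nat.add_right_comm, Nat.add_assoc]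

section Relations

variable {P : SkeinParams R} {Φ Ψ : List (Event Unit) → R} (hΦ : WordRules P Φ)
  (hΨ : WordRules P Ψ)

include hΦ hΨ

theorem sim_far (e f : Event Unit) {n : ℕ} (h : e.pos + e.inArity + f.pos + f.inArity ≤ n) :
    Sim Φ Ψ n [e, f.shift (e.pos + e.outArity)] [f.shift (e.pos + e.inArity), e] := by
  refine Sim.of_move hΦ hΨ (m := n - e.inArity + e.outArity - f.inArity + f.outArity)
    (.far e f) ?_ ?_
  · rw [tan_cons, tan_cons, tan_nil]; simp; omega
  · rw [tan_cons, tan_cons, tan_nil]; simp; omega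

theorem sim_step (u v : List (Event Unit)) {s t : List (Event Unit)} (h : LocalMove s t)
    {n : ℕ} (k m : ℕ) (hu : Tan u n k) (hs : Tan s k m) (ht : Tan t k m) :
    Sim Φ Ψ n (u ++ s ++ v) (u ++ t ++ v) :=
  (Sim.append_left hu (Sim.of_move hΦ hΨ h hs ht)).append_right v

theorem act_curl {b : Bool} {k : List (Event Unit)} (h : IsCurl b k) {n : ℕ} (hk : Tan k n n)
    {φ : Functional R} (hφ : φ ∈ tangleSpan Φ Ψ n) : act k φ = P.curl b • φ := by
  refine tangleSpan_ext (T := P.curl b • LinearMap.id) (fun w hw => ?_) hφ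
  rw [act_vec]
  funext v
  have h1 : Tan (w ++ k ++ v) 0 0 ↔ Tan v n 0 := (tan_append.2 ⟨n, hw, hk⟩ :).append_right_iff
  have h2 : Tan (w ++ v) 0 0 ↔ Tan v n 0 := hw.append_right_iff
  by_cases hv : Tan v n 0
  · simp [vec, hΦ.curl h (h1.2 hv) (h2.2 hv), hΨ.curl h (h1.2 hv) (h2.2 hv),
      -List.append_assoc]
  · simp [vec, hΦ.eq_zero (mt h1.1 hv), hΦ.eq_zero (mt h2.1 hv), hΨ.eq_zero (mt h1.1 hv),
      hΨ.eq_zero (mt h2.1 hv), -List.append_assoc]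

theorem act_circle {p n : ℕ} (h : p ≤ n) {φ : Functional R} (hφ : φ ∈ tangleSpan Φ Ψ n) :
    act [cup p (), cap p ()] φ = P.circle • φ := by
  refine tangleSpan_ext (T := P.circle • LinearMap.id) (fun w hw => ?_) hφ
  rw [act_vec]
  funext v
  have hk : Tan [cup p (), cap p ()] n n := by simp [tan_cup, tan_cap, tan_nil, h]
  have h1 : Tan (w ++ [cup p (), cap p ()] ++ v) 0 0 ↔ Tan v n 0 :=
    (tan_append.2 ⟨n, hw, hk⟩ :).append_right_iff
  have h2 : Tan (w ++ v) 0 0 ↔ Tan v n 0 := hw.append_right_iff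
  by_cases hv : Tan v n 0
  · simp [vec, hΦ.circle hw h hv, hΨ.circle hw h hv, -List.append_assoc]
  · simp [vec, hΦ.eq_zero (mt h1.1 hv), hΦ.eq_zero (mt h2.1 hv), hΨ.eq_zero (mt h1.1 hv),
      hΨ.eq_zero (mt h2.1 hv), -List.append_assoc]

theorem act_skein {p n : ℕ} (h : p + 2 ≤ n) {φ : Functional R} (hφ : φ ∈ tangleSpan Φ Ψ n) :
    act [cross p true () ()] φ + act [cross p false () ()] φ =
      P.z • (φ + act [cap p (), cup p ()] φ) := by
  refine tangleSpan_ext (S := act [cross p true () ()] + act [cross p false () ()])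
    (T := P.z • (LinearMap.id + act [cap p (), cup p ()])) (fun w hw => ?_) hφ
  simp only [LinearMap.add_apply, LinearMap.smul_apply, LinearMap.id_apply, act_vec]
  funext v
  have hx (b : Bool) : Tan [cross p b () ()] n n := tan_cross.2 ⟨h, tan_nil.2 rfl⟩
  have hk : Tan [cap p (), cup p ()] n n := by simp only [tan_cup, tan_cap, tan_nil, and_true]; omega
  have h1 (b : Bool) : Tan (w ++ [cross p b () ()] ++ v) 0 0 ↔ Tan v n 0 :=
    (tan_append.2 ⟨n, hw, hx b⟩ :).append_right_iff
  have h2 : Tan (w ++ [cap p (), cup p ()] ++ v) 0 0 ↔ Tan v n 0 :=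
    (tan_append.2 ⟨n, hw, hk⟩ :).append_right_iff
  have h3 : Tan (w ++ v) 0 0 ↔ Tan v n 0 := hw.append_right_iff
  by_cases hv : Tan v n 0
  · simp only [vec, Pi.add_apply, Pi.smul_apply, Prod.mk_add_mk, Prod.smul_mk, smul_eq_mul,
      hΦ.skein hw h hv, hΨ.skein hw h hv]
  · simp only [vec, Pi.add_apply, Pi.smul_apply, Prod.mk_add_mk, Prod.smul_mk, smul_eq_mul,
      hΦ.eq_zero (mt (h1 _).1 hv), hΦ.eq_zero (mt h2.1 hv), hΦ.eq_zero (mt h3.1 hv),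
      hΨ.eq_zero (mt (h1 _).1 hv), hΨ.eq_zero (mt h2.1 hv), hΨ.eq_zero (mt h3.1 hv),
      add_zero, mul_zero]

omit hΦ hΨ in
theorem far_of {X : Type} [StrandLabel X] {e f₁ f₂ : Event X} (f : Event X)
    (h₁ : f.shift (e.pos + e.outArity) = f₁) (h₂ : f.shift (e.pos + e.inArity) = f₂) :
    LocalMove [e, f₁] [f₂, e] := by
  subst h₁ h₂; exact LocalMove.far e f

/-- Put a curl of sign `!b` on the left leg of the minimum. Turning its crossing around its own
minimum flips the flag to `b`, and a zigzag then straightens, leaving the crossing on the two legs.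
-/
theorem act_cup_cross {p n : ℕ} (h : p ≤ n) (b : Bool) {φ : Functional R}
    (hφ : φ ∈ tangleSpan Φ Ψ n) :
    act [cup p (), cross p b () ()] φ = P.curl (!b) • act [cup p ()] φ := by
  have s1 : Sim Φ Ψ n [cup p (), cup p (), cross (p + 1) (!b) () (), cap p ()]
      [cup p (), cup (p + 2) (), cross (p + 1) (!b) () (), cap p ()] :=
    (sim_step hΦ hΨ [] [cross (p + 1) (!b) () (), cap p ()]
      (far_of (e := cup p ()) (cup 0 ()) (by simp [shift, pos, outArity])
      (by simp [shift, pos, inArity])) n (n + 4) (by simp only [tan_nil])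
      (by simp only [tan_cup, tan_nil, and_true]; omega) (by simp only [tan_cup, tan_nil, and_true]; omega)).symm
  have s2 : Sim Φ Ψ n [cup p (), cup (p + 2) (), cross (p + 1) (!b) () (), cap p ()]
      [cup p (), cup (p + 1) (), cross (p + 2) b () (), cap p ()] :=
    (sim_step hΦ hΨ [cup p ()] [cap p ()] (.crossCup (p + 1) b () ()) (n + 2) (n + 4)
      (by simp only [tan_cup, tan_nil, and_true]; omega)
      (by simp only [rev, tan_cup, tan_cross, tan_nil, and_true]; omega)
      (by simp only [tan_cup, tan_cross, tan_nil, and_true]; omega)).symm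
  have s3 : Sim Φ Ψ n [cup p (), cup (p + 1) (), cross (p + 2) b () (), cap p ()]
      [cup p (), cup (p + 1) (), cap p (), cross p b () ()] :=
    (sim_step hΦ hΨ [cup p (), cup (p + 1) ()] []
      (far_of (e := cap p ()) (cross 0 b () ()) (by simp [shift, pos, outArity])
      (by simp [shift, pos, inArity])) (n + 4) (n + 2) (by simp only [tan_cup, tan_nil, and_true]; omega)
      (by simp only [tan_cap, tan_cross, tan_nil, and_true]; omega)
      (by simp only [tan_cap, tan_cross, tan_nil, and_true]; omega)).symm
  have s4 : Sim Φ Ψ n [cup p (), cup (p + 1) (), cap p (), cross p b () ()]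
      [cup p (), cross p b () ()] :=
    sim_step hΦ hΨ [cup p ()] [cross p b () ()] (.zigzagLeft p ()) (n + 2) (n + 2)
      (by simp only [tan_cup, tan_nil, and_true]; omega)
      (by simp only [rev, tan_cap, tan_cup, tan_nil, and_true]; omega)
      (by simp only [tan_nil])
  rw [← (((s1.trans s2).trans s3).trans s4) φ hφ,
    ← act_curl hΦ hΨ (IsCurl.left p (!b) ()) (n := n + 2)
      (by simp only [rev, tan_cap, tan_cup, tan_cross, tan_nil, and_true]; omega)
      (act_mem_tangleSpan (by simp only [tan_cup, tan_nil, and_true]; omega) hφ), act_act]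
  rfl

/-- The argument for `act_cup_cross` upside down: a curl of sign `!b` below the maximum unfolds into
the crossing. -/
theorem act_cross_cap {p n : ℕ} (h : p + 2 ≤ n) (b : Bool) {φ : Functional R}
    (hφ : φ ∈ tangleSpan Φ Ψ n) :
    act [cross p b () (), cap p ()] φ = P.curl (!b) • act [cap p ()] φ := by
  have s1 : Sim Φ Ψ n [cup p (), cross (p + 1) (!b) () (), cap p (), cap p ()]
      [cup p (), cross (p + 1) (!b) () (), cap (p + 2) (), cap p ()] :=
    sim_step hΦ hΨ [cup p (), cross (p + 1) (!b) () ()] []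
      (far_of (e := cap p ()) (cap 0 ()) (by simp [shift, pos, outArity])
      (by simp [shift, pos, inArity])) (n + 2) (n - 2)
      (by simp only [tan_cup, tan_cross, tan_nil, and_true]; omega)
      (by simp only [tan_cap, tan_nil, and_true]; omega) (by simp only [tan_cap, tan_nil, and_true]; omega)
  have s2 : Sim Φ Ψ n [cup p (), cross (p + 1) (!b) () (), cap (p + 2) (), cap p ()]
      [cup p (), cross (p + 2) b () (), cap (p + 1) (), cap p ()] :=
    (sim_step hΦ hΨ [cup p ()] [cap p ()] (.crossCap (p + 1) b () ()) (n + 2) n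
      (by simp only [tan_cup, tan_nil, and_true]; omega)
      (by simp only [rev, tan_cap, tan_cross, tan_nil, and_true]; omega)
      (by simp only [tan_cap, tan_cross, tan_nil, and_true]; omega)).symm
  have s3 : Sim Φ Ψ n [cup p (), cross (p + 2) b () (), cap (p + 1) (), cap p ()]
      [cross p b () (), cup p (), cap (p + 1) (), cap p ()] :=
    sim_step hΦ hΨ [] [cap (p + 1) (), cap p ()]
      (far_of (e := cup p ()) (cross 0 b () ()) (by simp [shift, pos, outArity])
      (by simp [shift, pos, inArity])) n (n + 2) (by simp only [tan_nil])
      (by simp only [tan_cup, tan_cross, tan_nil, and_true]; omega)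
      (by simp only [tan_cup, tan_cross, tan_nil, and_true]; omega)
  have s4 : Sim Φ Ψ n [cross p b () (), cup p (), cap (p + 1) (), cap p ()]
      [cross p b () (), cap p ()] :=
    sim_step hΦ hΨ [cross p b () ()] [cap p ()] (.zigzagRight p ()) n n
      (by simp only [tan_cross, tan_nil, and_true]; omega)
      (by simp only [rev, tan_cap, tan_cup, tan_nil, and_true]; omega)
      (by simp only [tan_nil])
  have hc := act_curl hΦ hΨ (IsCurl.left p (!b) ()) (n := n)
      (by simp only [rev, tan_cap, tan_cup, tan_cross, tan_nil, and_true]; omega) hφ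
  rw [← (((s1.trans s2).trans s3).trans s4) φ hφ, ← map_smul, ← hc, act_act]
  rfl

theorem sim_cross_cross {p n : ℕ} (h : p + 2 ≤ n) (b : Bool) :
    Sim Φ Ψ n [cross p b () (), cross p (!b) () ()] [] :=
  Sim.of_move hΦ hΨ (m := n) (.reidemeister2 p b () ())
    (by simp only [tan_cross, tan_nil, and_true]; omega) (tan_nil.2 rfl)

/-- A strand passing over an event that lies on its left. -/
theorem sim_over_event (f : Event Unit) {n : ℕ} (h : f.pos + f.inArity < n) :
    Sim Φ Ψ n (overLeft f.pos f.inArity ++ [f.shift 1]) (f :: overLeft f.pos f.outArity) := by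
  obtain ⟨p, ⟨⟩⟩ | ⟨p, ⟨⟩⟩ | ⟨p, b, ⟨⟩, ⟨⟩⟩ := f <;> simp only [pos, inArity, outArity] at h ⊢
  · have s1 : Sim Φ Ψ n [cup p (), cross (p + 1) false () (), cross p false () ()]
        [cup (p + 1) (), cross p true () (), cross p false () ()] :=
      sim_step hΦ hΨ [] [cross p false () ()] (.crossCup p false () ()) n (n + 2)
        (tan_nil.2 rfl) (by simp only [rev, tan_cup, tan_cross, tan_nil, and_true]; omega)
        (by simp only [Bool.not_false, tan_cup, tan_cross, tan_nil, and_true]; omega)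
    have s2 : Sim Φ Ψ n [cup (p + 1) (), cross p true () (), cross p false () ()]
        [cup (p + 1) ()] :=
      sim_step hΦ hΨ [cup (p + 1) ()] [] (.reidemeister2 p true () ()) (n + 2) (n + 2)
        (by simp only [tan_cup, tan_nil, and_true]; omega)
        (by simp only [Bool.not_true, tan_cross, tan_nil, and_true]; omega) (by simp only [tan_nil])
    exact (s1.trans s2).symm
  · have s1 : Sim Φ Ψ n [cross (p + 1) false () (), cross p false () (), cap (p + 1) ()]
        [cross (p + 1) false () (), cross (p + 1) true () (), cap p ()] :=
      (sim_step hΦ hΨ [cross (p + 1) false () ()] [] (.crossCap p true () ()) n (n - 2)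
        (by simp only [tan_cross, tan_nil, and_true]; omega)
        (by simp only [rev, tan_cap, tan_cross, tan_nil, and_true]; omega)
        (by simp only [Bool.not_true, tan_cap, tan_cross, tan_nil, and_true]; omega)).symm
    have s2 : Sim Φ Ψ n [cross (p + 1) false () (), cross (p + 1) true () (), cap p ()]
        [cap p ()] :=
      sim_step hΦ hΨ [] [cap p ()] (.reidemeister2 (p + 1) false () ()) n n
        (by simp only [tan_nil])
        (by simp only [Bool.not_false, tan_cross, tan_nil, and_true]; omega) (by simp only [tan_nil])
    exact s1.trans s2
  · exact (Sim.of_move hΦ hΨ (m := n) (.reidemeister3 p b false false () () () (.inr rfl))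
      (by simp only [tan_cross, tan_nil, and_true]; omega) (by simp only [tan_cross, tan_nil, and_true]; omega)).symm

theorem sim_overLeft_left (e : Event Unit) (i k : ℕ) {n : ℕ}
    (h : e.pos + e.inArity + i + k < n) :
    Sim Φ Ψ n (overLeft (e.pos + e.inArity + i) k ++ [e])
      (e :: overLeft (e.pos + e.outArity + i) k) := by
  induction k with
  | zero => exact Sim.refl _
  | succ k ih =>
    refine (Sim.append_left (u := [cross (e.pos + e.inArity + i + k) false () ()])
      (k := n) (by simp only [tan_cross, tan_nil, and_true]; omega) (ih (by omega))).trans ?_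
    have := sim_far hΦ hΨ e (cross (i + k) false () ()) (n := n)
      (by simp only [pos, inArity] at *; omega)
    have := this.symm.append_right (overLeft (e.pos + e.outArity + i) k)
    simp only [shift, Nat.add_comm (i + k), ← Nat.add_assoc] at this
    exact this

theorem sim_overLeft_right (f : Event Unit) (j k : ℕ) {n : ℕ} (h : j + k < f.pos)
    (h' : f.pos + f.inArity ≤ n) :
    Sim Φ Ψ n (overLeft j k ++ [f]) (f :: overLeft j k) := by
  induction k with
  | zero => exact Sim.refl _
  | succ k ih =>
    refine (Sim.append_left (u := [cross (j + k) false () ()])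
      (k := n) (by simp only [tan_cross, tan_nil, and_true]; omega) (ih (by omega))).trans ?_
    obtain ⟨g, rfl⟩ : ∃ g : Event Unit, f = g.shift (j + k + 2) := by
      have ⟨i, hi⟩ := Nat.exists_eq_add_of_lt h
      rcases f with ⟨p, x⟩ | ⟨p, x⟩ | ⟨p, b, x, y⟩ <;> simp only [pos] at hi
      · exact ⟨cup i x, by simp only [shift]; congr 1; omega⟩
      · exact ⟨cap i x, by simp only [shift]; congr 1; omega⟩
      · exact ⟨cross i b x y, by simp only [shift]; congr 1; omega⟩
    simp only [pos_shift, inArity_shift] at h h'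
    exact (sim_far hΦ hΨ (cross (j + k) false () ()) g (n := n)
      (by simp only [pos, inArity] at *; omega)).append_right (overLeft j k)

/-- The path of the strand splits into a stretch to the right of `f`, one across `f` and one to the
left of `f`. The event is moved down past them in reverse order; crossing the middle stretch takes
the strand from its left to its right, which removes the shift by one. -/
theorem sim_overLeft_through (f : Event Unit) (j i k : ℕ) (hf : f.pos = j + i) {n : ℕ}
    (h : j + (i + f.inArity + k) < n) :
    Sim Φ Ψ n (overLeft j (i + f.inArity + k) ++ [f.shift 1])
      (f :: overLeft j (i + f.outArity + k)) := by
  have e1 (l : ℕ) : overLeft j (i + l + k) =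
      overLeft (f.pos + l) k ++ (overLeft f.pos l ++ overLeft j i) := by
    rw [overLeft_add, overLeft_add, hf, Nat.add_assoc]
  have h1 : Tan (overLeft (f.pos + f.inArity) k) n n := tan_overLeft (by omega)
  have h2 : Tan (overLeft f.pos f.inArity) n n := tan_overLeft (by omega)
  rw [e1, e1, List.append_assoc, List.append_assoc]
  have s1 := sim_overLeft_right hΦ hΨ (f.shift 1) j i (n := n) (by simp; omega) (by simp; omega)
  have s2 := (sim_over_event hΦ hΨ f (n := n) (by omega)).append_right (overLeft j i)
  have s3 := (sim_overLeft_left hΦ hΨ f 0 k (n := n) (by omega)).append_right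
    (overLeft f.pos f.outArity ++ overLeft j i)
  have s12 := Sim.append_left h2 s1
  simp only [List.append_assoc, List.cons_append, List.nil_append, Nat.add_zero] at s12 s2 s3
  exact (Sim.append_left h1 (s12.trans s2)).trans s3

/-- The whole arc, including its minimum, lies to the right of `e`. -/
theorem sim_overArc_left (e : Event Unit) (i k : ℕ) {n : ℕ}
    (h : n = e.pos + e.inArity + i + k) :
    Sim Φ Ψ n (overArc (e.pos + e.inArity + i) k ++ [e])
      (e :: overArc (e.pos + e.outArity + i) k) := by
  refine (Sim.append_left (u := [cup (e.pos + e.inArity + i + k) ()])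
      (k := n + 2) (by simp only [tan_cup, tan_nil, and_true]; omega)
      (sim_overLeft_left hΦ hΨ e i k (by omega))).trans ?_
  have := sim_far hΦ hΨ e (cup (i + k) ()) (n := n)
    (by simp only [pos, inArity] at *; omega)
  have := this.symm.append_right (overLeft (e.pos + e.outArity + i) k)
  simp only [shift, Nat.add_comm (i + k), ← Nat.add_assoc] at this
  exact this

/-- An event between the two legs of the arc lies beneath the path of the left leg, so it slides
down under that path and then past the minimum. -/
theorem sim_overArc_through (f : Event Unit) (j i k : ℕ) (hf : f.pos = j + i) {n : ℕ}
    (h : n = j + (i + f.inArity + k)) :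
    Sim Φ Ψ n (overArc j (i + f.inArity + k) ++ [f.shift 1])
      (f :: overArc j (i + f.outArity + k)) := by
  refine (Sim.append_left (u := [cup (j + (i + f.inArity + k)) ()])
      (k := n + 2) (by simp only [tan_cup, tan_nil, and_true]; omega)
      (sim_overLeft_through hΦ hΨ f j i k hf (by omega))).trans ?_
  have := sim_far hΦ hΨ f (cup k ()) (n := n)
    (by simp only [pos, inArity] at *; omega)
  have := this.symm.append_right (overLeft j (i + f.outArity + k))
  have e1 (l : ℕ) : k + (f.pos + l) = j + (i + l + k) := by omega
  simp only [shift, e1] at this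
  exact this

end Relations

end TiedLinks

/-! ### Layered arcs span, hence uniqueness of the Kauffman polynomial -/

namespace TiedLinks

open StrandLabel Event

variable {R : Type} [CommRing R]

/-! ### Layered arcs span -/

/-- The span of the functionals of the tangles made of arcs that lie over one another. -/
def arcSpan (Φ Ψ : List (Event Unit) → R) : ℕ → Submodule R (Functional R)
  | 0 => Submodule.span R {vec Φ Ψ []}
  -- The number of end points of a tangle that starts from the empty row is even.
  | 1 => ⊥
  | n + 2 => ⨆ (j : ℕ) (k : ℕ) (_ : j + k = n), (arcSpan Φ Ψ n).map (act (overArc j k))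

section

variable {Φ Ψ : List (Event Unit) → R}

theorem act_overArc_mem {n j k : ℕ} (h : j + k = n) {φ : Functional R}
    (hφ : φ ∈ arcSpan Φ Ψ n) : act (overArc j k) φ ∈ arcSpan Φ Ψ (n + 2) := by
  rw [arcSpan]
  exact Submodule.mem_iSup_of_mem j (Submodule.mem_iSup_of_mem k (Submodule.mem_iSup_of_mem h
    (Submodule.mem_map_of_mem hφ)))

theorem arcSpan_induction {n : ℕ} {T : Functional R →ₗ[R] Functional R}
    {S : Submodule R (Functional R)}
    (h : ∀ j k, j + k = n → ∀ φ ∈ arcSpan Φ Ψ n, T (act (overArc j k) φ) ∈ S)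
    {φ : Functional R} (hφ : φ ∈ arcSpan Φ Ψ (n + 2)) : T φ ∈ S := by
  rw [arcSpan] at hφ
  have : ⨆ (j : ℕ) (k : ℕ) (_ : j + k = n), (arcSpan Φ Ψ n).map (act (overArc j k)) ≤
      S.comap T := by
    refine iSup_le fun j => iSup_le fun k => iSup_le fun hjk => ?_
    rw [Submodule.map_le_iff_le_comap]
    exact fun φ hφ => h j k hjk φ hφ
  exact this hφ

theorem arcSpan_le_tangleSpan (n : ℕ) : arcSpan Φ Ψ n ≤ tangleSpan Φ Ψ n := by
  induction n using Nat.twoStepInduction with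
  | zero =>
    rw [arcSpan, Submodule.span_singleton_le_iff_mem]
    exact vec_mem_tangleSpan (tan_nil.2 rfl)
  | one => rw [arcSpan]; exact bot_le
  | more n ih _ =>
    exact fun φ hφ => arcSpan_induction (T := LinearMap.id)
      (fun j k h ψ hψ => act_mem_tangleSpan (tan_overArc h) (ih hψ)) hφ

end

section Closure

variable {P : SkeinParams R} {Φ Ψ : List (Event Unit) → R} (hΦ : WordRules P Φ)
  (hΨ : WordRules P Ψ)

include hΦ hΨ

/-- At the far right, a minimum is itself a new top arc. Anywhere else it slides below the top arc,
and induction applies to the fewer strands there. -/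
theorem act_cup_mem {n p : ℕ} (h : p ≤ n) {φ : Functional R} (hφ : φ ∈ arcSpan Φ Ψ n) :
    act [cup p ()] φ ∈ arcSpan Φ Ψ (n + 2) := by
  induction n using Nat.twoStepInduction generalizing p φ with
  | zero =>
    obtain rfl : p = 0 := by omega
    exact act_overArc_mem (j := 0) (k := 0) rfl hφ
  | one => rw [arcSpan, Submodule.mem_bot] at hφ; rw [hφ, map_zero]; exact zero_mem _
  | more n ih _ =>
    obtain rfl | h := h.eq_or_lt
    · exact act_overArc_mem (j := n + 2) (k := 0) rfl hφ
    refine arcSpan_induction (fun j k hjk ψ hψ => ?_) hφ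
    have hψ' := arcSpan_le_tangleSpan _ hψ
    rw [act_act]
    obtain hp | hp := le_or_gt p j
    · obtain ⟨i, rfl⟩ := Nat.exists_eq_add_of_le hp
      have := sim_overArc_left hΦ hΨ (cup p ()) i k (n := n) (by simp [pos, inArity, hjk]) ψ hψ'
      simp only [pos, inArity, outArity, Nat.add_zero] at this
      rw [this, ← List.singleton_append, ← act_act]
      exact act_overArc_mem (by omega) (ih (by omega) hψ)
    · obtain ⟨i, rfl⟩ := Nat.exists_eq_add_of_lt hp
      obtain ⟨l, rfl⟩ : ∃ l, k = i + l := ⟨k - i, by omega⟩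
      have := sim_overArc_through hΦ hΨ (cup (j + i) ()) j i l rfl (n := n)
        (by simp only [inArity]; omega) ψ hψ'
      simp only [inArity, outArity, Nat.add_zero, shift] at this
      rw [this, ← List.singleton_append, ← act_act]
      exact act_overArc_mem (by omega) (ih (by omega) hψ)

omit hΦ hΨ in
theorem act_overLeft_mem {n j k : ℕ}
    (hx : ∀ p < j + k, ∀ φ ∈ arcSpan Φ Ψ n, act [cross p false () ()] φ ∈ arcSpan Φ Ψ n)
    {φ : Functional R} (hφ : φ ∈ arcSpan Φ Ψ n) : act (overLeft j k) φ ∈ arcSpan Φ Ψ n := by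
  induction k generalizing φ with
  | zero => exact hφ
  | succ k ih =>
    rw [overLeft, ← List.singleton_append, ← act_act]
    exact ih (fun p hp => hx p (by omega)) (hx _ (by omega) _ hφ)

/-- A maximum joining the left leg of an arc to the strand on its left. -/
theorem act_cap_left_leg_mem {n : ℕ}
    (hx : ∀ p, p + 2 ≤ n → ∀ φ ∈ arcSpan Φ Ψ n, act [cross p true () ()] φ ∈ arcSpan Φ Ψ n)
    {j k : ℕ} (h : j + 1 + k = n) {φ : Functional R} (hφ : φ ∈ arcSpan Φ Ψ n) :
    act (overArc (j + 1) k ++ [cap j ()]) φ ∈ arcSpan Φ Ψ n := by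
  have hφ' := arcSpan_le_tangleSpan _ hφ
  induction k generalizing j φ with
  | zero =>
    have := Sim.of_move hΦ hΨ (n := n) (m := n) (.zigzagLeft j ())
      (by simp only [rev, tan_cup, tan_cap, tan_nil, and_true]; omega) (tan_nil.2 rfl) φ hφ'
    rwa [show overArc (j + 1) 0 ++ [cap j ()] = [cup (j + 1) (), cap j ()] from rfl, this]
  | succ k ih =>
    -- The last crossing of the path is turned around the maximum. It then lies to the left of the
    -- shortened arc and slides below it, where `hx` applies; the path has become one crossing
    -- shorter.
    have s1 := sim_step hΦ hΨ (overArc (j + 2) k) [] (.crossCap j false () ()) (n := n)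
      (n + 2) n (tan_overArc (by omega))
      (by simp only [rev, tan_cap, tan_cross, tan_nil, and_true]; omega)
      (by simp only [Bool.not_false, tan_cap, tan_cross, tan_nil, and_true]; omega)
    have s2 := (sim_overArc_left hΦ hΨ (cross j true () ()) 0 k (n := n)
      (by simp only [pos, inArity]; omega)).append_right [cap (j + 1) ()]
    have e : overArc (j + 1) (k + 1) ++ [cap j ()] =
        overArc (j + 2) k ++ [cross (j + 1) false () (), cap j ()] := by
      rw [overArc_succ]; simp
    simp only [List.append_assoc, List.cons_append, List.nil_append, List.append_nil, pos, rev,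
      inArity, outArity, Nat.add_zero, Bool.not_false] at s1 s2
    rw [e, s1 φ hφ', s2 φ hφ', ← List.singleton_append, ← act_act]
    exact ih (by omega) (hx _ (by omega) _ hφ) (act_mem_tangleSpan
      (by simp only [tan_cross, tan_nil, and_true]; omega) hφ')

/-- By the skein rule the two signs of a crossing add up to a combination of smoothings, which lies
in the span. So it is enough to treat whichever sign is convenient. -/
theorem act_cross_mem_of_neg {n p : ℕ} (h : p + 2 ≤ n + 2) (c : Bool)
    (hc : ∀ φ ∈ arcSpan Φ Ψ (n + 2), act [cap p ()] φ ∈ arcSpan Φ Ψ n) {φ : Functional R}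
    (hφ : φ ∈ arcSpan Φ Ψ (n + 2)) (h1 : act [cross p c () ()] φ ∈ arcSpan Φ Ψ (n + 2))
    (b : Bool) : act [cross p b () ()] φ ∈ arcSpan Φ Ψ (n + 2) := by
  have key := act_skein hΦ hΨ h (arcSpan_le_tangleSpan _ hφ)
  have h2 : P.z • (φ + act [cap p (), cup p ()] φ) ∈ arcSpan Φ Ψ (n + 2) := by
    refine Submodule.smul_mem _ _ (Submodule.add_mem _ hφ ?_)
    rw [show [cap p (), cup p ()] = [cap p ()] ++ [cup p ()] from rfl, ← act_act]
    exact act_cup_mem hΦ hΨ (by omega) (hc _ hφ)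
  rw [← key] at h2
  cases b <;> cases c
  · exact h1
  · exact (Submodule.add_mem_iff_right _ h1).1 h2
  · exact (Submodule.add_mem_iff_left _ h1).1 h2
  · exact h1

theorem act_cap_mem_of_lower {n : ℕ}
    (hcap : ∀ p, p + 2 ≤ n → ∀ φ ∈ arcSpan Φ Ψ n, act [cap p ()] φ ∈ arcSpan Φ Ψ (n - 2))
    (hx : ∀ p b, p + 2 ≤ n → ∀ φ ∈ arcSpan Φ Ψ n, act [cross p b () ()] φ ∈ arcSpan Φ Ψ n)
    {p : ℕ} (h : p ≤ n) {φ : Functional R} (hφ : φ ∈ arcSpan Φ Ψ (n + 2)) :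
    act [cap p ()] φ ∈ arcSpan Φ Ψ n := by
  refine arcSpan_induction (fun j k hjk ψ hψ => ?_) hφ
  have hψ' := arcSpan_le_tangleSpan _ hψ
  rw [act_act]
  -- For `p = n` the maximum uses the right leg of the top arc. It closes the arc to a circle if `k
  -- = 0`; otherwise it slides down to the first crossing of the path and makes a curl with it.
  obtain rfl | hp := h.eq_or_lt
  · obtain _ | k := k
    · obtain rfl : j = p := hjk
      have := act_circle hΦ hΨ le_rfl hψ'
      rw [show overArc j 0 ++ [cap j ()] = [cup j (), cap j ()] from rfl, this]
      exact Submodule.smul_mem _ _ hψ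
    · have s1 := Sim.append_left (Φ := Φ) (Ψ := Ψ) (n := p) (k := p + 2)
        (u := [cup p (), cross (j + k) false () ()])
        (by simp only [tan_cup, tan_cross, tan_nil, and_true]; omega)
        (sim_overLeft_right hΦ hΨ (cap p ()) j k (by simp only [pos]; omega)
          (by simp only [pos, inArity]; omega))
      have e : overArc j (k + 1) ++ [cap p ()] =
          [cup p (), cross (j + k) false () ()] ++ (overLeft j k ++ [cap p ()]) := by
        rw [overArc, overLeft, hjk]; rfl
      have hc := act_curl hΦ hΨ (IsCurl.right (j + k) false ()) (n := p)
        (by simp only [tan_cup, tan_cap, tan_cross, tan_nil, and_true]; omega) hψ'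
      have e2 : [cup p (), cross (j + k) false () ()] ++ cap p () :: overLeft j k =
          [cup (j + k + 1) (), cross (j + k) false () (), cap (j + k + 1) ()] ++
            overLeft j k := by
        rw [← hjk]; rfl
      rw [e, s1 _ hψ', e2, ← act_act, hc, map_smul]
      exact Submodule.smul_mem _ _
        (act_overLeft_mem (fun q hq => hx q false (by omega)) hψ)
  -- The position of the maximum relative to the left leg `j`. Away from that leg it slides below
  -- the arc. If it joins the leg to its right neighbour, the last crossing of the path sits under
  -- the maximum and is a curl factor, which leaves the case of the left neighbour.
  obtain hj | rfl | rfl | hj : p + 2 ≤ j ∨ p + 1 = j ∨ p = j ∨ j < p := by omega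
  · obtain ⟨i, rfl⟩ := Nat.exists_eq_add_of_le hj
    have := sim_overArc_left hΦ hΨ (cap p ()) i k (n := n) (by simp [pos, inArity, hjk]) ψ hψ'
    simp only [pos, inArity, outArity, Nat.add_zero] at this
    rw [this, ← List.singleton_append, ← act_act]
    obtain ⟨m, rfl⟩ : ∃ m, n = m + 2 := ⟨n - 2, by omega⟩
    exact act_overArc_mem (by omega) (hcap _ (by omega) _ hψ)
  · exact act_cap_left_leg_mem hΦ hΨ (fun q => hx q true) hjk hψ
  · obtain ⟨k, rfl⟩ : ∃ l, k = l + 1 := ⟨k - 1, by omega⟩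
    have e : overArc p (k + 1) ++ [cap p ()] =
        overArc (p + 1) k ++ [cross p false () (), cap p ()] := by
      rw [overArc_succ]; simp
    rw [e, ← act_act, act_cross_cap hΦ hΨ (n := n + 2) (by omega) false
      (act_mem_tangleSpan (tan_overArc (by omega)) hψ'), act_act]
    exact Submodule.smul_mem _ _
      (act_cap_left_leg_mem hΦ hΨ (fun q => hx q true) (by omega) hψ)
  · obtain ⟨i, rfl⟩ := Nat.exists_eq_add_of_lt hj
    obtain ⟨l, rfl⟩ : ∃ l, k = i + 2 + l := ⟨k - (i + 2), by omega⟩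
    have := sim_overArc_through hΦ hΨ (cap (j + i) ()) j i l rfl (n := n)
      (by simp only [inArity]; omega) ψ hψ'
    simp only [inArity, outArity, Nat.add_zero, shift] at this
    rw [this, ← List.singleton_append, ← act_act]
    obtain ⟨m, rfl⟩ : ∃ m, n = m + 2 := ⟨n - 2, by omega⟩
    exact act_overArc_mem (by omega) (hcap _ (by omega) _ hψ)

theorem act_cross_mem_of_lower {n : ℕ}
    (hcap : ∀ p, p ≤ n → ∀ φ ∈ arcSpan Φ Ψ (n + 2), act [cap p ()] φ ∈ arcSpan Φ Ψ n)
    (hx : ∀ p b, p + 2 ≤ n → ∀ φ ∈ arcSpan Φ Ψ n, act [cross p b () ()] φ ∈ arcSpan Φ Ψ n)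
    {p : ℕ} (h : p ≤ n) (b : Bool) {φ : Functional R} (hφ : φ ∈ arcSpan Φ Ψ (n + 2)) :
    act [cross p b () ()] φ ∈ arcSpan Φ Ψ (n + 2) := by
  -- Crossings that avoid the rightmost strand come first, since the remaining case `p = n` produces
  -- a path of such crossings.
  have hlow : ∀ p < n, ∀ b, ∀ φ ∈ arcSpan Φ Ψ (n + 2),
      act [cross p b () ()] φ ∈ arcSpan Φ Ψ (n + 2) := by
    intro p hp b φ hφ
    refine arcSpan_induction (fun j k hjk ψ hψ => ?_) hφ
    have hψ' := arcSpan_le_tangleSpan _ hψ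
    obtain hj | rfl | rfl | hj : p + 2 ≤ j ∨ p + 1 = j ∨ p = j ∨ j < p := by omega
    · obtain ⟨i, rfl⟩ := Nat.exists_eq_add_of_le hj
      have := sim_overArc_left hΦ hΨ (cross p b () ()) i k (n := n)
        (by simp [pos, inArity, hjk]) ψ hψ'
      simp only [pos, inArity, outArity, Nat.add_zero] at this
      rw [act_act, this, ← List.singleton_append, ← act_act]
      exact act_overArc_mem (by omega) (hx _ _ (by omega) _ hψ)
    -- With flag `false` the crossing just prolongs the path of the left leg by one place.
    · refine act_cross_mem_of_neg hΦ hΨ (by omega) false (hcap p hp.le)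
        (act_overArc_mem hjk hψ) ?_ b
      rw [act_act, ← overArc_succ]
      exact act_overArc_mem (by omega) hψ
    -- With flag `true` the crossing cancels the last crossing of the path by Reidemeister II.
    · obtain ⟨k, rfl⟩ : ∃ l, k = l + 1 := ⟨k - 1, by omega⟩
      refine act_cross_mem_of_neg hΦ hΨ (by omega) true (hcap p hp.le)
        (act_overArc_mem hjk hψ) ?_ b
      have e : overArc p (k + 1) ++ [cross p true () ()] =
          overArc (p + 1) k ++ [cross p false () (), cross p true () ()] := by
        rw [overArc_succ]; simp
      have s := sim_cross_cross hΦ hΨ (p := p) (n := n + 2) (by omega) false _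
        (act_mem_tangleSpan (tan_overArc (j := p + 1) (k := k) (by omega)) hψ')
      rw [Bool.not_false, act_nil] at s
      rw [act_act, e, ← act_act, s]
      exact act_overArc_mem (by omega) hψ
    · obtain ⟨i, rfl⟩ := Nat.exists_eq_add_of_lt hj
      obtain ⟨l, rfl⟩ : ∃ l, k = i + 2 + l := ⟨k - (i + 2), by omega⟩
      have := sim_overArc_through hΦ hΨ (cross (j + i) b () ()) j i l rfl (n := n)
        (by simp only [inArity]; omega) ψ hψ'
      simp only [inArity, outArity, Nat.add_zero, shift] at this
      rw [act_act, this, ← List.singleton_append, ← act_act]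
      exact act_overArc_mem (by omega) (hx _ _ (by omega) _ hψ)
  obtain rfl | hp := h.eq_or_lt
  swap
  · exact hlow p hp b φ hφ
  refine arcSpan_induction (fun j k hjk ψ hψ => ?_) hφ
  have hψ' := arcSpan_le_tangleSpan _ hψ
  obtain _ | k := k
  · obtain rfl : j = p := hjk
    rw [act_act, show overArc j 0 ++ [cross j b () ()] = [cup j (), cross j b () ()] from rfl,
      act_cup_cross hΦ hΨ le_rfl b hψ']
    exact Submodule.smul_mem _ _ (act_cup_mem hΦ hΨ le_rfl hψ)
  · refine act_cross_mem_of_neg hΦ hΨ (by omega) false (hcap p le_rfl)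
      (act_overArc_mem hjk hψ) ?_ b
    -- The crossing slides down past all of the path but its first crossing. That one, turned around
    -- the minimum, becomes its inverse, so the pair cancels; what remains is a minimum followed by
    -- crossings covered by `hlow`.
    obtain rfl : p = j + k + 1 := by omega
    have s1 := Sim.append_left (Φ := Φ) (Ψ := Ψ) (n := j + k + 1) (k := j + k + 3)
      (u := [cup (j + k + 1) (), cross (j + k) false () ()])
      (by simp only [tan_cup, tan_cross, tan_nil, and_true]; omega)
      (sim_overLeft_right hΦ hΨ (cross (j + k + 1) false () ()) j k (by simp only [pos]; omega)
        (by simp only [pos, inArity]; omega))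
    have s2 := sim_step hΦ hΨ [] (cross (j + k + 1) false () () :: overLeft j k)
      (.crossCup (j + k) true () ()) (n := j + k + 1) (j + k + 1) (j + k + 3) (tan_nil.2 rfl)
      (by simp only [rev, tan_cup, tan_cross, tan_nil, and_true]; omega)
      (by simp only [Bool.not_true, tan_cup, tan_cross, tan_nil, and_true]; omega)
    have s3 := sim_step hΦ hΨ [cup (j + k) ()] (overLeft j k)
      (.reidemeister2 (j + k + 1) true () ()) (n := j + k + 1) (j + k + 3) (j + k + 3)
      (by simp only [tan_cup, tan_nil, and_true]; omega)
      (by simp only [Bool.not_true, tan_cross, tan_nil, and_true]; omega) (tan_nil.2 rfl)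
    have e : overArc j (k + 1) ++ [cross (j + k + 1) false () ()] =
        [cup (j + k + 1) (), cross (j + k) false () ()] ++
          (overLeft j k ++ [cross (j + k + 1) false () ()]) := rfl
    rw [act_act, e]
    have := ((s1.trans s2.symm).trans s3) ψ hψ'
    rw [this, List.append_nil, ← act_act]
    exact act_overLeft_mem (fun q hq => hlow q (by omega) false)
      (act_cup_mem hΦ hΨ (by omega) hψ)

theorem act_cap_cross_mem (n : ℕ) :
    (∀ p, p + 2 ≤ n → ∀ φ ∈ arcSpan Φ Ψ n, act [cap p ()] φ ∈ arcSpan Φ Ψ (n - 2)) ∧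
    (∀ p b, p + 2 ≤ n → ∀ φ ∈ arcSpan Φ Ψ n, act [cross p b () ()] φ ∈ arcSpan Φ Ψ n) := by
  induction n using Nat.twoStepInduction with
  | zero => exact ⟨fun p h => by omega, fun p b h => by omega⟩
  | one => exact ⟨fun p h => by omega, fun p b h => by omega⟩
  | more n ih _ =>
    have hcap : ∀ p, p ≤ n → ∀ φ ∈ arcSpan Φ Ψ (n + 2), act [cap p ()] φ ∈ arcSpan Φ Ψ n :=
      fun p h φ hφ => act_cap_mem_of_lower hΦ hΨ ih.1 ih.2 h hφ
    exact ⟨fun p h => hcap p (by omega), fun p b h φ hφ =>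
      act_cross_mem_of_lower hΦ hΨ hcap ih.2 (by omega) b hφ⟩

theorem act_mem_arcSpan {w : List (Event Unit)} {n m : ℕ} (h : Tan w n m) {φ : Functional R}
    (hφ : φ ∈ arcSpan Φ Ψ n) : act w φ ∈ arcSpan Φ Ψ m := by
  induction w generalizing n φ with
  | nil => obtain rfl := tan_nil.1 h; exact hφ
  | cons e w ih =>
    rw [← List.singleton_append, ← act_act]
    obtain ⟨p, ⟨⟩⟩ | ⟨p, ⟨⟩⟩ | ⟨p, b, ⟨⟩, ⟨⟩⟩ := e
    · exact ih (tan_cup.1 h).2 (act_cup_mem hΦ hΨ (tan_cup.1 h).1 hφ)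
    · exact ih (tan_cap.1 h).2 ((act_cap_cross_mem hΦ hΨ n).1 p (tan_cap.1 h).1 φ hφ)
    · exact ih (tan_cross.1 h).2 ((act_cap_cross_mem hΦ hΨ n).2 p b (tan_cross.1 h).1 φ hφ)

/-- Without end points the span consists of the multiples of the functional of the empty word.
Evaluated there it is `(1, 1)`, so both values of `w` equal the same coefficient. -/
theorem WordRules.unique : Φ = Ψ := by
  funext w
  by_cases h : Tan w 0 0
  · have := act_mem_arcSpan hΦ hΨ h (φ := vec Φ Ψ [])
      (by rw [arcSpan]; exact Submodule.mem_span_singleton_self _)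
    rw [arcSpan, Submodule.mem_span_singleton] at this
    obtain ⟨r, hr⟩ := this
    have := congrFun hr []
    simp only [Pi.smul_apply, vec, act_apply, List.append_nil, List.nil_append, Prod.smul_mk,
      hΦ.nil, hΨ.nil, Prod.mk.injEq] at this
    rw [← this.1, ← this.2]
  · rw [hΦ.eq_zero h, hΨ.eq_zero h]

end Closure

/-- Kauffman's rules determine at most one function. -/
theorem KauffmanRules.unique [IsDomain R] {P : SkeinParams R} (hP : P.circle ≠ 0)
    {F G : Diagram Unit → R} (hF : KauffmanRules P F) (hG : KauffmanRules P G) : F = G := by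
  funext D
  apply mul_left_cancel₀ hP
  rw [← hF.circledValue_eq, ← hG.circledValue_eq, hF.wordRules.unique hG.wordRules]

end TiedLinks

/-! ### Sublinks cut out by a set of colours -/

namespace TiedLinks

open StrandLabel Event

/-! ### Sublinks of coloured diagrams -/

@[simp] theorem rev_nat (x : ℕ) : (rev x : ℕ) = x := rfl

/-- The part of an event with `k` remaining strands on its left that lies on the strands whose
colour satisfies `p`. -/
def restrictEvent (p : ℕ → Bool) (k : ℕ) : Event ℕ → List (Event Unit)
  | cup _ x => if p x then [cup k ()] else []
  | cap _ x => if p x then [cap k ()] else []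
  | cross _ b x y => if p x && p y then [cross k b () ()] else []

/-- The row of strands above an event. -/
def nextRow (e : Event ℕ) (S : List ℕ) : List ℕ :=
  S.take e.pos ++ e.outs ++ S.drop (e.pos + e.inArity)

/-- The part of a word above a row of strands that lies on the strands whose colour satisfies
`p`. -/
def restrict (p : ℕ → Bool) : List ℕ → List (Event ℕ) → List (Event Unit)
  | _, [] => []
  | S, e :: w => restrictEvent p ((S.take e.pos).countP p) e ++ restrict p (nextRow e S) w

theorem Step.nextRow_eq {e : Event ℕ} {S S' : List ℕ} (h : Step e S S') : nextRow e S = S' := by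
  obtain ⟨l, r, hl, rfl, rfl⟩ := step_iff.1 h
  have h1 : (l ++ e.ins ++ r).take e.pos = l := by simp [← hl]
  have h2 : (l ++ e.ins ++ r).drop (e.pos + e.inArity) = r := by
    rw [show e.pos + e.inArity = (l ++ e.ins).length by simp [hl], List.drop_left]
  rw [nextRow, h1, h2]

theorem restrict_append {p : ℕ → Bool} {u v : List (Event ℕ)} {S S' : List ℕ}
    (h : IsTangle u S S') : restrict p S (u ++ v) = restrict p S u ++ restrict p S' v := by
  induction h with
  | nil S => rfl
  | cons hs _ ih => rw [List.cons_append, restrict, restrict, hs.nextRow_eq, ih, List.append_assoc]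

/-- A dropped event does not change the number of selected strands, and a kept event keeps its
shape. This dichotomy serves to treat all kinds of events together. -/
theorem restrictEvent_cases (p : ℕ → Bool) (e : Event ℕ) :
    ((∀ k, restrictEvent p k e = []) ∧ e.ins.countP p = e.outs.countP p) ∨
      ∃ e₀ : Event Unit, e₀.pos = 0 ∧ (∀ k, restrictEvent p k e = [e₀.shift k]) ∧
        e₀.inArity = e.ins.countP p ∧ e₀.outArity = e.outs.countP p := by
  rcases e with ⟨q, x⟩ | ⟨q, x⟩ | ⟨q, b, x, y⟩
  · cases h : p x
    · simp [restrictEvent, ins, outs, h]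
    · exact .inr ⟨cup 0 (), by simp [pos, restrictEvent, ins, outs, h, shift, inArity, outArity]⟩
  · cases h : p x
    · simp [restrictEvent, ins, outs, h]
    · exact .inr ⟨cap 0 (), by simp [pos, restrictEvent, ins, outs, h, shift, inArity, outArity]⟩
  · cases h : p x && p y
    · left
      revert h
      cases h : p x <;> cases h' : p y <;> simp [restrictEvent, ins, outs, h, h']
    · rw [Bool.and_eq_true] at h
      exact .inr ⟨cross 0 b () (),
        by simp [pos, restrictEvent, ins, outs, h, shift, inArity, outArity]⟩

theorem restrictEvent_shift (p : ℕ → Bool) (k l : ℕ) (e : Event ℕ) :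
    restrictEvent p k (e.shift l) = restrictEvent p k e := by
  cases e <;> rfl

theorem tan_restrict {p : ℕ → Bool} {w : List (Event ℕ)} {S S' : List ℕ} (h : IsTangle w S S') :
    Tan (restrict p S w) (S.countP p) (S'.countP p) := by
  induction h with
  | nil S => exact tan_nil.2 rfl
  | @cons e w S S' S'' hs _ ih =>
    rw [restrict, hs.nextRow_eq]
    obtain ⟨l, r, hl, rfl, rfl⟩ := step_iff.1 hs
    refine tan_append.2 ⟨_, ?_, ih⟩
    simp only [List.countP_append]
    obtain ⟨h1, h2⟩ | ⟨e₀, h0, h1, h2, h3⟩ := restrictEvent_cases p e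
    · rw [h1, tan_nil, h2]
    · rw [h1, tan_cons, tan_nil, ← h2, ← h3]
      simp [h0, ← hl]
      omega

theorem restrict_congr_row {p : ℕ → Bool} {S S' : List ℕ} (h : S.map p = S'.map p)
    (w : List (Event ℕ)) : restrict p S w = restrict p S' w := by
  induction w generalizing S S' with
  | nil => rfl
  | cons e w ih =>
    have hc : (S.take e.pos).countP p = (S'.take e.pos).countP p := by
      have := congrArg (List.countP id ∘ List.take e.pos) h
      simpa [← List.map_take, List.countP_map] using this
    rw [restrict, restrict, hc, ih (S := nextRow e S)]
    simp [nextRow, List.map_take, List.map_drop, h]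

theorem restrict_congr {p q : ℕ → Bool} {w : List (Event ℕ)} {S S' : List ℕ}
    (h : ∀ e ∈ w, ∀ c ∈ e.labels, p c = q c) (hS : S.map p = S'.map q) :
    restrict p S w = restrict q S' w := by
  induction w generalizing S S' with
  | nil => rfl
  | cons e w ih =>
    have hc : (S.take e.pos).countP p = (S'.take e.pos).countP q := by
      have := congrArg (List.countP id ∘ List.take e.pos) hS
      simpa [← List.map_take, List.countP_map] using this
    have he := h e (by simp)
    have ho : e.outs.map p = e.outs.map q := by
      cases e <;> simp_all [labels, outs]
    have hr (k : ℕ) : restrictEvent p k e = restrictEvent q k e := by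
      cases e <;> simp_all [labels, restrictEvent]
    rw [restrict, restrict, hc, hr, ih (S := nextRow e S) fun e he => h e (by simp [he])]
    simp [nextRow, List.map_take, List.map_drop, hS, ho]

theorem restrict_map (p : ℕ → Bool) (g : ℕ → ℕ) (w : List (Event ℕ)) (S : List ℕ) :
    restrict p (S.map g) (w.map (Event.map g)) = restrict (p ∘ g) S w := by
  induction w generalizing S with
  | nil => rfl
  | cons e w ih =>
    have h1 (k : ℕ) : restrictEvent p k (e.map g) = restrictEvent (p ∘ g) k e := by
      cases e <;> rfl
    have h2 : (e.map g).pos = e.pos := by cases e <;> rfl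
    have h3 : nextRow (e.map g) (S.map g) = (nextRow e S).map g := by
      cases e <;> simp [nextRow, Event.map, pos, outs, inArity]
    rw [List.map_cons, restrict, restrict, h1, h2, h3, ih, ← List.map_take, List.countP_map]

theorem restrict_eq_nil {p : ℕ → Bool} {w : List (Event ℕ)} {S : List ℕ}
    (h : ∀ e ∈ w, ∀ c ∈ e.labels, p c = false) : restrict p S w = [] := by
  induction w generalizing S with
  | nil => rfl
  | cons e w ih =>
    have he := h e (by simp)
    rw [restrict, ih fun e he => h e (by simp [he])]
    cases e <;> simp_all [labels, restrictEvent]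

/-- A crossing between a selected and an unselected strand also disappears, so an empty restriction
excludes selected colours only because no selected strand enters from below and none is created by a
minimum. -/
theorem labels_of_restrict_eq_nil {p : ℕ → Bool} {w : List (Event ℕ)} {S S' : List ℕ}
    (h : IsTangle w S S') (hS : ∀ c ∈ S, p c = false) (hw : restrict p S w = []) :
    ∀ e ∈ w, ∀ c ∈ e.labels, p c = false := by
  induction h with
  | nil S => simp
  | @cons e w S S' S'' hs _ ih =>
    rw [restrict, hs.nextRow_eq, List.append_eq_nil_iff] at hw
    obtain ⟨l, r, hl, rfl, rfl⟩ := step_iff.1 hs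
    have he : ∀ c ∈ e.labels, p c = false := by
      cases e <;> simp_all [labels, restrictEvent, ins]
    have ho : ∀ c ∈ e.outs, p c = false := by
      cases e <;> simp_all [labels, outs]
    have := ih (by
      intro c hc
      simp only [List.mem_append] at hc
      rcases hc with (hc | hc) | hc
      · exact hS c (by simp [hc])
      · exact ho c hc
      · exact hS c (by simp [hc])) hw.2
    simpa using ⟨he, this⟩

theorem restrict_row_right {p : ℕ → Bool} {w : List (Event ℕ)} {S S' : List ℕ}
    (h : IsTangle w S S') (T : List ℕ) : restrict p (S ++ T) w = restrict p S w := by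
  induction h with
  | nil S => rfl
  | @cons e w S S' S'' hs _ ih =>
    obtain ⟨l, r, hl, rfl, rfl⟩ := step_iff.1 hs
    have hs' : Step e (l ++ e.ins ++ r ++ T) (l ++ e.outs ++ r ++ T) :=
      step_iff.2 ⟨l, r ++ T, hl, by simp, by simp⟩
    rw [restrict, restrict, hs.nextRow_eq, hs'.nextRow_eq, ih]
    simp [← hl]

theorem restrict_row_left {p : ℕ → Bool} {w : List (Event ℕ)} {S S' : List ℕ}
    (h : IsTangle w S S') (T : List ℕ) :
    restrict p (T ++ S) (w.map (Event.shift T.length)) =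
      (restrict p S w).map (Event.shift (T.countP p)) := by
  induction h with
  | nil S => rfl
  | @cons e w S S' S'' hs _ ih =>
    obtain ⟨l, r, hl, rfl, rfl⟩ := step_iff.1 hs
    have ho : (e.shift T.length).outs = e.outs := by cases e <;> rfl
    have hi : (e.shift T.length).ins = e.ins := by cases e <;> rfl
    have hs' : Step (e.shift T.length) (T ++ (l ++ e.ins ++ r)) (T ++ (l ++ e.outs ++ r)) :=
      step_iff.2 ⟨T ++ l, r, by simp [hl, Nat.add_comm], by simp [hi], by simp [ho]⟩
    rw [List.map_cons, restrict, restrict, hs.nextRow_eq, hs'.nextRow_eq, ih, List.map_append,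
      restrictEvent_shift]
    congr 1
    have h1 : ((l ++ e.ins ++ r).take e.pos).countP p = l.countP p := by simp [← hl]
    have h2 : ((T ++ (l ++ e.ins ++ r)).take (e.shift T.length).pos).countP p =
        T.countP p + l.countP p := by
      rw [pos_shift, ← hl, Nat.add_comm l.length, ← List.length_append, ← List.append_assoc,
        ← List.append_assoc, List.append_assoc (T ++ l), List.take_left, List.countP_append]
    rw [h1, h2]
    obtain ⟨h1, -⟩ | ⟨e₀, -, h1, -⟩ := restrictEvent_cases p e
    · simp [h1]
    · simp [h1, shift_add, Nat.add_comm]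

theorem isTangle_singleton {X : Type} [StrandLabel X] {e : Event X} {S S' : List X} :
    IsTangle [e] S S' ↔ Step e S S' := by
  constructor
  · rintro (_ | ⟨h, h'⟩); cases h'; exact h
  · exact fun h => .cons h (.nil _)

theorem isTangle_cons {X : Type} [StrandLabel X] {e : Event X} {w : List (Event X)}
    {S S'' : List X} : IsTangle (e :: w) S S'' ↔ ∃ S', Step e S S' ∧ IsTangle w S' S'' := by
  constructor
  · rintro (_ | ⟨h, h'⟩); exact ⟨_, h, h'⟩
  · exact fun ⟨_, h, h'⟩ => .cons h h'

theorem eq_append_of_append_eq {X : Type} {l l' r r' : List X} (h : l ++ r = l' ++ r') {k : ℕ}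
    (hk : l'.length = l.length + k) : ∃ m, m.length = k ∧ l' = l ++ m ∧ r = m ++ r' := by
  obtain ⟨m, rfl⟩ : l <+: l' :=
    List.prefix_of_prefix_length_le (l₃ := l ++ r) (List.prefix_append _ _)
      (h ▸ List.prefix_append _ _) (by omega)
  refine ⟨m, by simpa using hk, rfl, ?_⟩
  rwa [List.append_assoc, List.append_cancel_left_eq] at h

/-- A local move of a coloured diagram is a local move of each sublink, or leaves it unchanged. -/
theorem restrict_localMove {p : ℕ → Bool} {s t : List (Event ℕ)} (h : LocalMove s t)
    {S S' : List ℕ} (hs : IsTangle s S S') (ht : IsTangle t S S') :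
    restrict p S s = restrict p S t ∨ LocalMove (restrict p S s) (restrict p S t) := by
  cases h with
  | far e f =>
    simp only [isTangle_cons] at hs ht
    obtain ⟨S₁, h1, S₂, h2, -⟩ := hs
    obtain ⟨S₃, h3, S₄, h4, -⟩ := ht
    have e1 := h1.nextRow_eq
    have e3 := h3.nextRow_eq
    simp only [restrict, e1, e3, restrictEvent_shift]
    obtain ⟨l, r, hl, rfl, rfl⟩ := step_iff.1 h1
    obtain ⟨l', r', hl', h5, -⟩ := step_iff.1 h2
    have hi : (f.shift (e.pos + e.outArity)).ins = f.ins := by cases f <;> rfl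
    rw [hi, List.append_assoc l'] at h5
    -- `m` is the row of strands between the two events; the selected ones among them determine the
    -- distance of the restricted events.
    obtain ⟨m, hm, rfl, rfl⟩ := eq_append_of_append_eq h5 (k := f.pos) (by simp [hl, hl']; omega)
    have c1 : (l ++ e.ins ++ (m ++ (f.ins ++ r'))).take e.pos = l := by simp [← hl]
    have c2 : (l ++ e.outs ++ (m ++ (f.ins ++ r'))).take (f.shift (e.pos + e.outArity)).pos =
        l ++ e.outs ++ m := by
      have : (f.shift (e.pos + e.outArity)).pos = (l ++ e.outs ++ m).length := by
        simp [hl, hm]; omega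
      rw [this, ← List.append_assoc, List.take_left]
    have c3 : (l ++ e.ins ++ (m ++ (f.ins ++ r'))).take (f.shift (e.pos + e.inArity)).pos =
        l ++ e.ins ++ m := by
      have : (f.shift (e.pos + e.inArity)).pos = (l ++ e.ins ++ m).length := by
        simp [hl, hm]; omega
      rw [this, ← List.append_assoc, List.take_left]
    have c4 : S₃.take e.pos = l := by
      rw [← e3, nextRow, c3]; simp [← hl]
    rw [c1, c2, c3, c4]
    simp only [List.countP_append, List.append_nil]
    obtain ⟨h1, h2⟩ | ⟨e₀, h0, h1, h2, h3⟩ := restrictEvent_cases p e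
    · left; simp [h1, h2]
    · obtain ⟨h1', h2'⟩ | ⟨f₀, h0', h1', h2', h3'⟩ := restrictEvent_cases p f
      · left; simp [h1']
      · right
        have := LocalMove.far (e₀.shift (l.countP p)) (f₀.shift (m.countP p))
        simp only [shift_add, pos_shift, h0, Nat.zero_add, inArity_shift, outArity_shift, h2, h3]
          at this
        rw [h1, h1', h1', List.singleton_append, List.singleton_append, Nat.add_comm _ (m.countP p),
          Nat.add_comm _ (m.countP p)]
        exact this
  | zigzagLeft q x =>
    simp only [isTangle_cons] at hs
    obtain ⟨S₁, h1, S₂, h2, -⟩ := hs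
    obtain ⟨l, r, hl, rfl, rfl⟩ := step_iff.1 h1
    obtain ⟨l', r', hl', h5, -⟩ := step_iff.1 h2
    simp only [List.append_assoc, pos] at h5 hl hl'
    obtain ⟨m, hm, rfl, h6⟩ := eq_append_of_append_eq h5.symm (k := 1) (by omega)
    obtain ⟨z, rfl⟩ := List.length_eq_one_iff.1 hm
    simp only [ins, outs, rev_nat, List.cons_append, List.nil_append, List.cons.injEq] at h6
    obtain ⟨rfl, -⟩ := h6
    subst hl'
    cases h : p x
    · left; simp [restrict, restrictEvent, h]
    · right
      simpa [restrict, restrictEvent, h, nextRow, ins, outs, pos, inArity, Nat.add_assoc,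
          List.take_length_add_append, List.drop_length_add_append] using
        LocalMove.zigzagLeft (l'.countP p) ()
  | zigzagRight q x =>
    simp only [isTangle_cons] at hs
    obtain ⟨S₁, h1, S₂, h2, -⟩ := hs
    obtain ⟨l, r, hl, rfl, rfl⟩ := step_iff.1 h1
    obtain ⟨l', r', hl', h5, -⟩ := step_iff.1 h2
    simp only [List.append_assoc, pos] at h5 hl hl'
    obtain ⟨m, hm, rfl, h6⟩ := eq_append_of_append_eq h5 (k := 1) (by omega)
    obtain ⟨z, rfl⟩ := List.length_eq_one_iff.1 hm
    simp only [ins, outs, rev_nat, List.cons_append, List.nil_append, List.cons.injEq] at h6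
    obtain ⟨rfl, -, rfl⟩ := h6
    subst hl
    cases h : p x
    · left; simp [restrict, restrictEvent, h]
    · right
      simpa [restrict, restrictEvent, h, nextRow, ins, outs, pos, inArity, Nat.add_assoc,
          List.take_length_add_append, List.drop_length_add_append] using
        LocalMove.zigzagRight (l.countP p) ()
  | crossCup q b x y =>
    simp only [isTangle_cons] at hs
    obtain ⟨S₁, h1, S₂, h2, -⟩ := hs
    obtain ⟨l, r, hl, rfl, rfl⟩ := step_iff.1 h1
    obtain ⟨l', r', hl', h5, -⟩ := step_iff.1 h2
    simp only [List.append_assoc, pos] at h5 hl hl'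
    obtain ⟨m, hm, rfl, h6⟩ := eq_append_of_append_eq h5 (k := 1) (by omega)
    obtain ⟨z, rfl⟩ := List.length_eq_one_iff.1 hm
    simp only [ins, outs, rev_nat, List.cons_append, List.nil_append, List.cons.injEq] at h6
    obtain ⟨rfl, -, rfl⟩ := h6
    subst hl
    cases h : p x
    · left; simp [restrict, restrictEvent, h]
    · cases h' : p y
      · left; simp [restrict, restrictEvent, h, h', nextRow, ins, outs, pos, inArity, Nat.add_assoc,
          List.take_length_add_append, List.drop_length_add_append]
      · right
        simpa [restrict, restrictEvent, h, h', nextRow, ins, outs, pos, inArity, Nat.add_assoc,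
          List.take_length_add_append, List.drop_length_add_append] using
          LocalMove.crossCup (l.countP p) b () ()
  | crossCap q b x y =>
    simp only [isTangle_cons] at hs
    obtain ⟨S₁, h1, S₂, h2, -⟩ := hs
    obtain ⟨l, r, hl, rfl, rfl⟩ := step_iff.1 h1
    obtain ⟨l', r', hl', h5, -⟩ := step_iff.1 h2
    simp only [List.append_assoc, pos] at h5 hl hl'
    obtain ⟨m, hm, rfl, h6⟩ := eq_append_of_append_eq h5.symm (k := 1) (by omega)
    obtain ⟨z, rfl⟩ := List.length_eq_one_iff.1 hm
    simp only [ins, outs, rev_nat, List.cons_append, List.nil_append, List.cons.injEq] at h6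
    obtain ⟨rfl, -, rfl⟩ := h6
    subst hl'
    cases h : p x
    · left; simp [restrict, restrictEvent, h]
    · cases h' : p y
      · left; simp [restrict, restrictEvent, h, h', nextRow, ins, outs, pos, inArity, Nat.add_assoc,
          List.take_length_add_append, List.drop_length_add_append]
      · right
        simpa [restrict, restrictEvent, h, h', nextRow, ins, outs, pos, inArity, Nat.add_assoc,
          List.take_length_add_append, List.drop_length_add_append] using
          LocalMove.crossCap (l'.countP p) b () ()
  | reidemeister2 q b x y =>
    simp only [isTangle_cons] at hs
    obtain ⟨S₁, h1, -⟩ := hs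
    obtain ⟨l, r, hl, rfl, rfl⟩ := step_iff.1 h1
    simp only [pos] at hl
    subst hl
    cases h : p x
    · left; simp [restrict, restrictEvent, h]
    · cases h' : p y
      · left; simp [restrict, restrictEvent, h, h', nextRow, ins, outs, pos, inArity, Nat.add_assoc,
          List.take_length_add_append, List.drop_length_add_append]
      · right
        simpa [restrict, restrictEvent, h, h', nextRow, ins, outs, pos, inArity, Nat.add_assoc,
          List.take_length_add_append, List.drop_length_add_append] using
          LocalMove.reidemeister2 (l.countP p) b () ()
  | reidemeister3 q b₁ b₂ b₃ x y w hb =>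
    simp only [isTangle_cons] at hs
    obtain ⟨S₁, h1, S₂, h2, -⟩ := hs
    obtain ⟨l, r, hl, rfl, rfl⟩ := step_iff.1 h1
    obtain ⟨l', r', hl', h5, -⟩ := step_iff.1 h2
    simp only [List.append_assoc, pos] at h5 hl hl'
    obtain ⟨m, hm, rfl, h6⟩ := eq_append_of_append_eq h5 (k := 1) (by omega)
    obtain ⟨z, rfl⟩ := List.length_eq_one_iff.1 hm
    simp only [ins, outs, rev_nat, List.cons_append, List.nil_append, List.cons.injEq] at h6
    obtain ⟨rfl, -, rfl⟩ := h6
    subst hl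
    -- If one of the three strands is dropped, at most one crossing survives, and it is the same one
    -- on both sides.
    cases h : p x
    · left; cases h' : p y <;> cases h'' : p w <;>
        simp [restrict, restrictEvent, h, h', h'', nextRow, ins, outs, pos, inArity, Nat.add_assoc,
          List.take_length_add_append, List.drop_length_add_append]
    · cases h' : p y
      · left; cases h'' : p w <;>
          simp [restrict, restrictEvent, h, h', h'', nextRow, ins, outs, pos, inArity, Nat.add_assoc,
          List.take_length_add_append, List.drop_length_add_append]
      · cases h'' : p w
        · left; simp [restrict, restrictEvent, h, h', h'', nextRow, ins, outs, pos, inArity, Nat.add_assoc,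
          List.take_length_add_append, List.drop_length_add_append]
        · right
          simpa [restrict, restrictEvent, h, h', h'', nextRow, ins, outs, pos, inArity, Nat.add_assoc,
          List.take_length_add_append, List.drop_length_add_append] using
            LocalMove.reidemeister3 (l.countP p) b₁ b₂ b₃ () () () hb

end TiedLinks

/-! ### The sign of a colouring and its dependence on the partition alone -/

namespace TiedLinks

open StrandLabel Event

/-! ### Signs -/

/-- The sign `-1` for every crossing in which the strand whose colour has the smaller value under
`f` passes over. -/
def crossingSign (f : ℕ → ℕ) : Event ℕ → ℤ
  | cup _ _ => 1
  | cap _ _ => 1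
  | cross _ b x y => if (f x < f y ∧ b = true) ∨ (f y < f x ∧ b = false) then -1 else 1

/-- The product of the signs of all crossings. -/
def linkingSign (f : ℕ → ℕ) (w : List (Event ℕ)) : ℤ := (w.map (crossingSign f)).prod

@[simp] theorem linkingSign_append (f : ℕ → ℕ) (u v : List (Event ℕ)) :
    linkingSign f (u ++ v) = linkingSign f u * linkingSign f v := by
  simp [linkingSign]

@[simp] theorem linkingSign_nil (f : ℕ → ℕ) : linkingSign f [] = 1 := rfl

@[simp] theorem linkingSign_cons (f : ℕ → ℕ) (e : Event ℕ) (w : List (Event ℕ)) :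
    linkingSign f (e :: w) = crossingSign f e * linkingSign f w := rfl

@[simp] theorem crossingSign_shift (f : ℕ → ℕ) (e : Event ℕ) (k : ℕ) :
    crossingSign f (e.shift k) = crossingSign f e := by cases e <;> rfl

theorem crossingSign_mul_self (f : ℕ → ℕ) (e : Event ℕ) :
    crossingSign f e * crossingSign f e = 1 := by
  cases e with
  | cup => rfl
  | cap => rfl
  | cross => simp only [crossingSign]; split_ifs <;> rfl

theorem linkingSign_mul_self (f : ℕ → ℕ) (w : List (Event ℕ)) :
    linkingSign f w * linkingSign f w = 1 := by
  induction w with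
  | nil => rfl
  | cons e w ih =>
    rw [linkingSign_cons, mul_mul_mul_comm, crossingSign_mul_self, ih, one_mul]

/-- Flipping the flag and exchanging the strands leaves the same colour on top, which is all the
sign depends on. -/
theorem crossingSign_not (f : ℕ → ℕ) (q q' : ℕ) (b : Bool) (x y : ℕ) :
    crossingSign f (cross q (!b) x y) = crossingSign f (cross q' b y x) := by
  unfold crossingSign
  cases b <;> simp

theorem linkingSign_localMove (f : ℕ → ℕ) {s t : List (Event ℕ)} (h : LocalMove s t) :
    linkingSign f s = linkingSign f t := by
  cases h with
  | far e g => simp [mul_comm]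
  | zigzagLeft q x => simp [crossingSign]
  | zigzagRight q x => simp [crossingSign]
  | crossCup q b x y =>
    rw [linkingSign_cons, linkingSign_cons, linkingSign_cons, linkingSign_cons,
      crossingSign_not f q (q + 1)]
    rfl
  | crossCap q b x y =>
    rw [linkingSign_cons, linkingSign_cons, linkingSign_cons, linkingSign_cons,
      crossingSign_not f q (q + 1)]
    simp [crossingSign]
  | reidemeister2 q b x y =>
    rw [linkingSign_cons, linkingSign_cons, linkingSign_nil, mul_one, crossingSign_not f q q,
      crossingSign_mul_self]
  | reidemeister3 q b₁ b₂ b₃ x y w hb =>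
    simp only [linkingSign_cons, linkingSign_nil, mul_one]
    unfold crossingSign
    ring

theorem linkingSign_map (f g : ℕ → ℕ) (w : List (Event ℕ)) :
    linkingSign f (w.map (Event.map g)) = linkingSign (f ∘ g) w := by
  rw [linkingSign, linkingSign, List.map_map]
  congr 2
  funext e
  cases e <;> rfl

/-- The set of colours of a word. -/
def labelSet (w : List (Event ℕ)) : Finset ℕ := (w.flatMap Event.labels).toFinset

theorem mem_labelSet {w : List (Event ℕ)} {c : ℕ} :
    c ∈ labelSet w ↔ ∃ e ∈ w, c ∈ e.labels := by
  simp [labelSet]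

theorem linkingSign_congr {f g : ℕ → ℕ} {w : List (Event ℕ)} (h : ∀ c ∈ labelSet w, f c = g c) :
    linkingSign f w = linkingSign g w := by
  unfold linkingSign
  congr 1
  refine List.map_congr_left fun e he => ?_
  have h' : ∀ c ∈ e.labels, f c = g c := fun c hc => h c (mem_labelSet.2 ⟨e, he, hc⟩)
  cases e <;> simp_all [labels, crossingSign]

/-- The sign `-1` if `f` and `g` order the pair `x`, `y` differently and `f x < f y`. -/
def inversionSign (f g : ℕ → ℕ) (x y : ℕ) : ℤ := if f x < f y ∧ g y < g x then -1 else 1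

/-- The product of the inversion signs of all pairs in a row. -/
def rowSign (f g : ℕ → ℕ) : List ℕ → ℤ
  | [] => 1
  | x :: S => (S.map (inversionSign f g x)).prod * rowSign f g S

theorem inversionSign_mul_self (f g : ℕ → ℕ) (x y : ℕ) :
    inversionSign f g x y * inversionSign f g x y = 1 := by
  unfold inversionSign; split_ifs <;> rfl

theorem inversionSign_self (f g : ℕ → ℕ) (x : ℕ) : inversionSign f g x x = 1 := by
  simp [inversionSign]

theorem rowSign_double (f g : ℕ → ℕ) (l r : List ℕ) (x : ℕ) :
    rowSign f g (l ++ x :: x :: r) = rowSign f g (l ++ r) := by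
  induction l with
  | nil =>
    have : ((r.map (inversionSign f g x)).prod) * ((r.map (inversionSign f g x)).prod) = 1 := by
      induction r with
      | nil => rfl
      | cons y r ih =>
        rw [List.map_cons, List.prod_cons, mul_mul_mul_comm, ih, inversionSign_mul_self, one_mul]
    simp only [List.nil_append, rowSign, List.map_cons, List.prod_cons, inversionSign_self, one_mul]
    rw [← mul_assoc, this, one_mul]
  | cons z l ih =>
    rw [List.cons_append, List.cons_append, rowSign, rowSign, ih]
    simp only [List.map_append, List.map_cons, List.prod_append, List.prod_cons]
    rw [← mul_assoc (inversionSign f g z x), inversionSign_mul_self, one_mul]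

theorem rowSign_swap (f g : ℕ → ℕ) (l r : List ℕ) (x y : ℕ) :
    rowSign f g (l ++ y :: x :: r) =
      inversionSign f g x y * inversionSign f g y x * rowSign f g (l ++ x :: y :: r) := by
  induction l with
  | nil =>
    simp only [List.nil_append, rowSign, List.map_cons, List.prod_cons]
    linear_combination (-((r.map (inversionSign f g x)).prod * inversionSign f g y x *
      (r.map (inversionSign f g y)).prod * rowSign f g r)) * inversionSign_mul_self f g x y
  | cons z l ih =>
    rw [List.cons_append, List.cons_append, rowSign, rowSign, ih]
    simp only [List.map_append, List.map_cons, List.prod_append, List.prod_cons]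
    ring

/-- The linking sign only depends on which colours have the same value. -/
theorem linkingSign_mul_linkingSign {f g : ℕ → ℕ} {w : List (Event ℕ)} {S S' : List ℕ}
    (h : IsTangle w S S') (hfg : ∀ c ∈ labelSet w, ∀ d ∈ labelSet w, f c = f d ↔ g c = g d) :
    linkingSign f w * linkingSign g w * rowSign f g S = rowSign f g S' := by
  induction h with
  | nil S => simp
  | @cons e w S S' S'' hs _ ih =>
    have hfg' : ∀ c ∈ labelSet w, ∀ d ∈ labelSet w, f c = f d ↔ g c = g d := by
      intro c hc d hd
      obtain ⟨e₁, h1, h2⟩ := mem_labelSet.1 hc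
      obtain ⟨e₂, h3, h4⟩ := mem_labelSet.1 hd
      exact hfg c (mem_labelSet.2 ⟨e₁, by simp [h1], h2⟩) d (mem_labelSet.2 ⟨e₂, by simp [h3], h4⟩)
    rw [← ih hfg', linkingSign_cons, linkingSign_cons]
    -- One event at a time: an extremum adds or removes two adjacent equal colours, whose
    -- contributions square to one. A crossing exchanges two neighbours; the row sign changes
    -- exactly if `f` and `g` order their colours differently, which is when the two crossing signs
    -- differ.
    suffices hstep : crossingSign f e * crossingSign g e * rowSign f g S = rowSign f g S' by
      rw [← hstep]; ring
    cases hs with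
    | cup l r x => rw [rev_nat, rowSign_double]; simp [crossingSign]
    | cap l r x => rw [rev_nat, rowSign_double]; simp [crossingSign]
    | cross l r b x y =>
      rw [rowSign_swap]
      have := hfg x (mem_labelSet.2 ⟨_, List.mem_cons_self, by simp [labels]⟩) y
        (mem_labelSet.2 ⟨_, List.mem_cons_self, by simp [labels]⟩)
      rcases lt_trichotomy (f x) (f y) with h1 | h1 | h1 <;>
        rcases lt_trichotomy (g x) (g y) with h2 | h2 | h2 <;> cases b <;>
        simp_all [crossingSign, inversionSign, h1.not_gt, h2.not_gt, le_of_lt]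

/-- Geometrically, two disjoint sublinks of a closed diagram cross an even number of times, so it is
immaterial which of two colours counts as the smaller. Here the row signs at both ends are those of
the empty row. -/
theorem linkingSign_congr_ker {f g : ℕ → ℕ} {w : List (Event ℕ)} (h : IsTangle w [] [])
    (hfg : ∀ c ∈ labelSet w, ∀ d ∈ labelSet w, f c = f d ↔ g c = g d) :
    linkingSign f w = linkingSign g w := by
  have := linkingSign_mul_linkingSign h hfg
  simp only [rowSign, mul_one] at this
  calc linkingSign f w = linkingSign f w * linkingSign g w * linkingSign g w := by
        rw [mul_assoc, linkingSign_mul_self, mul_one]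
    _ = linkingSign g w := by rw [this, one_mul]

/-! ### Rows and colours -/

theorem Step.unique_left {X : Type} [StrandLabel X] {e : Event X} {S S' S'' : List X}
    (h : Step e S S'') (h' : Step e S' S'') : S = S' := by
  obtain ⟨l, r, hl, rfl, rfl⟩ := step_iff.1 h
  obtain ⟨l', r', hl', rfl, h1⟩ := step_iff.1 h'
  obtain ⟨h2, rfl⟩ := List.append_inj h1 (by simp [hl, hl'])
  rw [List.append_cancel_right h2]

theorem IsTangle.unique_left {X : Type} [StrandLabel X] {w : List (Event X)} {S S' S'' : List X}
    (h : IsTangle w S S'') (h' : IsTangle w S' S'') : S = S' := by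
  induction h generalizing S' with
  | nil S => cases h'; rfl
  | cons hs _ ih =>
    cases h' with
    | cons hs' ht' => cases ih ht'; exact hs.unique_left hs'

theorem labelSet_append (u v : List (Event ℕ)) :
    labelSet (u ++ v) = labelSet u ∪ labelSet v := by
  simp [labelSet, List.toFinset_append]

theorem IsTangle.mem_labelSet_top {w : List (Event ℕ)} {S S' : List ℕ} (h : IsTangle w S S')
    {c : ℕ} (hc : c ∈ S') : c ∈ labelSet w ∨ c ∈ S := by
  induction h with
  | nil S => exact .inr hc
  | @cons e w S S' S'' hs _ ih =>
    obtain h1 | h1 := ih hc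
    · obtain ⟨e', h2, h3⟩ := mem_labelSet.1 h1
      exact .inl (mem_labelSet.2 ⟨e', by simp [h2], h3⟩)
    · obtain ⟨l, r, hl, rfl, rfl⟩ := step_iff.1 hs
      simp only [List.mem_append] at h1
      have he : c ∈ e.outs → c ∈ e.labels := by cases e <;> simp [outs, labels]; tauto
      rcases h1 with (h1 | h1) | h1
      · exact .inr (by simp [h1])
      · exact .inl (mem_labelSet.2 ⟨e, by simp, he h1⟩)
      · exact .inr (by simp [h1])

/-- A move that erases all its events may remove labels from the word, but their colours are still
present in the row below. Hence the set of colours to be summed over does not change. -/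
theorem LocalMove.labelSet_subset {s t : List (Event ℕ)} (h : LocalMove s t) {S S' : List ℕ}
    (hs : IsTangle s S S') :
    labelSet t ⊆ labelSet s ∧ ∀ c ∈ labelSet s, c ∈ labelSet t ∨ c ∈ S := by
  have key : labelSet t ⊆ labelSet s ∧ (labelSet s ⊆ labelSet t ∨ t = []) := by
    cases h with
    | far e f =>
      have h (k : ℕ) : (f.shift k).labels = f.labels := by cases f <;> rfl
      refine ⟨fun c => ?_, .inl fun c => ?_⟩ <;> simp [mem_labelSet, h] <;> tauto
    | zigzagLeft | zigzagRight | reidemeister2 => exact ⟨by simp [labelSet], .inr rfl⟩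
    | crossCup | crossCap | reidemeister3 =>
      refine ⟨fun c => ?_, .inl fun c => ?_⟩ <;> simp [mem_labelSet, labels] <;> tauto
  refine ⟨key.1, fun c hc => ?_⟩
  obtain hst | rfl := key.2
  · exact .inl (hst hc)
  · right
    cases h with
    | zigzagLeft q x =>
      obtain rfl : c = x := by simpa [mem_labelSet, labels] using hc
      simp only [isTangle_cons] at hs
      obtain ⟨S₁, h1, S₂, h2, -⟩ := hs
      obtain ⟨l, r, hl, rfl, rfl⟩ := step_iff.1 h1
      obtain ⟨l', r', hl', h5, -⟩ := step_iff.1 h2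
      simp only [List.append_assoc, pos] at h5 hl hl'
      obtain ⟨m, hm, rfl, h6⟩ := eq_append_of_append_eq h5.symm (k := 1) (by omega)
      obtain ⟨z, rfl⟩ := List.length_eq_one_iff.1 hm
      simp only [ins, outs, rev_nat, List.cons_append, List.nil_append, List.cons.injEq] at h6
      simp [h6.1]
    | zigzagRight q x =>
      obtain rfl : c = x := by simpa [mem_labelSet, labels] using hc
      simp only [isTangle_cons] at hs
      obtain ⟨S₁, h1, S₂, h2, -⟩ := hs
      obtain ⟨l, r, hl, rfl, rfl⟩ := step_iff.1 h1
      obtain ⟨l', r', hl', h5, -⟩ := step_iff.1 h2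
      simp only [List.append_assoc, pos] at h5 hl hl'
      obtain ⟨m, hm, rfl, h6⟩ := eq_append_of_append_eq h5 (k := 1) (by omega)
      obtain ⟨z, rfl⟩ := List.length_eq_one_iff.1 hm
      simp only [ins, outs, rev_nat, List.cons_append, List.nil_append, List.cons.injEq] at h6
      simp [h6.2.2]
    | reidemeister2 q b x y =>
      simp only [isTangle_cons] at hs
      obtain ⟨S₁, h1, -⟩ := hs
      obtain ⟨l, r, hl, rfl, rfl⟩ := step_iff.1 h1
      simp [mem_labelSet, labels, ins] at hc ⊢
      tauto

end TiedLinks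

/-! ### Invariance and skein rule for a single colouring -/

namespace TiedLinks

open StrandLabel Event

variable {R : Type} [CommRing R]

/-! ### The value of a colouring -/

/-- The product of the values of the sublinks of colours below `N`, up to a sign. -/
noncomputable def colouredValue (F : Diagram Unit → R) (N : ℕ) (f : ℕ → ℕ)
    (w : List (Event ℕ)) : R :=
  (linkingSign f w : R) *
    ∏ j ∈ Finset.range N, circledValue F (restrict (fun c => decide (f c = j)) [] w)

theorem colouredValue_congr {F : Diagram Unit → R} {N : ℕ} {f g : ℕ → ℕ} {w : List (Event ℕ)}
    (h : ∀ c ∈ labelSet w, f c = g c) : colouredValue F N f w = colouredValue F N g w := by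
  rw [colouredValue, colouredValue, linkingSign_congr h]
  congr 1
  refine Finset.prod_congr rfl fun j _ => ?_
  refine congrArg _ (restrict_congr (fun e he c hc => ?_) rfl)
  simp only [h c (mem_labelSet.2 ⟨e, he, hc⟩)]

theorem colouredValue_map (F : Diagram Unit → R) (N : ℕ) (f g : ℕ → ℕ) (w : List (Event ℕ)) :
    colouredValue F N f (w.map (Event.map g)) = colouredValue F N (f ∘ g) w := by
  rw [colouredValue, colouredValue, linkingSign_map]
  congr 1
  exact Finset.prod_congr rfl fun j _ => congrArg _ (restrict_map _ g w [])

theorem tan_map_shift {w : List (Event Unit)} {n m k : ℕ} (h : Tan w n m) :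
    Tan (w.map (Event.shift k)) (n + k) (m + k) := by
  induction w generalizing n with
  | nil => rw [tan_nil] at h; exact tan_nil.2 (by rw [h])
  | cons e w ih =>
    rw [tan_cons] at h
    rw [List.map_cons, tan_cons]
    simp only [pos_shift, inArity_shift, outArity_shift]
    refine ⟨by omega, ?_⟩
    have := ih h.2
    rwa [show n + k - e.inArity + e.outArity = n - e.inArity + e.outArity + k by omega]

section

variable {P : SkeinParams R} {F : Diagram Unit → R} (hF : KauffmanRules P F)

include hF

/-- The sphere move requires the swept arc to start the word, whereas here the additional circle
precedes it; so the circle factor is taken out first. -/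
theorem circledValue_sphere {t : List (Event Unit)} (ht : Tan t 1 1) :
    circledValue F ([cup 0 ()] ++ t ++ [cap 0 ()]) =
      circledValue F ([cup 0 ()] ++ t.map (Event.shift 1) ++ [cap 0 ()]) := by
  have h1 : Tan ([cup 0 ()] ++ t ++ [cap 0 ()]) 0 0 := by
    refine tan_cup.2 ⟨le_rfl, tan_append.2 ⟨2, ?_, tan_cap.2 ⟨le_rfl, tan_nil.2 rfl⟩⟩⟩
    -- A further strand is added on the right of the tangle.
    have aux : ∀ {w : List (Event Unit)} {n : ℕ}, Tan w n 1 → Tan w (n + 1) 2 := by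
      intro w
      induction w with
      | nil => intro n h; rw [tan_nil] at h ⊢; omega
      | cons e w ih =>
        intro n h
        rw [tan_cons] at h ⊢
        refine ⟨by omega, ?_⟩
        have := ih h.2
        rwa [show n + 1 - e.inArity + e.outArity = n - e.inArity + e.outArity + 1 by omega]
    exact aux ht
  have h2 : Tan ([cup 0 ()] ++ t.map (Event.shift 1) ++ [cap 0 ()]) 0 0 :=
    tan_cup.2 ⟨le_rfl, tan_append.2 ⟨2, tan_map_shift ht, tan_cap.2 ⟨le_rfl, tan_nil.2 rfl⟩⟩⟩
  rw [hF.circledValue_eq ⟨_, by simp, h1⟩, hF.circledValue_eq ⟨_, by simp, h2⟩]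
  congr 1
  exact hF.regular _ _ (.sphere _ _ t () ht rfl rfl)

theorem colouredValue_regular (N : ℕ) (f : ℕ → ℕ) {D D' : Diagram ℕ} (h : RegularMove D D') :
    colouredValue F N f D.word = colouredValue F N f D'.word := by
  have hT := D.isTangle
  have hT' := D'.isTangle
  cases h with
  | isotopy u s t v h hD hD' =>
    rw [hD] at hT ⊢
    rw [hD'] at hT' ⊢
    obtain ⟨S₂, h12, h3⟩ := hT.split
    obtain ⟨S₁, h1, h2⟩ := h12.split
    obtain ⟨S₂', h12', h3'⟩ := hT'.split
    obtain ⟨S₁', h1', h2'⟩ := h12'.split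
    obtain rfl := h1.unique h1'
    obtain rfl := h3.unique_left h3'
    rw [colouredValue, colouredValue]
    simp only [linkingSign_append, linkingSign_localMove f h]
    congr 1
    refine Finset.prod_congr rfl fun j _ => ?_
    have e1 (p : ℕ → Bool) := restrict_append (p := p) (v := v) h12
    have e2 (p : ℕ → Bool) := restrict_append (p := p) (v := v) h12'
    have t1 (p : ℕ → Bool) := tan_restrict (p := p) hT
    have t2 (p : ℕ → Bool) := tan_restrict (p := p) hT'
    simp only [restrict_append h1] at e1 e2
    simp only [e1, e2] at t1 t2
    rw [e1, e2]
    obtain h4 | h4 := restrict_localMove (p := fun c => decide (f c = j)) h h2 h2'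
    · rw [h4]
    · exact hF.wordRules.move h4 (t1 _) (t2 _)
  | sphere t x ht hD hD' =>
    have hs (y : ℕ) : Step (cup 0 y) [] [y, y] := Step.cup [] [] y
    have ht2 : IsTangle t [x, x] [x, x] := by
      rw [hD, List.append_assoc] at hT
      obtain ⟨S₁, h1, h2⟩ := hT.split
      obtain rfl := (isTangle_singleton.1 h1).unique (hs x)
      obtain ⟨S₂, h3, h4⟩ := h2.split
      have h5 := isTangle_singleton.1 h4
      obtain rfl := h5.unique_left (Step.cap [] [] x)
      exact h3
    have ht2' : IsTangle (t.map (Event.shift 1)) [x, x] [x, x] := by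
      rw [hD', List.append_assoc] at hT'
      obtain ⟨S₁, h1, h2⟩ := hT'.split
      obtain rfl := (isTangle_singleton.1 h1).unique (hs x)
      obtain ⟨S₂, h3, h4⟩ := h2.split
      have h5 := isTangle_singleton.1 h4
      obtain rfl := h5.unique_left (Step.cap [] [] x)
      exact h3
    rw [hD, hD', colouredValue, colouredValue]
    have hsgn : linkingSign f (t.map (Event.shift 1)) = linkingSign f t := by
      simp [linkingSign, Function.comp_def]
    simp only [linkingSign_append, hsgn, rev_nat]
    congr 1
    refine Finset.prod_congr rfl fun j _ => ?_
    generalize hp : (fun c => decide (f c = j)) = p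
    have e1 : restrict p [x, x] t = restrict p [x] t := restrict_row_right ht [x]
    have e2 := restrict_row_left (p := p) ht [x]
    rw [List.append_assoc, List.append_assoc, restrict_append (isTangle_singleton.2 (hs x)),
      restrict_append (isTangle_singleton.2 (hs x)), restrict_append ht2, restrict_append ht2', e1]
    simp only [List.length_singleton, List.singleton_append, List.countP_singleton] at e2
    rw [e2]
    have ht' := tan_restrict (p := p) ht
    cases h : p x
    -- If the arc has another colour, it is invisible to the sublink and the shift is by zero.
    · simp [restrict, restrictEvent, h, shift_zero]
      congr 1
      symm
      rw [List.map_id'' fun e => shift_zero e]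
    · simp only [List.countP_singleton, h, if_true] at ht'
      simpa [restrict, restrictEvent, h, pos] using circledValue_sphere hF ht'

omit hF in
theorem restrict_curl {b : Bool} {k : List (Event ℕ)} (h : IsCurl b k) {S S' : List ℕ}
    (hk : IsTangle k S S') : ∃ x, labelSet k = {x} ∧ x ∈ S ∧ (∀ f, linkingSign f k = 1) ∧
      ∀ p : ℕ → Bool, if p x then IsCurl b (restrict p S k) else restrict p S k = [] := by
  cases h with
  | right q _ x =>
    simp only [isTangle_cons] at hk
    obtain ⟨S₁, h1, S₂, h2, -⟩ := hk
    obtain ⟨l, r, hl, rfl, rfl⟩ := step_iff.1 h1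
    obtain ⟨l', r', hl', h5, -⟩ := step_iff.1 h2
    simp only [List.append_assoc, pos] at h5 hl hl'
    obtain ⟨m, hm, rfl, h6⟩ := eq_append_of_append_eq h5.symm (k := 1) (by omega)
    obtain ⟨z, rfl⟩ := List.length_eq_one_iff.1 hm
    simp only [ins, outs, rev_nat, List.cons_append, List.nil_append, List.cons.injEq] at h6
    obtain ⟨rfl, -⟩ := h6
    subst hl'
    refine ⟨x, by ext; simp [mem_labelSet, labels], by simp, fun f => by simp [crossingSign],
      fun p => ?_⟩
    cases h : p x
    · simp [restrict, restrictEvent, h]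
    · simpa [restrict, restrictEvent, h, nextRow, ins, outs, pos, inArity, Nat.add_assoc,
        List.take_length_add_append, List.drop_length_add_append] using
        IsCurl.right (l'.countP p) b ()
  | left q _ x =>
    simp only [isTangle_cons] at hk
    obtain ⟨S₁, h1, S₂, h2, -⟩ := hk
    obtain ⟨l, r, hl, rfl, rfl⟩ := step_iff.1 h1
    obtain ⟨l', r', hl', h5, -⟩ := step_iff.1 h2
    simp only [List.append_assoc, pos] at h5 hl hl'
    obtain ⟨m, hm, rfl, h6⟩ := eq_append_of_append_eq h5 (k := 1) (by omega)
    obtain ⟨z, rfl⟩ := List.length_eq_one_iff.1 hm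
    simp only [ins, outs, rev_nat, List.cons_append, List.nil_append, List.cons.injEq] at h6
    obtain ⟨rfl, -, rfl⟩ := h6
    subst hl
    refine ⟨x, by ext; simp [mem_labelSet, labels], by simp, fun f => by simp [crossingSign],
      fun p => ?_⟩
    cases h : p x
    · simp [restrict, restrictEvent, h]
    · simpa [restrict, restrictEvent, h, nextRow, ins, outs, pos, inArity, Nat.add_assoc,
        List.take_length_add_append, List.drop_length_add_append] using
        IsCurl.left (l.countP p) b ()

/-- Only the sublink with the colour of the curl sees it, so exactly one factor is multiplied; `hf`
ensures that this factor occurs. A self-crossing has sign one. -/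
theorem colouredValue_curl {N : ℕ} {f : ℕ → ℕ} {b : Bool} {u k v : List (Event ℕ)}
    (h : IsCurl b k) (hT : IsTangle (u ++ k ++ v) [] []) (hT' : IsTangle (u ++ v) [] [])
    (hf : ∀ c ∈ labelSet k, f c < N) :
    colouredValue F N f (u ++ k ++ v) = P.curl b * colouredValue F N f (u ++ v) := by
  obtain ⟨S₂, h12, h3⟩ := hT.split
  obtain ⟨S₁, h1, h2⟩ := h12.split
  obtain ⟨S₁', h1', h3'⟩ := hT'.split
  obtain rfl := h1.unique h1'
  obtain rfl := h3.unique_left h3'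
  obtain ⟨x, hx, -, hsgn, hr⟩ := restrict_curl h h2
  have key : ∀ j ∈ Finset.range N,
      circledValue F (restrict (fun c => decide (f c = j)) [] (u ++ k ++ v)) =
        (if f x = j then P.curl b else 1) *
          circledValue F (restrict (fun c => decide (f c = j)) [] (u ++ v)) := by
    intro j _
    have hr := hr fun c => decide (f c = j)
    have t1 := tan_restrict (p := fun c => decide (f c = j)) hT
    have t2 := tan_restrict (p := fun c => decide (f c = j)) hT'
    rw [restrict_append h12, restrict_append h1] at t1 ⊢
    rw [restrict_append h1] at t2 ⊢
    by_cases hj : f x = j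
    · rw [if_pos (by simpa using hj)] at hr
      rw [if_pos hj, hF.wordRules.curl hr t1 t2]
    · rw [if_neg (by simpa using hj)] at hr
      rw [if_neg hj, hr, List.append_nil, one_mul]
  rw [colouredValue, colouredValue, Finset.prod_congr rfl key, Finset.prod_mul_distrib,
    Finset.prod_ite_eq, if_pos (Finset.mem_range.2 (hf x (by simp [hx])))]
  simp only [linkingSign_append, hsgn, mul_one, mul_left_comm]

theorem colouredValue_circle {N : ℕ} {f : ℕ → ℕ} {w : List (Event ℕ)} {c : ℕ}
    (hw : IsTangle w [] []) (hf : f c < N) :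
    colouredValue F N f (w ++ [cup 0 c, cap 0 c]) = P.circle * colouredValue F N f w := by
  have key : ∀ j ∈ Finset.range N,
      circledValue F (restrict (fun c => decide (f c = j)) [] (w ++ [cup 0 c, cap 0 c])) =
        (if f c = j then P.circle else 1) *
          circledValue F (restrict (fun c => decide (f c = j)) [] w) := by
    intro j _
    have t1 := tan_restrict (p := fun c => decide (f c = j)) hw
    rw [restrict_append hw]
    by_cases hj : f c = j
    · have := hF.wordRules.circle (p := 0) (v := []) t1 (by simp) (tan_nil.2 rfl)
      simpa [restrict, restrictEvent, hj, pos] using this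
    · simp [restrict, restrictEvent, hj]
  rw [colouredValue, colouredValue, Finset.prod_congr rfl key, Finset.prod_mul_distrib,
    Finset.prod_ite_eq, if_pos (Finset.mem_range.2 hf)]
  simp [crossingSign, mul_left_comm]

theorem colouredValue_nil (N : ℕ) (f : ℕ → ℕ) : colouredValue F N f [] = 1 := by
  simp [colouredValue, restrict, hF.wordRules.nil]

omit hF in
theorem restrict_cross {p : ℕ → Bool} {q c d : ℕ} {b : Bool} {u v : List (Event ℕ)}
    {S S' : List ℕ} (hu : IsTangle u [] S) (hx : Step (cross q b c d) S S') :
    restrict p [] (u ++ [cross q b c d] ++ v) = restrict p [] u ++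
      (if p c && p d then [cross ((S.take q).countP p) b () ()] else []) ++ restrict p S' v := by
  rw [List.append_assoc, restrict_append hu, restrict_append (isTangle_singleton.2 hx)]
  simp [restrict, restrictEvent, pos]

/-- The skein rule at a crossing between strands of the same colour. -/
theorem colouredValue_skein_of_eq {N : ℕ} {f : ℕ → ℕ} {q c d : ℕ} {u v : List (Event ℕ)}
    (hT : IsTangle (u ++ [cross q true c d] ++ v) [] [])
    (hT' : IsTangle (u ++ [cross q false c d] ++ v) [] []) (hcd : f c = f d) (hf : f c < N) :
    colouredValue F N f (u ++ [cross q true c d] ++ v) +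
      colouredValue F N f (u ++ [cross q false c d] ++ v) =
    P.z * (colouredValue F N f (u ++ v) +
      colouredValue F N f (u ++ [cap q c, cup q c] ++ v)) := by
  obtain ⟨S₂, h12, h3⟩ := hT.split
  obtain ⟨S₁, h1, h2⟩ := h12.split
  obtain ⟨S₂', h12', h3'⟩ := hT'.split
  obtain ⟨S₁', h1', h2'⟩ := h12'.split
  obtain rfl := h1.unique h1'
  obtain rfl := h3.unique_left h3'
  rw [isTangle_singleton] at h2 h2'
  obtain ⟨l, r, hl, hS₁, hS₂⟩ := step_iff.1 h2
  simp only [pos] at hl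
  subst hl
  have hp (p : ℕ → Bool) (hpcd : p c = p d) : S₁.map p = S₂.map p := by
    subst hS₁ hS₂; simp [ins, outs, hpcd]
  have e0 (p : ℕ → Bool) (hpcd : p c = p d) :
      restrict p [] (u ++ v) = restrict p [] u ++ restrict p S₂ v := by
    rw [restrict_append h1, restrict_congr_row (hp p hpcd)]
  have einf (p : ℕ → Bool) (hpcd : p c = p d) :
      restrict p [] (u ++ [cap l.length c, cup l.length c] ++ v) = restrict p [] u ++
        (if p c then [cap (l.countP p) (), cup (l.countP p) ()] else []) ++ restrict p S₂ v := by
    have hrow : nextRow (cup l.length c) (nextRow (cap l.length c) S₁) = l ++ [c, c] ++ r := by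
      subst hS₁
      simp [nextRow, ins, outs, pos, inArity, List.drop_length_add_append]
    rw [List.append_assoc, restrict_append h1, List.cons_append, List.cons_append, List.nil_append,
      restrict, restrict, hrow, restrict_congr_row (S := l ++ [c, c] ++ r) (S' := S₂)
        (by subst hS₂; simp [outs, hpcd])]
    subst hS₁
    cases h : p c <;> simp [restrictEvent, h, nextRow, ins, outs, pos]
  have ecr (p : ℕ → Bool) (b : Bool) (hb : Step (cross l.length b c d) S₁ S₂) (hpcd : p c = p d) :
      restrict p [] (u ++ [cross l.length b c d] ++ v) = restrict p [] u ++
        (if p c then [cross (l.countP p) b () ()] else []) ++ restrict p S₂ v := by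
    rw [restrict_cross h1 hb, ← hpcd, Bool.and_self]
    subst hS₁; simp
  have hN : f c ∈ Finset.range N := Finset.mem_range.2 hf
  have hpf (j : ℕ) : decide (f c = j) = decide (f d = j) := by rw [hcd]
  -- All factors but the one of colour `f c` are unaffected by the crossing; in that one the rule
  -- for words applies.
  have herase (b : Bool) (hb : Step (cross l.length b c d) S₁ S₂) :
      ∏ j ∈ (Finset.range N).erase (f c), circledValue F
        (restrict (fun c => decide (f c = j)) [] (u ++ [cross l.length b c d] ++ v)) =
      ∏ j ∈ (Finset.range N).erase (f c), circledValue F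
        (restrict (fun c => decide (f c = j)) [] (u ++ v)) :=
    Finset.prod_congr rfl fun j hj => by
      rw [ecr _ b hb (hpf j), e0 _ (hpf j), if_neg (by simpa using (Finset.ne_of_mem_erase hj).symm),
        List.append_nil]
  have herase' : ∏ j ∈ (Finset.range N).erase (f c), circledValue F
        (restrict (fun c => decide (f c = j)) [] (u ++ [cap l.length c, cup l.length c] ++ v)) =
      ∏ j ∈ (Finset.range N).erase (f c), circledValue F
        (restrict (fun c => decide (f c = j)) [] (u ++ v)) :=
    Finset.prod_congr rfl fun j hj => by
      rw [einf _ (hpf j), e0 _ (hpf j), if_neg (by simpa using (Finset.ne_of_mem_erase hj).symm),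
        List.append_nil]
  have hsgn (b : Bool) : crossingSign f (cross l.length b c d) = 1 := by
    simp [crossingSign, hcd]
  have key := hF.wordRules.skein (p := l.countP fun x => decide (f x = f c))
    (tan_restrict (p := fun x => decide (f x = f c)) h1)
    (by rw [hS₁]; simp [ins, List.countP_append, List.countP_cons, hcd])
    (v := restrict (fun x => decide (f x = f c)) S₂ v) (by
      have := tan_restrict (p := fun x => decide (f x = f c)) h3
      have h5 : S₁.countP (fun x => decide (f x = f c)) = S₂.countP fun x => decide (f x = f c) := by
        have := congrArg (List.countP id) (hp (fun x => decide (f x = f c)) (hpf _))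
        simpa [List.countP_map] using this
      rwa [h5])
  simp only [colouredValue, linkingSign_append, linkingSign_cons, linkingSign_nil, hsgn]
  rw [← Finset.mul_prod_erase _ _ hN, ← Finset.mul_prod_erase _ _ hN, ← Finset.mul_prod_erase _ _ hN,
    ← Finset.mul_prod_erase _ _ hN, herase true h2, herase false h2', herase',
    ecr _ true h2 (hpf _), ecr _ false h2' (hpf _), e0 _ (hpf _), einf _ (hpf _)]
  simp only [decide_true, if_true, crossingSign, mul_one, Int.cast_mul, one_mul]
  linear_combination ((linkingSign f u : R) * linkingSign f v *
    ∏ j ∈ (Finset.range N).erase (f c), circledValue F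
        (restrict (fun c => decide (f c = j)) [] (u ++ v))) * key

omit hF in
/-- The skein rule at a crossing between strands of different colours. -/
theorem colouredValue_skein_of_ne {N : ℕ} {f : ℕ → ℕ} {q c d : ℕ} {u v : List (Event ℕ)}
    (hT : IsTangle (u ++ [cross q true c d] ++ v) [] [])
    (hT' : IsTangle (u ++ [cross q false c d] ++ v) [] []) (hcd : f c ≠ f d) :
    colouredValue F N f (u ++ [cross q true c d] ++ v) +
      colouredValue F N f (u ++ [cross q false c d] ++ v) = 0 := by
  obtain ⟨S₂, h12, h3⟩ := hT.split
  obtain ⟨S₁, h1, h2⟩ := h12.split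
  obtain ⟨S₂', h12', h3'⟩ := hT'.split
  obtain ⟨S₁', h1', h2'⟩ := h12'.split
  obtain rfl := h1.unique h1'
  obtain rfl := h3.unique_left h3'
  rw [isTangle_singleton] at h2 h2'
  -- No sublink contains both strands, so switching the crossing affects nothing but the sign.
  have hp (j : ℕ) : (decide (f c = j) && decide (f d = j)) = false := by
    rw [Bool.and_eq_false_iff, decide_eq_false_iff_not, decide_eq_false_iff_not]
    by_contra! h
    exact hcd (h.1.trans h.2.symm)
  have hsgn : crossingSign f (cross q true c d) = -crossingSign f (cross q false c d) := by
    obtain h | h := hcd.lt_or_gt <;> simp [crossingSign, h, h.not_gt]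
  simp only [colouredValue, restrict_cross h1 h2, restrict_cross h1 h2', hp, linkingSign_append,
    linkingSign_cons, linkingSign_nil, hsgn]
  push_cast
  simp

end

end TiedLinks

/-! ### From sums over colourings to a polynomial in `x⁻¹` -/

namespace TiedLinks

open StrandLabel Event

variable {R : Type} [CommRing R]

/-! ### The value of a partition of the colours -/

/-- The classes of colours in `C` with the same value under `f`. -/
def colourClasses (f : ℕ → ℕ) (C : Finset ℕ) : Finset (Finset ℕ) :=
  C.image fun c => C.filter fun d => f d = f c

/-- The product, up to a sign, of the values of the sublinks given by the classes of colours with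
the same value under `f`. -/
noncomputable def partitionValue (F : Diagram Unit → R) (f : ℕ → ℕ) (w : List (Event ℕ)) : R :=
  (linkingSign f w : R) * ∏ B ∈ colourClasses f (labelSet w),
    wordValue F (restrict (fun c => decide (c ∈ B)) [] w)

theorem partitionValue_congr_ker {F : Diagram Unit → R} {f g : ℕ → ℕ} {w : List (Event ℕ)}
    (h : IsTangle w [] []) (hfg : ∀ c ∈ labelSet w, ∀ d ∈ labelSet w, f c = f d ↔ g c = g d) :
    partitionValue F f w = partitionValue F g w := by
  rw [partitionValue, partitionValue, linkingSign_congr_ker h hfg]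
  congr 2
  exact Finset.image_congr fun c hc => Finset.filter_congr fun d hd => hfg d hd c hc

/-- Unused colours contribute the value `1` of the empty word; each colour in use contributes a
nonempty sublink with an additional circle, hence one factor `P.circle`. -/
theorem colouredValue_eq {P : SkeinParams R} {F : Diagram Unit → R} (hF : KauffmanRules P F)
    {N : ℕ} {f : ℕ → ℕ} {D : Diagram ℕ} (hf : ∀ c ∈ labelSet D.word, f c < N) :
    colouredValue F N f D.word =
      P.circle ^ ((labelSet D.word).image f).card * partitionValue F f D.word := by
  set C := labelSet D.word with hC
  have h1 : ∏ j ∈ Finset.range N,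
        circledValue F (restrict (fun c => decide (f c = j)) [] D.word) =
      ∏ j ∈ C.image f, circledValue F (restrict (fun c => decide (f c = j)) [] D.word) := by
    symm
    refine Finset.prod_subset ?_ fun j _ hj => ?_
    · intro j hj
      obtain ⟨c, hc, rfl⟩ := Finset.mem_image.1 hj
      exact Finset.mem_range.2 (hf c hc)
    · rw [restrict_eq_nil, hF.wordRules.nil]
      intro e he c hc
      simp only [decide_eq_false_iff_not]
      rintro rfl
      exact hj (Finset.mem_image_of_mem f (mem_labelSet.2 ⟨e, he, hc⟩))
  have h2 : ∀ j ∈ C.image f,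
      circledValue F (restrict (fun c => decide (f c = j)) [] D.word) =
      P.circle * wordValue F (restrict (fun c => decide (c ∈ C.filter fun d => f d = j)) [] D.word) := by
    intro j hj
    obtain ⟨c, hc, rfl⟩ := Finset.mem_image.1 hj
    have e1 : restrict (fun d => decide (d ∈ C.filter fun d => f d = f c)) [] D.word =
        restrict (fun d => decide (f d = f c)) [] D.word := by
      refine restrict_congr (fun e he d hd => ?_) rfl
      have : d ∈ C := mem_labelSet.2 ⟨e, he, hd⟩
      simp [this]
    rw [e1]
    have hne : restrict (fun d => decide (f d = f c)) [] D.word ≠ [] := by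
      intro h
      obtain ⟨e, he, hd⟩ := mem_labelSet.1 hc
      have := labels_of_restrict_eq_nil D.isTangle (by simp) h e he c hd
      simp at this
    have hT := tan_restrict (p := fun d => decide (f d = f c)) D.isTangle
    rw [hF.circledValue_eq ⟨_, hne, hT⟩, ← wordValue_eq (F := F)]
  have h3 : colourClasses f C = (C.image f).image fun j => C.filter fun d => f d = j := by
    rw [Finset.image_image]; rfl
  have hinj : Set.InjOn (fun j => C.filter fun d => f d = j) (C.image f : Finset ℕ) := ?_
  · rw [colouredValue, h1, Finset.prod_congr rfl h2, Finset.prod_mul_distrib, Finset.prod_const,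
      partitionValue, ← hC, h3, Finset.prod_image hinj, mul_left_comm]
  intro j hj j' hj' h
  obtain ⟨c, hc, rfl⟩ := Finset.mem_image.1 hj
  have : c ∈ C.filter fun d => f d = j' := by
    rw [← show (C.filter fun d => f d = f c) = C.filter fun d => f d = j' from h]
    simpa using hc
  exact (Finset.mem_filter.1 this).2

/-! ### Sums over colourings -/

/-- Extend a function on a finite set by zero. -/
noncomputable def extendColour {C : Finset ℕ} (g : C → ℕ) : ℕ → ℕ := Function.extend Subtype.val g 0

theorem extendColour_apply {C : Finset ℕ} (g : C → ℕ) (c : C) : extendColour g c = g c :=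
  Subtype.val_injective.extend_apply g 0 c

/-- The sum over all colourings of the set `C` with `N` colours. -/
noncomputable def colourSum (C : Finset ℕ) (N : ℕ) (G : (ℕ → ℕ) → R) : R :=
  ∑ g : C → Fin N, G (extendColour fun c => (g c : ℕ))

theorem colourSum_congr {C : Finset ℕ} {N : ℕ} {G G' : (ℕ → ℕ) → R}
    (h : ∀ f : ℕ → ℕ, (∀ c ∈ C, f c < N) → G f = G' f) : colourSum C N G = colourSum C N G' := by
  refine Finset.sum_congr rfl fun g _ => h _ fun c hc => ?_
  rw [extendColour_apply _ (⟨c, hc⟩ : C)]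
  exact (g _).2

theorem colourSum_mul (C : Finset ℕ) (N : ℕ) (r : R) (G : (ℕ → ℕ) → R) :
    colourSum C N (fun f => r * G f) = r * colourSum C N G := by
  rw [colourSum, colourSum, Finset.mul_sum]

theorem colourSum_add (C : Finset ℕ) (N : ℕ) (G G' : (ℕ → ℕ) → R) :
    colourSum C N (fun f => G f + G' f) = colourSum C N G + colourSum C N G' := by
  rw [colourSum, colourSum, colourSum, Finset.sum_add_distrib]

open Classical in
/-- Colourings of the image of `C` correspond to colourings of `C` that are constant on fibres. -/
theorem colourSum_image (C : Finset ℕ) (N : ℕ) (σ : ℕ → ℕ) {G : (ℕ → ℕ) → R}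
    (hG : ∀ f f' : ℕ → ℕ, (∀ c ∈ C, f c = f' c) → G f = G f') :
    colourSum (C.image σ) N (fun f => G (f ∘ σ)) =
      colourSum C N fun f => if ∀ c ∈ C, ∀ d ∈ C, σ c = σ d → f c = f d then G f else 0 := by
  rw [colourSum, colourSum, ← Finset.sum_filter]
  refine Finset.sum_bij (fun g _ c => g ⟨σ c, Finset.mem_image_of_mem σ c.2⟩) ?_ ?_ ?_ ?_
  · intro g _
    simp only [Finset.mem_filter, Finset.mem_univ, true_and]
    intro c hc d hd hcd
    rw [extendColour_apply _ (⟨c, hc⟩ : C), extendColour_apply _ (⟨d, hd⟩ : C)]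
    simp only [hcd]
  · intro g _ g' _ h
    funext ⟨x, hx⟩
    obtain ⟨c, hc, rfl⟩ := Finset.mem_image.1 hx
    exact congrFun h ⟨c, hc⟩
  · intro g hg
    simp only [Finset.mem_filter, Finset.mem_univ, true_and] at hg
    refine ⟨fun x => g ⟨(Finset.mem_image.1 x.2).choose, (Finset.mem_image.1 x.2).choose_spec.1⟩,
      Finset.mem_univ _, ?_⟩
    funext ⟨c, hc⟩
    have hx : σ c ∈ C.image σ := Finset.mem_image_of_mem σ hc
    have hspec := (Finset.mem_image.1 hx).choose_spec
    have := hg _ hspec.1 c hc hspec.2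
    rw [extendColour_apply _ (⟨_, hspec.1⟩ : C), extendColour_apply _ (⟨c, hc⟩ : C)] at this
    exact Fin.ext this
  · intro g _
    refine hG _ _ fun c hc => ?_
    have hx : σ c ∈ C.image σ := Finset.mem_image_of_mem σ hc
    rw [Function.comp_apply, extendColour_apply _ (⟨σ c, hx⟩ : C.image σ),
      extendColour_apply _ (⟨c, hc⟩ : C)]

theorem colourSum_insert {C : Finset ℕ} {c : ℕ} (hc : c ∉ C) (N : ℕ) {G : (ℕ → ℕ) → R}
    (hG : ∀ f f' : ℕ → ℕ, (∀ c ∈ C, f c = f' c) → G f = G f') :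
    colourSum (insert c C) N G = N * colourSum C N G := by
  have h1 : (N : R) * colourSum C N G = ∑ q : Fin N × (C → Fin N),
      G (extendColour fun c => (q.2 c : ℕ)) := by
    simp [Fintype.sum_prod_type, colourSum]
  rw [h1, colourSum]
  refine Finset.sum_bij (fun g _ => (g ⟨c, Finset.mem_insert_self _ _⟩,
    fun d : C => g ⟨d, Finset.mem_insert_of_mem d.2⟩)) (fun _ _ => Finset.mem_univ _) ?_ ?_ ?_
  · intro g _ g' _ h
    rw [Prod.mk.injEq] at h
    funext ⟨d, hd⟩
    obtain rfl | hd' := Finset.mem_insert.1 hd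
    · exact h.1
    · exact congrFun h.2 ⟨d, hd'⟩
  · rintro ⟨i, g⟩ _
    refine ⟨fun d => if h : d.1 ∈ C then g ⟨d, h⟩ else i, Finset.mem_univ _, ?_⟩
    rw [Prod.mk.injEq]
    refine ⟨by simp [hc], ?_⟩
    funext d
    simp
  · intro g _
    refine hG _ _ fun d hd => ?_
    rw [extendColour_apply _ (⟨d, hd⟩ : C),
      extendColour_apply _ (⟨d, Finset.mem_insert_of_mem hd⟩ : (insert c C : Finset ℕ))]

/-- The number of colourings with a given kernel. -/
theorem card_ker_eq {α : Type} [Fintype α] [DecidableEq α] (N : ℕ) (Q : Setoid α) :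
    Nat.card {g : α → Fin N // Setoid.ker g = Q} = N.descFactorial (Nat.card (Quotient Q)) := by
  classical
  have e : {g : α → Fin N // Setoid.ker g = Q} ≃ (Quotient Q ↪ Fin N) :=
    { toFun := fun g => ⟨Quotient.lift g.1 fun a b h => by
          have h' : Setoid.ker g.1 a b := by rw [g.2]; exact h
          exact h', by
          rintro ⟨a⟩ ⟨b⟩ h
          apply Quotient.sound
          have h' : Setoid.ker g.1 a b := h
          rwa [g.2] at h'⟩
      invFun := fun e => ⟨fun a => e (Quotient.mk Q a), by
        ext a b
        rw [Setoid.ker_def, e.injective.eq_iff, Quotient.eq]⟩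
      left_inv := fun g => rfl
      right_inv := fun e => by ext ⟨a⟩; rfl }
  rw [Nat.card_congr e, Nat.card_eq_fintype_card, Fintype.card_embedding_eq, Fintype.card_fin,
    Nat.card_eq_fintype_card]

theorem sum_ker {α : Type} [Fintype α] [DecidableEq α] [Fintype (Setoid α)] (N : ℕ) (H : Setoid α → R) :
    ∑ g : α → Fin N, H (Setoid.ker g) =
      ∑ Q : Setoid α, (N.descFactorial (Nat.card (Quotient Q)) : R) * H Q := by
  classical
  rw [← Finset.sum_fiberwise_of_maps_to (s := Finset.univ) (t := Finset.univ)
    (g := fun g : α → Fin N => Setoid.ker g) (fun _ _ => Finset.mem_univ _)]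
  refine Finset.sum_congr rfl fun Q _ => ?_
  rw [Finset.sum_congr rfl (g := fun _ => H Q) fun g hg => by rw [(Finset.mem_filter.1 hg).2],
    Finset.sum_const, nsmul_eq_mul, ← card_ker_eq, Nat.card_eq_fintype_card, Fintype.card_subtype]

/-! ### The polynomial of a tied diagram -/

/-- The sum of the values of all colourings of the components with `N` colours that only depend on
the ties. -/
noncomputable def totalValue (F : Diagram Unit → R) (N : ℕ) (w : List (Event ℕ)) : R :=
  colourSum (labelSet w) N fun f => colouredValue F N f w

/-- A colouring with a given kernel. -/
noncomputable def kernelColouring {C : Finset ℕ} (Q : Setoid C) : ℕ → ℕ :=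
  extendColour fun c => (Finite.equivFin (Quotient Q) (Quotient.mk Q c) : ℕ)

theorem kernelColouring_eq_iff {C : Finset ℕ} (Q : Setoid C) (c d : C) :
    kernelColouring Q c = kernelColouring Q d ↔ Q c d := by
  rw [kernelColouring, extendColour_apply, extendColour_apply, Fin.val_inj,
    (Finite.equivFin _).injective.eq_iff, Quotient.eq]

noncomputable instance (C : Finset ℕ) : Fintype (Setoid C) :=
  have : Finite (Setoid C) := Finite.of_injective (fun Q : Setoid C => fun c d => Q c d)
    fun _ _ h => Setoid.ext fun c d => iff_of_eq (congrFun (congrFun h c) d)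
  Fintype.ofFinite _

open Polynomial in
/-- The polynomial whose value at `N` times the value of a circle counts colourings with `N`
colours. -/
noncomputable def tiedPolynomial (P : SkeinParams R) (F : Diagram Unit → R) (w : List (Event ℕ)) :
    R[X] :=
  ∑ Q : Setoid (labelSet w), C (partitionValue F (kernelColouring Q) w) *
    ∏ j ∈ Finset.range (Nat.card (Quotient Q) - 1), (X - C ((j + 1 : ℕ) * P.circle))

/-- This turns the number of colourings into a polynomial in `N * y`. Its factor for `j = 0` is the
variable itself, which `tiedPolynomial` omits. -/
theorem prod_sub_mul_eq (y : R) (N m : ℕ) :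
    ∏ j ∈ Finset.range m, ((N : R) * y - (j : R) * y) = y ^ m * (N.descFactorial m : R) := by
  induction m with
  | zero => simp
  | succ m ih =>
    rw [Finset.prod_range_succ, ih, Nat.descFactorial_succ]
    obtain h | h := le_or_gt m N
    · push_cast [Nat.cast_sub h]; ring
    · simp [Nat.descFactorial_of_lt h]

/-- A partition into `m` classes is the kernel of `N (N - 1) ⋯ (N - m + 1)` colourings, each
contributing `y ^ m` times its partition value. Dividing by the common factor `N * y` normalises a
single circle to `1`. -/
theorem eval_tiedPolynomial {P : SkeinParams R} {F : Diagram Unit → R} (hF : KauffmanRules P F)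
    (N : ℕ) (D : Diagram ℕ) :
    (N * P.circle) * (tiedPolynomial P F D.word).eval (N * P.circle) = totalValue F N D.word := by
  classical
  -- A diagram has at least one colour, hence every partition has at least one class and the
  -- truncated `- 1` in `tiedPolynomial` is harmless.
  have hne : Nonempty (labelSet D.word) := by
    obtain ⟨e, w, h⟩ := List.exists_cons_of_ne_nil D.word_ne_nil
    obtain ⟨c, hc⟩ : ∃ c, c ∈ e.labels := by cases e <;> simp [labels]
    exact ⟨⟨c, mem_labelSet.2 ⟨e, by simp [h], hc⟩⟩⟩
  have h1 : totalValue F N D.word = ∑ g : labelSet D.word → Fin N,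
      (fun Q : Setoid (labelSet D.word) => P.circle ^ Nat.card (Quotient Q) *
        partitionValue F (kernelColouring Q) D.word) (Setoid.ker g) := by
    refine Finset.sum_congr rfl fun g _ => ?_
    dsimp only
    have happ := extendColour_apply (C := labelSet D.word) fun c => (g c : ℕ)
    rw [colouredValue_eq hF fun c hc => by rw [happ ⟨c, hc⟩]; exact (g _).2]
    congr 1
    · congr 1
      rw [Nat.card_congr (Setoid.quotientKerEquivRange g), Nat.card_coe_set_eq,
        ← Set.ncard_image_of_injective (Set.range g) Fin.val_injective, ← Set.ncard_coe_finset]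
      congr 1
      ext i
      simp only [Finset.coe_image, Set.mem_image, Finset.mem_coe, Set.mem_range,
        exists_exists_eq_and]
      exact ⟨fun ⟨c, hc, h⟩ => ⟨⟨c, hc⟩, by rw [← h, happ ⟨c, hc⟩]⟩,
        fun ⟨c, h⟩ => ⟨c, c.2, by rw [← h, happ]⟩⟩
    · refine partitionValue_congr_ker D.isTangle fun c hc d hd => ?_
      rw [happ ⟨c, hc⟩, happ ⟨d, hd⟩, kernelColouring_eq_iff _ ⟨c, hc⟩ ⟨d, hd⟩, Fin.val_inj]
      rfl
  rw [h1, sum_ker N (fun Q : Setoid (labelSet D.word) => P.circle ^ Nat.card (Quotient Q) *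
    partitionValue F (kernelColouring Q) D.word), tiedPolynomial, Polynomial.eval_finsetSum, Finset.mul_sum]
  refine Finset.sum_congr rfl fun Q _ => ?_
  obtain ⟨m, hm⟩ : ∃ m, Nat.card (Quotient Q) = m + 1 :=
    have : Nonempty (Quotient Q) := hne.map (Quotient.mk Q)
    Nat.exists_eq_succ_of_ne_zero Nat.card_pos.ne'
  have := prod_sub_mul_eq P.circle N (m + 1)
  rw [Finset.prod_range_succ'] at this
  rw [hm]
  simp only [Polynomial.eval_mul, Polynomial.eval_C, Polynomial.eval_prod, Polynomial.eval_sub,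
    Polynomial.eval_X, Nat.add_sub_cancel]
  simp only [Nat.cast_zero, zero_mul, sub_zero] at this
  linear_combination partitionValue F (kernelColouring Q) D.word * this

theorem polynomial_ext [IsDomain R] [CharZero R] {y : R} (hy : y ≠ 0) {p q : Polynomial R}
    (h : ∀ N : ℕ, (N * y) * p.eval (N * y) = (N * y) * q.eval (N * y)) : p = q := by
  -- `N = 0` carries no information because of the factor `N * y`, so the points start at `N + 1`.
  refine Polynomial.eq_of_infinite_eval_eq p q (Set.infinite_of_injective_forall_mem
    (f := fun N : ℕ => ((N + 1 : ℕ) : R) * y) ?_ fun N => ?_)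
  · intro N M hNM
    have := mul_right_cancel₀ hy hNM
    have := Nat.cast_injective this
    omega
  · exact mul_left_cancel₀ (mul_ne_zero (Nat.cast_ne_zero.2 N.succ_ne_zero) hy) (h (N + 1))

end TiedLinks

/-! ### The tied rules for the sum over all colourings -/

namespace TiedLinks

open StrandLabel Event

variable {R : Type} [CommRing R]

/-! ### The rules for the sum over colourings -/

theorem labelSet_map (w : List (Event ℕ)) (σ : ℕ → ℕ) :
    labelSet (w.map (Event.map σ)) = (labelSet w).image σ := by
  have h (e : Event ℕ) : (e.map σ).labels = e.labels.map σ := by cases e <;> rfl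
  ext c
  simp only [mem_labelSet, Finset.mem_image, List.mem_map, exists_exists_and_eq_and, h]
  tauto

theorem IsTangle.labelSet_append {u s v : List (Event ℕ)} {S : List ℕ}
    (hu : IsTangle u [] S) {t : List (Event ℕ)}
    (ht : labelSet t ⊆ labelSet s) (hst : ∀ c ∈ labelSet s, c ∈ labelSet t ∨ c ∈ S) :
    labelSet (u ++ s ++ v) = labelSet (u ++ t ++ v) := by
  ext c
  simp only [TiedLinks.labelSet_append, Finset.mem_union]
  have h1 := @hst c
  have h2 := @ht c
  have h3 := fun h => (hu.mem_labelSet_top (c := c) h).resolve_right (by simp)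
  tauto

theorem RegularMove.labelSet_eq {D D' : Diagram ℕ} (h : RegularMove D D') :
    labelSet D.word = labelSet D'.word := by
  cases h with
  | isotopy u s t v h hD hD' =>
    have hT := D.isTangle
    rw [hD] at hT
    obtain ⟨S₂, h12, h3⟩ := hT.split
    obtain ⟨S₁, h1, h2⟩ := h12.split
    have := h.labelSet_subset h2
    rw [hD, hD']
    exact h1.labelSet_append this.1 this.2
  | sphere t x ht hD hD' =>
    have h (f : Event ℕ) (k : ℕ) : (f.shift k).labels = f.labels := by cases f <;> rfl
    rw [hD, hD']
    simp only [labelSet, List.flatMap_append, List.flatMap_map, h]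
    rfl

theorem totalValue_map (F : Diagram Unit → R) (N : ℕ) (w : List (Event ℕ)) {σ : ℕ → ℕ}
    (hσ : Function.Injective σ) :
    totalValue F N (w.map (Event.map σ)) = totalValue F N w := by
  classical
  rw [totalValue, labelSet_map, totalValue]
  simp only [colouredValue_map]
  rw [colourSum_image (labelSet w) N σ (G := fun f => colouredValue F N f w)
    fun f f' => colouredValue_congr]
  refine colourSum_congr fun f _ => if_pos ?_
  rintro c - d - h
  rw [hσ h]

section

variable {P : SkeinParams R} {F : Diagram Unit → R} (hF : KauffmanRules P F)

include hF

theorem totalValue_regular (N : ℕ) {D D' : Diagram ℕ} (h : RegularMove D D') :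
    totalValue F N D.word = totalValue F N D'.word := by
  rw [totalValue, totalValue, h.labelSet_eq]
  exact colourSum_congr fun f _ => colouredValue_regular hF N f h

theorem totalValue_circle (N c : ℕ) : totalValue F N [cup 0 c, cap 0 c] = N * P.circle := by
  have hC : labelSet [cup 0 c, cap 0 c] = insert c ∅ := by
    ext; simp [mem_labelSet, labels]
  rw [totalValue, hC, colourSum_congr (G' := fun _ => P.circle), colourSum_insert (by simp) N
    fun _ _ _ => rfl]
  · simp [colourSum]
  · intro f hf
    have := colouredValue_circle hF (N := N) (f := f) (IsTangle.nil []) (hf c (by simp))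
    simpa [colouredValue_nil hF] using this

theorem totalValue_disjointCircle (N : ℕ) {w : List (Event ℕ)} {c : ℕ} (hw : IsTangle w [] [])
    (hc : c ∉ labelSet w) :
    totalValue F N (w ++ [cup 0 c, cap 0 c]) = N * P.circle * totalValue F N w := by
  have hC : labelSet (w ++ [cup 0 c, cap 0 c]) = insert c (labelSet w) := by
    ext d
    rw [labelSet_append]
    simp [mem_labelSet, labels, or_comm]
  rw [totalValue, hC, colourSum_congr (G' := fun f => P.circle * colouredValue F N f w),
    colourSum_insert hc N fun f f' h => by rw [colouredValue_congr h], colourSum_mul, totalValue,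
    mul_assoc]
  exact fun f hf => colouredValue_circle hF hw (hf c (by simp))

theorem totalValue_curl (N : ℕ) {b : Bool} {u k v : List (Event ℕ)}
    (h : IsCurl b k) (hT : IsTangle (u ++ k ++ v) [] []) (hT' : IsTangle (u ++ v) [] []) :
    totalValue F N (u ++ k ++ v) = P.curl b * totalValue F N (u ++ v) := by
  obtain ⟨S₂, h12, h3⟩ := hT.split
  obtain ⟨S₁, h1, h2⟩ := h12.split
  have hC : labelSet (u ++ k ++ v) = labelSet (u ++ v) := by
    obtain ⟨x, hx, hxS, -, -⟩ := restrict_curl h h2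
    have := h1.labelSet_append (v := v) (s := k) (t := []) (by simp [labelSet]) fun c hc => by
      rw [hx, Finset.mem_singleton] at hc
      exact .inr (hc ▸ hxS)
    rw [this, List.append_nil]
  rw [totalValue, totalValue, hC, ← colourSum_mul]
  exact colourSum_congr fun f hf => colouredValue_curl hF h hT hT' fun c hc =>
    hf c (by rw [← hC]; simp [labelSet_append, hc])

/-- Colourings that distinguish `c` and `d` cancel on the left by the sign. Those that do not are
precisely the colourings of the diagrams with `c` and `d` merged, and they satisfy Kauffman's skein
rule one by one. -/
theorem totalValue_skein (N : ℕ) {q c d : ℕ} {u v : List (Event ℕ)}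
    (hT : IsTangle (u ++ [cross q true c d] ++ v) [] [])
    (hT' : IsTangle (u ++ [cross q false c d] ++ v) [] []) :
    totalValue F N (u ++ [cross q true c d] ++ v) + totalValue F N (u ++ [cross q false c d] ++ v) =
    P.z * (totalValue F N ((u ++ v).map (Event.map (mergeColour c d))) +
      totalValue F N ((u ++ [cap q c, cup q c] ++ v).map (Event.map (mergeColour c d)))) := by
  classical
  obtain ⟨S₂, h12, h3⟩ := hT.split
  obtain ⟨S₁, h1, h2⟩ := h12.split
  have hc : c ∈ S₁ ∧ d ∈ S₁ := by
    obtain ⟨l, r, hl, rfl, rfl⟩ := step_iff.1 (isTangle_singleton.1 h2)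
    simp [ins]
  -- The strands at the crossing were created below it, starting from the empty row. So all four
  -- diagrams have the same colours before merging.
  have hu : c ∈ labelSet u ∧ d ∈ labelSet u :=
    ⟨(h1.mem_labelSet_top hc.1).resolve_right (by simp),
      (h1.mem_labelSet_top hc.2).resolve_right (by simp)⟩
  have hC : c ∈ labelSet (u ++ v) ∧ d ∈ labelSet (u ++ v) := by
    simp [labelSet_append, hu]
  have hx (b : Bool) : labelSet (u ++ [cross q b c d] ++ v) = labelSet (u ++ v) := by
    have : labelSet [cross q b c d] ⊆ labelSet u := by
      intro e; simp [mem_labelSet, labels]; rintro (rfl | rfl)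
      · exact mem_labelSet.1 hu.1
      · exact mem_labelSet.1 hu.2
    simp only [labelSet_append, Finset.union_eq_left.2 this]
  have hi : labelSet (u ++ [cap q c, cup q c] ++ v) = labelSet (u ++ v) := by
    have : labelSet [cap q c, cup q c] ⊆ labelSet u := by
      intro e; simp [mem_labelSet, labels]; rintro rfl
      exact mem_labelSet.1 hu.1
    simp only [labelSet_append, Finset.union_eq_left.2 this]
  have hfib (f : ℕ → ℕ) : (∀ a ∈ labelSet (u ++ v), ∀ b ∈ labelSet (u ++ v),
      mergeColour c d a = mergeColour c d b → f a = f b) ↔ f c = f d := by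
    constructor
    · intro h
      exact h c hC.1 d hC.2 (by simp [mergeColour])
    · intro h a _ b _ hab
      unfold mergeColour at hab
      split_ifs at hab with h1 h2 h2 <;> simp_all
  have hm (w : List (Event ℕ)) (hw : labelSet w = labelSet (u ++ v)) :
      totalValue F N (w.map (Event.map (mergeColour c d))) =
        colourSum (labelSet (u ++ v)) N fun f => if f c = f d then colouredValue F N f w else 0 := by
    rw [totalValue, labelSet_map, hw]
    simp only [colouredValue_map]
    rw [colourSum_image (labelSet (u ++ v)) N (mergeColour c d)
      (G := fun f => colouredValue F N f w) fun f f' h => colouredValue_congr (hw ▸ h)]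
    simp only [hfib]
  rw [totalValue, totalValue, hx, hx, hm _ rfl, hm _ hi, ← colourSum_add, ← colourSum_add,
    ← colourSum_mul]
  refine colourSum_congr fun f hf => ?_
  by_cases h : f c = f d
  · rw [if_pos h, if_pos h]
    exact colouredValue_skein_of_eq hF hT hT' h (hf c hC.1)
  · rw [if_neg h, if_neg h, colouredValue_skein_of_ne hT hT' h, add_zero, mul_zero]

end

end TiedLinks

/-! ### Comparison of the two polynomials -/

namespace TiedLinks

open StrandLabel Event

/-! ### The coefficient rings -/

theorem aPow_mul_inv : aPow 1 * aPow (-1) = 1 := by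
  simp only [aPow, ← LaurentPolynomial.T_add]; simp

theorem zPow_mul_inv : zPow 1 * zPow (-1) = 1 := by
  simp only [zPow, ← map_mul, ← LaurentPolynomial.T_add]; simp

/-- Otherwise `a + a⁻¹ = z`, but the coefficients of `a` on the two sides are `1` and `0`. -/
theorem yElt_ne_zero : yElt ≠ 0 := by
  intro h
  have h2 : aPow 1 + aPow (-1) = zPow 1 := by
    unfold yElt at h
    linear_combination zPow 1 * h - (aPow 1 + aPow (-1)) * zPow_mul_inv
  have := congrArg (fun q : KRing => q.coeff 1) h2
  simp [aPow, zPow] at this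

theorem laurentPolynomial_C_injective {R : Type} [CommRing R] :
    Function.Injective (LaurentPolynomial.C : R →+* LaurentPolynomial R) := by
  intro r s h
  have := congrArg (fun q : LaurentPolynomial R => q.coeff 0) h
  simpa using this

instance : CharZero KRing where
  cast_injective := by
    have h : Function.Injective fun n : ℕ =>
        (LaurentPolynomial.C (LaurentPolynomial.C (n : ℤ)) : KRing) :=
      laurentPolynomial_C_injective.comp
        (laurentPolynomial_C_injective.comp Nat.cast_injective)
    simpa using h

/-- The parameters of the Kauffman polynomial. -/
noncomputable def kauffmanParams : SkeinParams KRing where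
  a := aPow 1
  aInv := aPow (-1)
  z := zPow 1
  zInv := zPow (-1)
  mul_aInv := aPow_mul_inv
  mul_zInv := zPow_mul_inv

theorem kauffmanParams_circle : kauffmanParams.circle = yElt := rfl

theorem kauffmanParams_curl (b : Bool) : kauffmanParams.curl b = aPow (curlSign b) := by
  cases b <;> rfl

/-- The image of the parameters under a ring homomorphism. -/
def SkeinParams.map {R S : Type} [CommRing R] [CommRing S] (P : SkeinParams R) (φ : R →+* S) :
    SkeinParams S where
  a := φ P.a
  aInv := φ P.aInv
  z := φ P.z
  zInv := φ P.zInv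
  mul_aInv := by rw [← map_mul, P.mul_aInv, map_one]
  mul_zInv := by rw [← map_mul, P.mul_zInv, map_one]

section

variable {R S : Type} [CommRing R] [CommRing S]

theorem SkeinParams.map_curl (P : SkeinParams R) (φ : R →+* S) (b : Bool) :
    (P.map φ).curl b = φ (P.curl b) := by
  cases b <;> rfl

theorem SkeinParams.map_circle (P : SkeinParams R) (φ : R →+* S) :
    (P.map φ).circle = φ P.circle := by
  simp [SkeinParams.circle, SkeinParams.map]

theorem SkeinParams.map_map_of_leftInverse (P : SkeinParams R) {φ : R →+* S} {ψ : S →+* R}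
    (h : ∀ r, ψ (φ r) = r) : (P.map φ).map ψ = P := by
  cases P; simp [SkeinParams.map, h]

theorem KauffmanRules.map {P : SkeinParams R} {F : Diagram Unit → R} (hF : KauffmanRules P F)
    (φ : R →+* S) : KauffmanRules (P.map φ) fun D => φ (F D) where
  circle D h := by rw [hF.circle D h, map_one]
  regular D D' h := by rw [hF.regular D D' h]
  curl D D' b u k v h h1 h2 := by rw [hF.curl D D' b u k v h h1 h2, map_mul, P.map_curl]
  skein Dp Dm D0 Dinf p u v h1 h2 h3 h4 := by
    rw [← map_add, hF.skein Dp Dm D0 Dinf p u v h1 h2 h3 h4, map_mul, map_add]; rfl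

end

theorem isKauffman_iff {F : Diagram Unit → KRing} :
    IsKauffman F ↔ KauffmanRules kauffmanParams F := by
  constructor
  · exact fun h => ⟨h.circle, h.regular, fun D D' b u k v h1 h2 h3 => by
      rw [kauffmanParams_curl]; exact h.curl D D' b u k v h1 h2 h3, h.skein⟩
  · exact fun h => ⟨h.circle, h.regular, fun D D' b u k v h1 h2 h3 => by
      rw [← kauffmanParams_curl]; exact h.curl D D' b u k v h1 h2 h3, h.skein⟩

/-! ### Existence of the tied polynomial -/

/-- Each rule is checked at all points `x⁻¹ = N * y`, where it becomes the corresponding rule for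
`totalValue`. -/
theorem isTiedKauffman_tiedPolynomial {F : Diagram Unit → KRing}
    (hF : KauffmanRules kauffmanParams F) :
    IsTiedKauffman fun D => tiedPolynomial kauffmanParams F D.word where
  rename D f hf := by
    refine polynomial_ext yElt_ne_zero fun N => ?_
    have h1 := eval_tiedPolynomial hF N (D.map f fun _ => rfl)
    have h2 := eval_tiedPolynomial hF N D
    rw [kauffmanParams_circle] at h1 h2
    rw [h1, h2]
    exact totalValue_map F N D.word hf
  circle D c h := by
    refine polynomial_ext yElt_ne_zero fun N => ?_
    have h1 := eval_tiedPolynomial hF N D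
    rw [h, totalValue_circle hF, kauffmanParams_circle] at h1
    rw [h, Polynomial.eval_one, mul_one, h1]
  disjointCircle D D' c hc h := by
    refine polynomial_ext yElt_ne_zero fun N => ?_
    have h1 := eval_tiedPolynomial hF N D'
    have h2 := eval_tiedPolynomial hF N D
    rw [h, totalValue_disjointCircle hF N D.isTangle
      (by rw [mem_labelSet]; rintro ⟨e, he, hce⟩; exact hc e he hce), ← h2, ← h] at h1
    simp only [kauffmanParams_circle] at h1
    rw [h1, Polynomial.eval_mul, Polynomial.eval_X]
  regular D D' h := by
    refine polynomial_ext yElt_ne_zero fun N => ?_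
    have h1 := eval_tiedPolynomial hF N D'
    have h2 := eval_tiedPolynomial hF N D
    rw [kauffmanParams_circle] at h1 h2
    rw [h1, h2, totalValue_regular hF N h]
  curl D D' b u k v hk h h' := by
    refine polynomial_ext yElt_ne_zero fun N => ?_
    have h1 := eval_tiedPolynomial hF N D
    have h2 := eval_tiedPolynomial hF N D'
    rw [kauffmanParams_circle] at h1 h2
    have h3 := totalValue_curl hF N hk (h ▸ D.isTangle) (h' ▸ D'.isTangle)
    rw [← h, ← h', kauffmanParams_curl] at h3
    rw [Polynomial.eval_mul, Polynomial.eval_C, mul_left_comm, h1, h2, h3]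
  skein Dp Dm De Df p c d u v hp hm he hf := by
    refine polynomial_ext yElt_ne_zero fun N => ?_
    have h1 := eval_tiedPolynomial hF N Dp
    have h2 := eval_tiedPolynomial hF N Dm
    have h3 := eval_tiedPolynomial hF N De
    have h4 := eval_tiedPolynomial hF N Df
    rw [kauffmanParams_circle] at h1 h2 h3 h4
    have h5 := totalValue_skein hF N (hp ▸ Dp.isTangle) (hm ▸ Dm.isTangle)
    rw [← hp, ← hm, ← he, ← hf] at h5
    rw [Polynomial.eval_mul, Polynomial.eval_C, Polynomial.eval_add, Polynomial.eval_add,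
      mul_add, h1, h2, mul_left_comm, mul_add, h3, h4, h5]
    rfl

/-! ### Diagrams with a single colour -/

section

variable {X Y : Type}

theorem Event.map_shift (f : X → Y) (k : ℕ) (e : Event X) :
    (e.shift k).map f = (e.map f).shift k := by
  cases e <;> rfl

theorem Event.pos_map (f : X → Y) (e : Event X) : (e.map f).pos = e.pos := by
  cases e <;> rfl

theorem Event.inArity_map (f : X → Y) (e : Event X) : (e.map f).inArity = e.inArity := by
  cases e <;> rfl

theorem Event.outArity_map (f : X → Y) (e : Event X) : (e.map f).outArity = e.outArity := by
  cases e <;> rfl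

variable [StrandLabel X] [StrandLabel Y] {f : X → Y} (hf : ∀ x, f (rev x) = rev (f x))

include hf

theorem LocalMove.map {s t : List (Event X)} (h : LocalMove s t) :
    LocalMove (s.map (Event.map f)) (t.map (Event.map f)) := by
  cases h with
  | far e e' =>
    simpa [Event.map_shift, Event.pos_map, Event.inArity_map, Event.outArity_map] using
      LocalMove.far (e.map f) (e'.map f)
  | zigzagLeft p x => simpa [Event.map, hf] using LocalMove.zigzagLeft p (f x)
  | zigzagRight p x => simpa [Event.map, hf] using LocalMove.zigzagRight p (f x)
  | crossCup p b x y => simpa [Event.map, hf] using LocalMove.crossCup p b (f x) (f y)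
  | crossCap p b x y => simpa [Event.map, hf] using LocalMove.crossCap p b (f x) (f y)
  | reidemeister2 p b x y => simpa [Event.map] using LocalMove.reidemeister2 p b (f x) (f y)
  | reidemeister3 p b₁ b₂ b₃ x y w hb =>
    simpa [Event.map] using LocalMove.reidemeister3 p b₁ b₂ b₃ (f x) (f y) (f w) hb

theorem RegularMove.map {D D' : Diagram X} (h : RegularMove D D') :
    RegularMove (D.map f hf) (D'.map f hf) := by
  cases h with
  | isotopy u s t v h hD hD' =>
    exact .isotopy _ _ (u.map (Event.map f)) _ _ (v.map (Event.map f)) (h.map hf)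
      (by simp [Diagram.map, hD]) (by simp [Diagram.map, hD'])
  | sphere t x ht hD hD' =>
    refine .sphere _ _ (t.map (Event.map f)) (f x) (ht.map hf)
      (by simp [Diagram.map, hD, Event.map]) ?_
    have h : (t.map (Event.shift 1)).map (Event.map f) =
        (t.map (Event.map f)).map (Event.shift 1) := by
      simp only [List.map_map, Function.comp_def, Event.map_shift]
    simp only [Diagram.map, hD', List.map_append, h, ← hf]
    rfl

theorem IsCurl.map {b : Bool} {k : List (Event X)} (h : IsCurl b k) :
    IsCurl b (k.map (Event.map f)) := by
  cases h with
  | right p _ x => simpa [Event.map] using IsCurl.right p b (f x)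
  | left p _ x => simpa [Event.map, hf] using IsCurl.left p b (f x)

end

/-- The tied diagram all of whose components have the colour `c`. -/
def Diagram.monochrome (c : ℕ) (D : Diagram Unit) : Diagram ℕ := D.map (fun _ => c) fun _ => rfl

theorem map_mergeColour_const (c : ℕ) (w : List (Event Unit)) :
    (w.map (Event.map fun _ => c)).map (Event.map (mergeColour c c)) =
      w.map (Event.map fun _ => c) := by
  rw [List.map_map]
  refine List.map_congr_left fun e _ => ?_
  cases e <;> simp [Event.map, mergeColour]

/-- With both strands of the same colour the merging is the identity, so the tied skein rule has no
effect beyond Kauffman's. The untied circle and renaming rules are not needed. -/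
theorem IsTiedKauffman.monochrome {G : Diagram ℕ → TRing} (hG : IsTiedKauffman G) (c : ℕ) :
    KauffmanRules (kauffmanParams.map Polynomial.C) fun D => G (D.monochrome c) where
  circle D h := hG.circle _ c (by simp [Diagram.monochrome, Diagram.map, h, Event.map])
  regular D D' h := hG.regular _ _ (h.map _)
  curl D D' b u k v hk h h' := by
    rw [SkeinParams.map_curl, kauffmanParams_curl]
    exact hG.curl _ _ b (u.map (Event.map fun _ => c)) _ (v.map (Event.map fun _ => c))
      (hk.map (f := fun _ => c) fun _ => rfl)
      (by simp [Diagram.monochrome, Diagram.map, h])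
      (by simp [Diagram.monochrome, Diagram.map, h'])
  skein Dp Dm D0 Dinf p u v hp hm h0 hinf := by
    refine hG.skein _ _ _ _ p c c (u.map (Event.map fun _ => c)) (v.map (Event.map fun _ => c))
      ?_ ?_ ?_ ?_
    · simp [Diagram.monochrome, Diagram.map, hp, Event.map]
    · simp [Diagram.monochrome, Diagram.map, hm, Event.map]
    · rw [← List.map_append, map_mergeColour_const, ← h0]; rfl
    · have := map_mergeColour_const c Dinf.word
      rw [hinf] at this
      simp only [Diagram.monochrome, Diagram.map, hinf]
      rw [← this]
      simp [Event.map]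

theorem IsTiedKauffman.monochrome_eq {G : Diagram ℕ → TRing} (hG : IsTiedKauffman G)
    {F : Diagram Unit → KRing} (hF : IsKauffman F) (c : ℕ) (D : Diagram Unit) :
    G (D.monochrome c) = Polynomial.C (F D) := by
  have h := (isKauffman_iff.1 hF).map (S := TRing) Polynomial.C
  refine congrFun (KauffmanRules.unique ?_ (hG.monochrome c) h) D
  rw [SkeinParams.map_circle, kauffmanParams_circle]
  exact Polynomial.C_ne_zero.2 yElt_ne_zero

/-- Any retraction of `Polynomial.C` would do in place of evaluation at `0`: it carries the
parameters back to those of `KRing`. -/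
theorem IsTiedKauffman.isKauffman {G : Diagram ℕ → TRing} (hG : IsTiedKauffman G) :
    IsKauffman fun D => Polynomial.evalRingHom 0 (G (D.monochrome 0)) := by
  have := (hG.monochrome 0).map (Polynomial.evalRingHom (0 : KRing))
  rwa [SkeinParams.map_map_of_leftInverse _ fun r => by simp, ← isKauffman_iff] at this

/-- Solutions of the two systems exist together. If they do, the values of any two chosen ones agree
by uniqueness; if not, both functions are zero by definition. -/
theorem tiedKauffman_monochrome (c : ℕ) (D : Diagram Unit) :
    tiedKauffman (D.monochrome c) = Polynomial.C (kauffman D) := by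
  by_cases h : ∃ F, IsKauffman F
  · have h' : ∃ G, IsTiedKauffman G :=
      h.imp' _ fun F hF => isTiedKauffman_tiedPolynomial (isKauffman_iff.1 hF)
    rw [tiedKauffman, dif_pos h', kauffman, dif_pos h]
    exact h'.choose_spec.monochrome_eq h.choose_spec c D
  · have h' : ¬ ∃ G, IsTiedKauffman G := fun ⟨G, hG⟩ => h ⟨_, hG.isKauffman⟩
    rw [tiedKauffman, dif_neg h', kauffman, dif_neg h]
    simp

theorem AllTied.exists_monochrome {D : Diagram (ℕ × Dir)} (hD : AllTied D) :
    ∃ c, unorientTied D = (unorient (forgetTies D)).monochrome c := by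
  obtain ⟨c, hc⟩ := hD
  refine ⟨c, ?_⟩
  have h : D.word.map (Event.map Prod.fst) =
      ((D.word.map (Event.map Prod.snd)).map (Event.map fun _ => ())).map
        (Event.map fun _ => c) := by
    rw [List.map_map, List.map_map]
    refine List.map_congr_left fun e he => ?_
    have := hc e he
    cases e <;> simp_all [labels, Event.map]
  simp only [unorientTied, unorient, forgetTies, Diagram.monochrome, Diagram.map, h]

end TiedLinks

theorem mainTheorem8 (D : TiedLinks.Diagram (ℕ × TiedLinks.Dir)) (hD : TiedLinks.AllTied D) :
    TiedLinks.orientedTiedKauffman D =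
        Polynomial.C (TiedLinks.orientedKauffman (TiedLinks.forgetTies D)) ∧
      Polynomial.eval TiedLinks.yElt (TiedLinks.orientedTiedKauffman D) =
        TiedLinks.orientedKauffman (TiedLinks.forgetTies D) := by
  have h : TiedLinks.orientedTiedKauffman D =
      Polynomial.C (TiedLinks.orientedKauffman (TiedLinks.forgetTies D)) := by
    obtain ⟨c, hc⟩ := hD.exists_monochrome
    -- Both normalisations use the writhe of the same diagram with the ties forgotten, so the factor
    -- passes through `Polynomial.C`.
    rw [TiedLinks.orientedTiedKauffman, hc, TiedLinks.tiedKauffman_monochrome, ← map_mul]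
    rfl
  exact ⟨h, by rw [h, Polynomial.eval_C]⟩
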